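/- Let $M$ be a connected smooth manifold (without boundary, Hausdorff, second countable) and let $(E,g)$ be a sub-Riemannian structure on $M$: $E\subseteq TM$ is a smooth subbundle and $g$ is a smooth positive definite metric tensor on $E$. For $k\ge 0$ let $E^{-k}_x\subseteq T_xM$ be the span of the values at $x$ of all iterated brackets $[X_1,[X_2,\dots,[X_{j-1},X_j]\cdots]]$ with $1\le j\le k$ and $X_i\in\Gamma(E)$ (so $E^0=0$, $E^{-1}=E$). Assume that $E$ is bracket-generating (these brackets span $TM$) and equiregular (every $E^{-k}$ is a smooth subbundle of $TM$), and let $s$ be the least integer with $E^{-s}=TM$. Let $\mathrm{gr}=\mathrm{gr}(E)=\bigoplus_{k=1}^{s}\mathrm{gr}_{-k}$ with $\mathrm{gr}_{-k}=E^{-k}/E^{-k+1}$ be the nonholonomic tangent bundle. Each fiber $\mathrm{gr}_x$ carries the graded Lie bracket determined by $$[\![\,X_x \bmod E_x^{-i+1},\ Y_x \bmod E_x^{-j+1}\,]\!]=[X,Y]|_x \bmod E_x^{-i-j+1},\qquad X\in\Gamma(E^{-i}),\ Y\in\Gamma(E^{-j}),$$ and the inner product $g_x$ on $\mathrm{gr}_{x,-1}=E_x$.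 A Carnot algebra is a finite-dimensional real graded Lie algebra $\mathfrak g_-=\mathfrak g_{-s'}\oplus\cdots\oplus\mathfrak g_{-1}$ with $[\mathfrak g_{-1},\mathfrak g_{-k}]=\mathfrak g_{-k-1}$ for $1\le k<s'$ and $[\mathfrak g_{-1},\mathfrak g_{-s'}]=0$, together with an inner product on $\mathfrak g_{-1}$; an isometry is a Lie algebra isomorphism that maps the degree $-1$ part isometrically onto the degree $-1$ part. $(M,E,g)$ has constant symbol if there is a Carnot algebra $\mathfrak g_-$ such that $\mathrm{gr}_x$ is isometric to $\mathfrak g_-$ for every $x\in M$. A connection $\nabla$ on the vector bundle $\mathrm{gr}$ is called strongly compatible if each $\mathrm{gr}_{-k}$ is parallel, the restriction of $\nabla$ to $\mathrm{gr}_{-1}=E$ satisfies $Y\langle A,B\rangle_g=\langle\nabla_YA,B\rangle_g+\langle A,\nabla_YB\rangle_g$ for $Y\in\Gamma(TM)$, $A,B\in\Gamma(E)$, and $$\nabla_Y[\![A,B]\!]=[\![\nabla_YA,B]\!]+[\![A,\nabla_YB]\!]\qquad\text{for all } Y\in\Gamma(TM),\ A,B\in\Gamma(\mathrm{gr}).$$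 **Proposition.** There exists a strongly compatible connection on $\mathrm{gr}(E)$ if and only if $(M,E,g)$ has constant symbol. -/

import Mathlib

open scoped Manifold ContDiff Topology DirectSum

noncomputable section

namespace SubRiemannian

section Fields

variable {n : ℕ} {M : Type*} [TopologicalSpace M] [ChartedSpace (EuclideanSpace ℝ (Fin n)) M]

/-- A (not necessarily smooth) vector field on the `n`-dimensional manifold `M`. -/
abbrev VField (n : ℕ) (M : Type*) [TopologicalSpace M]
    [ChartedSpace (EuclideanSpace ℝ (Fin n)) M] : Type _ :=
  ∀ x : M, TangentSpace (𝓡 n) x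

/-- A (not necessarily smooth or constant rank) distribution: a subspace of each tangent space. -/
abbrev Distribution (n : ℕ) (M : Type*) [TopologicalSpace M]
    [ChartedSpace (EuclideanSpace ℝ (Fin n)) M] : Type _ :=
  ∀ x : M, Submodule ℝ (TangentSpace (𝓡 n) x)

variable [IsManifold (𝓡 n) ∞ M]

/-- The vector field `X` is smooth on the set `U`. -/
def SmoothOn (X : VField n M) (U : Set M) : Prop :=
  ContMDiffOn (𝓡 n) (𝓡 n).tangent ∞ (fun x => (⟨x, X x⟩ : TangentBundle (𝓡 n) M)) U

/-- `X ∈ Γ(TM)`. -/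
def IsSmooth (X : VField n M) : Prop :=
  ContMDiff (𝓡 n) (𝓡 n).tangent ∞ (fun x => (⟨x, X x⟩ : TangentBundle (𝓡 n) M))

/-- `X ∈ Γ(D)`: a global smooth vector field with values in `D`. -/
structure IsSection (D : Distribution n M) (X : VField n M) : Prop where
  smooth : IsSmooth X
  mem : ∀ x, X x ∈ D x

/-- `D` is a smooth subbundle of `TM`: around each point it has a smooth local frame. -/
def IsSubbundle (D : Distribution n M) : Prop :=
  ∀ x₀ : M, ∃ U : Set M, IsOpen U ∧ x₀ ∈ U ∧ ∃ (r : ℕ) (X : Fin r → VField n M),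
    (∀ i, SmoothOn (X i) U) ∧
    ∀ x ∈ U, LinearIndependent ℝ (fun i => X i x) ∧
      Submodule.span ℝ (Set.range fun i => X i x) = D x

/-- `IsIteratedBracket D j Z`: the vector field `Z` equals `[X₁, [X₂, ⋯ [X_{j-1}, X_j] ⋯ ]]`
for some `X₁, …, X_j ∈ Γ(D)`, where `j ≥ 1`. -/
inductive IsIteratedBracket (D : Distribution n M) : ℕ → VField n M → Prop
  | one {X : VField n M} (hX : IsSection D X) : IsIteratedBracket D 1 X
  | succ {j : ℕ} {X Z : VField n M} (hX : IsSection D X) (hZ : IsIteratedBracket D j Z) :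
      IsIteratedBracket D (j + 1) (VectorField.mlieBracket (𝓡 n) X Z)

/-- `flag D k x` is the space `D^{-k}_x` spanned by the values at `x` of the iterated brackets of
at most `k` sections of `D`; in particular `D^0 = 0`. -/
def flag (D : Distribution n M) (k : ℕ) : Distribution n M := fun x =>
  Submodule.span ℝ {v | ∃ j ≤ k, ∃ Z : VField n M, IsIteratedBracket D j Z ∧ Z x = v}

/-- `E` is bracket-generating: the iterated brackets of sections of `E` span `TM`. -/
def IsBracketGenerating (E : Distribution n M) : Prop :=
  ∀ x, ⨆ k, flag E k x = ⊤

/-- `E` is equiregular: every `E^{-k}` is a subbundle of `TM`. -/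
def IsEquiregular (E : Distribution n M) : Prop :=
  ∀ k, IsSubbundle (flag E k)

theorem IsIteratedBracket.one_le {D : Distribution n M} {j : ℕ} {Z : VField n M}
    (h : IsIteratedBracket D j Z) : 1 ≤ j := by
  induction h <;> omega

theorem flag_zero (D : Distribution n M) (x : M) : flag D 0 x = ⊥ := by
  rw [flag, Submodule.span_eq_bot]
  rintro v ⟨j, hj, Z, hZ, -⟩
  have := hZ.one_le
  omega

/-- A vector in a smooth subbundle is the value of a global smooth section. -/
theorem IsSubbundle.exists_isSection [T2Space M] {D : Distribution n M} (hD : IsSubbundle D)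
    {x : M} {v : TangentSpace (𝓡 n) x} (hv : v ∈ D x) : ∃ X, IsSection D X ∧ X x = v := by
  obtain ⟨U, hU, hxU, r, X, hX, hspan⟩ := hD x
  rw [← (hspan x hxU).2, Submodule.mem_span_range_iff_exists_fun] at hv
  obtain ⟨c, rfl⟩ := hv
  obtain ⟨f, -, hf⟩ :=
    (SmoothBumpFunction.nhds_basis_tsupport (I := 𝓡 n) x).mem_iff.1 (hU.mem_nhds hxU)
  refine ⟨fun y => f y • ∑ i, c i • X i y, ⟨?_, fun y => ?_⟩, by simp⟩
  · have h : ContMDiffOn (𝓡 n) ((𝓡 n).prod 𝓘(ℝ, EuclideanSpace ℝ (Fin n))) ∞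
        (fun y => (⟨y, ∑ i, c i • X i y⟩ : TangentBundle (𝓡 n) M)) U :=
      ContMDiffOn.sum_section fun i _ => (contMDiffOn_const (c := c i)).smul_section (hX i)
    exact ContMDiffOn.smul_section_of_tsupport (f.contMDiff.contMDiffOn) hU hf h
  · by_cases hy : y ∈ U
    · rw [← (hspan y hy).2]
      exact Submodule.smul_mem _ _ (Submodule.sum_mem _ fun i _ =>
        Submodule.smul_mem _ _ (Submodule.subset_span ⟨i, rfl⟩))
    · have : f y = 0 := image_eq_zero_of_notMem_tsupport fun h => hy (hf h)
      simp [this]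

/-- `E^{-1} = E`. -/
theorem IsSubbundle.flag_one [T2Space M] {E : Distribution n M} (hE : IsSubbundle E) (x : M) :
    flag E 1 x = E x := by
  apply le_antisymm
  · refine Submodule.span_le.2 ?_
    rintro v ⟨j, hj, Z, hZ, rfl⟩
    cases hZ with
    | one hX => exact hX.mem x
    | succ hX hZ => have := hZ.one_le; omega
  · intro v hv
    obtain ⟨X, hX, rfl⟩ := hE.exists_isSection hv
    exact Submodule.subset_span ⟨1, le_rfl, X, .one hX, rfl⟩

end Fields

/-- A sub-Riemannian structure `(E, g)` on `M`: a smooth subbundle `E` of `TM` with a smooth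
positive definite metric tensor `g` on `E`. -/
structure Structure (n : ℕ) (M : Type*) [TopologicalSpace M]
    [ChartedSpace (EuclideanSpace ℝ (Fin n)) M] [IsManifold (𝓡 n) ∞ M] where
  E : Distribution n M
  isSubbundle : IsSubbundle E
  g : ∀ x, E x →ₗ[ℝ] E x →ₗ[ℝ] ℝ
  g_symm : ∀ x (u v : E x), g x u v = g x v u
  g_pos : ∀ x (u : E x), u ≠ 0 → 0 < g x u u
  g_smooth : ∀ (X Y : VField n M) (hX : IsSection E X) (hY : IsSection E Y),
    ContMDiff (𝓡 n) 𝓘(ℝ, ℝ) ∞ fun x => g x ⟨X x, hX.mem x⟩ ⟨Y x, hY.mem x⟩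

/-- A Carnot algebra: a finite-dimensional real graded Lie algebra
`𝔤 = 𝔤_{-s} ⊕ ⋯ ⊕ 𝔤_{-1}` with `[𝔤_{-1}, 𝔤_{-k}] = 𝔤_{-k-1}` and an inner product on `𝔤_{-1}`.
Here `layer k` is `𝔤_{-k}`, with `𝔤_{-k} = 0` unless `1 ≤ k ≤ s`. -/
structure CarnotAlgebra where
  carrier : Type
  [lieRing : LieRing carrier]
  [lieAlgebra : LieAlgebra ℝ carrier]
  finiteDimensional : FiniteDimensional ℝ carrier
  step : ℕ
  layer : ℕ → Submodule ℝ carrier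
  layer_zero : layer 0 = ⊥
  layer_of_step_lt : ∀ k, step < k → layer k = ⊥
  isInternal : DirectSum.IsInternal layer
  lie_mem : ∀ i j, ∀ a ∈ layer i, ∀ b ∈ layer j, ⁅a, b⁆ ∈ layer (i + j)
  span_lie : ∀ k, 1 ≤ k →
    Submodule.span ℝ {c | ∃ a ∈ layer 1, ∃ b ∈ layer k, ⁅a, b⁆ = c} = layer (k + 1)
  inner : layer 1 →ₗ[ℝ] layer 1 →ₗ[ℝ] ℝ
  inner_symm : ∀ a b, inner a b = inner b a
  inner_pos : ∀ a, a ≠ 0 → 0 < inner a a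

attribute [instance] CarnotAlgebra.lieRing CarnotAlgebra.lieAlgebra

namespace Structure

variable {n : ℕ} {M : Type*} [TopologicalSpace M] [ChartedSpace (EuclideanSpace ℝ (Fin n)) M]
  [IsManifold (𝓡 n) ∞ M] (S : Structure n M)

/-- `gr_{x,-k} = E^{-k}_x / E^{-k+1}_x`. For `k = 0` this is the zero space `E^0_x / E^0_x`. -/
abbrev GrPiece (x : M) (k : ℕ) : Type :=
  ↥(flag S.E k x) ⧸ (flag S.E (k - 1) x).submoduleOf (flag S.E k x)

/-- The class in `gr_{x,-k}` of a vector of `E^{-k}_x`. -/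
def grMk (x : M) (k : ℕ) (v : TangentSpace (𝓡 n) x) (hv : v ∈ flag S.E k x) : S.GrPiece x k :=
  Submodule.Quotient.mk ⟨v, hv⟩

/-- The fiber `gr_x = ⨁ₖ E^{-k}_x / E^{-k+1}_x` of the nonholonomic tangent bundle. For a
bracket-generating equiregular `E` the summands with `k` greater than the step vanish. -/
abbrev Gr (x : M) : Type := ⨁ k : ℕ, S.GrPiece x k

/-- The identification `E_x = gr_{x,-1}`, sending `v` to its class. -/
def horizontalEquiv [T2Space M] (x : M) : S.E x ≃ₗ[ℝ] S.GrPiece x 1 :=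
  (LinearEquiv.ofEq _ _ (S.isSubbundle.flag_one x).symm).trans
    (Submodule.quotEquivOfEqBot ((flag S.E (1 - 1) x).submoduleOf (flag S.E 1 x)) (by
      rw [Nat.sub_self, flag_zero, Submodule.submoduleOf, Submodule.comap_bot]
      exact Submodule.ker_subtype _)).symm

/-- The inner product of `gr_{x,-1} = E_x`. -/
def grInner [T2Space M] (x : M) (a b : S.GrPiece x 1) : ℝ :=
  S.g x ((S.horizontalEquiv x).symm a) ((S.horizontalEquiv x).symm b)

/-- `c = [X, Y]|_x mod E^{-i-j+1}_x` for some sections `X` of `E^{-i}` and `Y` of `E^{-j}` with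
`a = X_x mod E^{-i+1}_x` and `b = Y_x mod E^{-j+1}_x`. -/
def IsLeviBracket (x : M) {i j : ℕ} (a : S.GrPiece x i) (b : S.GrPiece x j)
    (c : S.GrPiece x (i + j)) : Prop :=
  ∃ (X Y : VField n M) (hX : IsSection (flag S.E i) X) (hY : IsSection (flag S.E j) Y)
    (hXY : VectorField.mlieBracket (𝓡 n) X Y x ∈ flag S.E (i + j) x),
    S.grMk x i (X x) (hX.mem x) = a ∧ S.grMk x j (Y x) (hY.mem x) = b ∧
    S.grMk x (i + j) (VectorField.mlieBracket (𝓡 n) X Y x) hXY = c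

open Classical in
/-- The Levi bracket `gr_{x,-i} × gr_{x,-j} → gr_{x,-i-j}` of homogeneous elements: the class of
the bracket of vector fields extending them. For equiregular `E` the element `c` exists and does
not depend on the extensions, so that the choice made here is immaterial. -/
def leviBracket (x : M) {i j : ℕ} (a : S.GrPiece x i) (b : S.GrPiece x j) :
    S.GrPiece x (i + j) :=
  if h : ∃ c, S.IsLeviBracket x a b c then h.choose else 0

open Classical in
/-- The Levi bracket on `gr_x`, extended from homogeneous elements by
`⟦a, b⟧ = ∑_{i,j} ⟦a_i, b_j⟧`. -/
def grBracket (x : M) (a b : S.Gr x) : S.Gr x :=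
  ∑ i ∈ DFinsupp.support a, ∑ j ∈ DFinsupp.support b,
    DirectSum.of (S.GrPiece x) (i + j) (S.leviBracket x (a i) (b j))

/-- The linear isomorphism `φ : 𝔤 → gr_x` is an isometry of Carnot algebras: it is compatible with
the brackets and maps `𝔤_{-1}` onto `gr_{x,-1}` isometrically. -/
structure IsIsometry [T2Space M] (𝔤 : CarnotAlgebra) (x : M) (φ : 𝔤.carrier ≃ₗ[ℝ] S.Gr x) :
    Prop where
  map_lie : ∀ a b, φ ⁅a, b⁆ = S.grBracket x (φ a) (φ b)
  map_layer : (𝔤.layer 1).map φ.toLinearMap =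
    LinearMap.range (DirectSum.lof ℝ ℕ (S.GrPiece x) 1)
  map_inner : ∀ a b : 𝔤.layer 1, S.grInner x (φ a 1) (φ b 1) = 𝔤.inner a b

/-- `(M, E, g)` has constant symbol: all `gr_x` are isometric to one Carnot algebra. -/
def HasConstantSymbol [T2Space M] : Prop :=
  ∃ 𝔤 : CarnotAlgebra, ∀ x : M, ∃ φ : 𝔤.carrier ≃ₗ[ℝ] S.Gr x, S.IsIsometry 𝔤 x φ

/-- `A ∈ Γ(gr)`: in each degree, the section `A` is near each point the class of a smooth section
of `E^{-k}`. -/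
def IsSmoothGr (A : ∀ x, S.Gr x) : Prop :=
  ∀ (k : ℕ) (x₀ : M), ∃ (X : VField n M) (hX : IsSection (flag S.E k) X),
    ∀ᶠ x in 𝓝 x₀, A x k = S.grMk x k (X x) (hX.mem x)

/-- A connection on the vector bundle `gr`, as a Koszul covariant derivative
`∇ : Γ(TM) × Γ(gr) → Γ(gr)`. Values at arguments that are not smooth carry no meaning. -/
structure GrConnection where
  nabla : VField n M → (∀ x, S.Gr x) → ∀ x, S.Gr x
  smooth : ∀ Y A, IsSmooth Y → S.IsSmoothGr A → S.IsSmoothGr (nabla Y A)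
  add_left : ∀ Y Y' A, IsSmooth Y → IsSmooth Y' → S.IsSmoothGr A →
    ∀ x, nabla (fun z => Y z + Y' z) A x = nabla Y A x + nabla Y' A x
  smul_left : ∀ (f : M → ℝ) Y A, ContMDiff (𝓡 n) 𝓘(ℝ, ℝ) ∞ f → IsSmooth Y → S.IsSmoothGr A →
    ∀ x, nabla (fun z => f z • Y z) A x = f x • nabla Y A x
  add_right : ∀ Y A B, IsSmooth Y → S.IsSmoothGr A → S.IsSmoothGr B →
    ∀ x, nabla Y (fun z => A z + B z) x = nabla Y A x + nabla Y B x
  leibniz : ∀ (f : M → ℝ) Y A, ContMDiff (𝓡 n) 𝓘(ℝ, ℝ) ∞ f → IsSmooth Y → S.IsSmoothGr A →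
    ∀ x, nabla Y (fun z => f z • A z) x =
      mvfderiv (𝓡 n) f x (Y x) • A x + f x • nabla Y A x

variable {S}

/-- The section `A` of `gr` takes values in `gr_{-k}`. -/
def IsInDegree (k : ℕ) (A : ∀ x, S.Gr x) : Prop :=
  ∀ x m, m ≠ k → A x m = 0

/-- The connection is compatible: each `gr_{-k}` is parallel, and the restriction of the
connection to `gr_{-1} = E` is compatible with `g`. -/
structure GrConnection.IsCompatible [T2Space M] (D : S.GrConnection) : Prop where
  parallel : ∀ k Y A, IsSmooth Y → S.IsSmoothGr A → IsInDegree k A → IsInDegree k (D.nabla Y A)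
  metric : ∀ Y A B, IsSmooth Y → S.IsSmoothGr A → S.IsSmoothGr B →
    IsInDegree 1 A → IsInDegree 1 B → ∀ x,
    mvfderiv (𝓡 n) (fun z => S.grInner z (A z 1) (B z 1)) x (Y x) =
      S.grInner x (D.nabla Y A x 1) (B x 1) + S.grInner x (A x 1) (D.nabla Y B x 1)

/-- The connection is strongly compatible: it is compatible and
`∇_Y ⟦A, B⟧ = ⟦∇_Y A, B⟧ + ⟦A, ∇_Y B⟧`. -/
structure GrConnection.IsStronglyCompatible [T2Space M] (D : S.GrConnection) : Prop extends
    D.IsCompatible where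
  bracket : ∀ Y A B, IsSmooth Y → S.IsSmoothGr A → S.IsSmoothGr B → ∀ x,
    D.nabla Y (fun z => S.grBracket z (A z) (B z)) x =
      S.grBracket x (D.nabla Y A x) (B x) + S.grBracket x (A x) (D.nabla Y B x)

end Structure

end SubRiemannian

end

/-!
In a local frame adapted to the filtration by the `E^{-k}`, the bracket and the inner product of
`gr_x` become a tensor `T_x` on `F = ℝⁿ`, and two fibers are isometric exactly when a linear
isomorphism commuting with the degree operator carries one tensor to the other. A connection with
matrix `A` in the frame is strongly compatible exactly when `A` commutes with the degree operator
and `dT = A · T`, the infinitesimal action of `A` on `T`.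

Given such a connection, along a line in a chart the tensor solves a linear differential equation
whose flow intertwines its values, so nearby fibers are isometric, and connectedness makes all
fibers isometric. Conversely, under constant symbol `T` stays in a single orbit, hence `dT` is
tangent to the orbit and `A · T = dT` is solvable at every point. The map `A ↦ A · T_x` has constant
rank, so a generalized inverse of it depends smoothly on `x` and gives local strongly compatible
connections. The conditions on a connection are affine, so a partition of unity glues these.
-/

noncomputable section

namespace SubRiemannian

open Set Filter Metric Asymptotics

section SymbolTensor

/-- A bilinear product on `F` together with a bilinear form on `F`, encoded as one bilinear map
with values in `F × ℝ`. In a frame of `gr`, the bracket and the inner product become a tensor of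
this kind. The inner product is only defined on `gr_{-1}`; its form is extended by zero. -/
abbrev SymbolTensor (F : Type*) [NormedAddCommGroup F] [NormedSpace ℝ F] : Type _ :=
  F →L[ℝ] F →L[ℝ] F × ℝ

variable {F : Type*} [NormedAddCommGroup F] [NormedSpace ℝ F]

/-- The infinitesimal action `A · T = T(A ·, ·) + T(·, A ·) - A T(·, ·)` of endomorphisms on
symbol tensors, where `A` acts trivially on the values of the form. Its kernel at `T` consists of
the skew derivations of `T`. -/
def infAct : SymbolTensor F →ₗ[ℝ] (F →L[ℝ] F) →ₗ[ℝ] SymbolTensor F :=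
  LinearMap.mk₂ ℝ
    (fun T A => T ∘L A + ((ContinuousLinearMap.compL ℝ F F (F × ℝ)).flip A) ∘L T -
      (ContinuousLinearMap.compL ℝ F (F × ℝ) (F × ℝ)
        (ContinuousLinearMap.inl ℝ F ℝ ∘L A ∘L ContinuousLinearMap.fst ℝ F ℝ)) ∘L T)
    (fun _ _ _ => by
      simp only [ContinuousLinearMap.add_comp, ContinuousLinearMap.comp_add]
      abel)
    (fun _ _ _ => by
      simp only [ContinuousLinearMap.smul_comp, ContinuousLinearMap.comp_smul]
      module)
    (fun _ _ _ => by
      simp only [ContinuousLinearMap.add_comp, ContinuousLinearMap.comp_add, map_add]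
      abel)
    (fun _ _ _ => by
      simp only [ContinuousLinearMap.smul_comp, ContinuousLinearMap.comp_smul, map_smul]
      module)

@[simp]
theorem infAct_apply_apply (T : SymbolTensor F) (A : F →L[ℝ] F) (a b : F) :
    infAct T A a b = T (A a) b + T a (A b) - (A (T a b).1, 0) := by
  simp [infAct]

/-- `h` commutes with `D` and carries the product and the form of `T` to those of `T'`. For the
degree operator `D` of a grading this is a morphism of graded algebras that preserves the form. -/
structure IsIntertwiner (D h : F →L[ℝ] F) (T T' : SymbolTensor F) : Prop where
  commute : Commute h D
  map : ∀ a b, T' (h a) (h b) = (h (T a b).1, (T a b).2)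

/-- The part of degree one of the grading with degree operator `D`. -/
def degreeOne (D : F →L[ℝ] F) : Submodule ℝ F :=
  LinearMap.eqLocus (D : F →ₗ[ℝ] F) LinearMap.id

/-- The form of `T` is positive definite in degree one. -/
def IsPositive (D : F →L[ℝ] F) (T : SymbolTensor F) : Prop :=
  ∀ a ∈ degreeOne D, a ≠ 0 → 0 < (T a a).2

/-- The product of `T` is generated in degree one. -/
def IsGeneratedInDegreeOne (D : F →L[ℝ] F) (T : SymbolTensor F) : Prop :=
  ∀ V : Submodule ℝ F, degreeOne D ≤ V → (∀ a ∈ degreeOne D, ∀ b ∈ V, (T a b).1 ∈ V) → V = ⊤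

variable {D h k : F →L[ℝ] F} {T T' T'' T₀ : SymbolTensor F}

theorem mem_degreeOne {a : F} : a ∈ degreeOne D ↔ D a = a := Iff.rfl

namespace IsIntertwiner

theorem mul (hk : IsIntertwiner D k T' T'') (hh : IsIntertwiner D h T T') :
    IsIntertwiner D (k * h) T T'' where
  commute := hk.commute.mul_left hh.commute
  map a b := by simp only [mul_apply_eq_comp, hk.map, hh.map]

theorem apply_mem_degreeOne (hh : IsIntertwiner D h T T') {a : F} (ha : a ∈ degreeOne D) :
    h a ∈ degreeOne D := by
  have hcomm : h (D a) = D (h a) := DFunLike.congr_fun hh.commute.eq a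
  rw [mem_degreeOne, ← hcomm, mem_degreeOne.1 ha]

theorem of_inverse (hh : IsIntertwiner D h T T') (hkh : k * h = 1) (hhk : h * k = 1) :
    IsIntertwiner D k T' T where
  commute := by
    calc k * D = k * (D * h) * k := by rw [mul_assoc, mul_assoc, hhk, mul_one]
      _ = k * h * (D * k) := by rw [← hh.commute.eq]; simp only [mul_assoc]
      _ = D * k := by rw [hkh, one_mul]
  map a b := by
    have hk_left (x : F) : k (h x) = x := DFunLike.congr_fun hkh x
    have hk_right (x : F) : h (k x) = x := DFunLike.congr_fun hhk x
    have hmap := hh.map (k a) (k b)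
    rw [hk_right, hk_right] at hmap
    rw [hmap, hk_left]

theorem infAct_conj (hh : IsIntertwiner D h T T') (hkh : k * h = 1) (A : F →L[ℝ] F) (a b : F) :
    infAct T' (h * A * k) (h a) (h b) = (h (infAct T A a b).1, (infAct T A a b).2) := by
  have hk_left (x : F) : k (h x) = x := DFunLike.congr_fun hkh x
  ext <;> simp [hk_left, hh.map]

theorem isClosed_setOf (D : F →L[ℝ] F) (T T' : SymbolTensor F) :
    IsClosed {h : F →L[ℝ] F | IsIntertwiner D h T T'} := by
  have hset : {h : F →L[ℝ] F | IsIntertwiner D h T T'} = {h | h * D = D * h} ∩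
      ⋂ a, ⋂ b, {h | T' (h a) (h b) = (h (T a b).1, (T a b).2)} := by
    ext h
    simp only [mem_inter_iff, mem_iInter, mem_ofPred_eq]
    exact ⟨fun hh => ⟨hh.commute.eq, hh.map⟩, fun hh => ⟨hh.1, hh.2⟩⟩
  rw [hset]
  exact (isClosed_eq (by fun_prop) (by fun_prop)).inter
    (isClosed_iInter fun a => isClosed_iInter fun b => isClosed_eq (by fun_prop) (by fun_prop))

theorem of_tendsto {ι : Type*} {l : Filter ι} [l.NeBot] {T' : ι → SymbolTensor F}
    {h : ι → F →L[ℝ] F} {h₀ : F →L[ℝ] F} (hT : Tendsto T' l (𝓝 T₀)) (hh : Tendsto h l (𝓝 h₀))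
    (hi : ∀ᶠ t in l, IsIntertwiner D (h t) T (T' t)) : IsIntertwiner D h₀ T T₀ where
  commute := tendsto_nhds_unique_of_eventuallyEq (hh.mul_const D) (hh.const_mul D)
    (hi.mono fun _ ht => ht.commute.eq)
  map a b := by
    have hleft : Continuous fun p : SymbolTensor F × (F →L[ℝ] F) => p.1 (p.2 a) (p.2 b) := by
      fun_prop
    have hright : Continuous fun g : F →L[ℝ] F => (g (T a b).1, (T a b).2) := by fun_prop
    exact tendsto_nhds_unique_of_eventuallyEq ((hleft.tendsto (T₀, h₀)).comp (hT.prodMk_nhds hh))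
      ((hright.tendsto h₀).comp hh) (hi.mono fun _ ht => ht.map a b)

end IsIntertwiner

variable [FiniteDimensional ℝ F]

namespace IsIntertwiner

/-- Restricted to degree one, `h` is injective because it preserves a positive definite form, hence
surjective; the rest of `F` is generated in degree one. -/
theorem surjective (hh : IsIntertwiner D h T T') (hpos : IsPositive D T)
    (hgen : IsGeneratedInDegreeOne D T') : Function.Surjective h := by
  let h₁ : degreeOne D →ₗ[ℝ] degreeOne D :=
    (h : F →ₗ[ℝ] F).restrict fun _ => hh.apply_mem_degreeOne
  have hinj : Function.Injective h₁ := by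
    rw [← LinearMap.ker_eq_bot, LinearMap.ker_eq_bot']
    rintro ⟨a, ha⟩ hra
    have hzero : h a = 0 := congrArg Subtype.val hra
    by_contra hne
    have hform := congrArg Prod.snd (hh.map a a)
    simp only [hzero, map_zero, Prod.snd_zero] at hform
    exact (hpos a ha (by simpa using hne)).ne hform
  have hdeg : degreeOne D ≤ LinearMap.range (h : F →ₗ[ℝ] F) := fun a ha => by
    obtain ⟨a', ha'⟩ := LinearMap.injective_iff_surjective.1 hinj ⟨a, ha⟩
    exact ⟨a', congrArg Subtype.val ha'⟩
  rw [← ContinuousLinearMap.coe_coe, ← LinearMap.range_eq_top]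
  refine hgen _ hdeg ?_
  rintro a ha _ ⟨b', rfl⟩
  obtain ⟨a', rfl⟩ := hdeg ha
  exact ⟨(T a' b').1, by simp [hh.map]⟩

theorem exists_inverse (hh : IsIntertwiner D h T T') (hpos : IsPositive D T)
    (hgen : IsGeneratedInDegreeOne D T') :
    ∃ k : F →L[ℝ] F, k * h = 1 ∧ h * k = 1 ∧ IsIntertwiner D k T' T := by
  have hsurj := hh.surjective hpos hgen
  let e : F ≃ₗ[ℝ] F := LinearEquiv.ofBijective (h : F →ₗ[ℝ] F)
    ⟨LinearMap.injective_iff_surjective.2 hsurj, hsurj⟩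
  let k : F →L[ℝ] F := LinearMap.toContinuousLinearMap (e.symm : F →ₗ[ℝ] F)
  have hkh : k * h = 1 := ContinuousLinearMap.ext e.symm_apply_apply
  have hhk : h * k = 1 := ContinuousLinearMap.ext e.apply_symm_apply
  exact ⟨k, hkh, hhk, hh.of_inverse hkh hhk⟩

end IsIntertwiner

theorem IsPositive.exists_eventually_mul_sq_le (hpos : IsPositive D T₀) :
    ∃ δ > 0, ∀ᶠ T in 𝓝 T₀, ∀ a ∈ degreeOne D, δ * ‖a‖ ^ 2 ≤ (T a a).2 := by
  have hcompact : IsCompact ((degreeOne D : Set F) ∩ sphere 0 1) :=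
    (isCompact_sphere 0 1).inter_left (degreeOne D).closed_of_finiteDimensional
  obtain ⟨δ, hδ, hle⟩ := hcompact.exists_forall_le' (f := fun a => (T₀ a a).2) (a := 0)
    (by fun_prop) fun a ha => hpos a ha.1 (ne_zero_of_mem_unit_sphere ⟨a, ha.2⟩)
  refine ⟨δ / 2, half_pos hδ, ?_⟩
  have hnear : ∀ᶠ T in 𝓝 T₀, ‖T - T₀‖ ≤ δ / 2 :=
    ((tendsto_iff_norm_sub_tendsto_zero (E := SymbolTensor F)).1 tendsto_id).eventually_le_const
      (half_pos hδ)
  filter_upwards [hnear] with T hT a ha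
  rcases eq_or_ne a 0 with rfl | hne
  · simp
  have hT₀ : δ * ‖a‖ ^ 2 ≤ (T₀ a a).2 := by
    have hunit := hle (‖a‖⁻¹ • a)
      ⟨(degreeOne D).smul_mem _ ha, by simp [norm_smul, norm_ne_zero_iff.2 hne]⟩
    simp only [map_smul, smul_apply, Prod.smul_snd, smul_eq_mul] at hunit
    have hscale : (T₀ a a).2 = ‖a‖⁻¹ * (‖a‖⁻¹ * (T₀ a a).2) * ‖a‖ ^ 2 := by
      field_simp [norm_ne_zero_iff.2 hne]
    rw [hscale]
    gcongr
  have hdiff : |(T a a).2 - (T₀ a a).2| ≤ δ / 2 * ‖a‖ * ‖a‖ := by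
    refine (norm_snd_le ((T - T₀) a a)).trans (((T - T₀).le_opNorm₂ a a).trans ?_)
    gcongr
  linarith [(abs_le.1 hdiff).1]

theorem IsIntertwiner.exists_eventually_norm_apply_le (hpos : IsPositive D T₀)
    (hgen : IsGeneratedInDegreeOne D T) (a : F) :
    ∃ C, ∀ᶠ T' in 𝓝 T₀, ∀ h, IsIntertwiner D h T T' → ‖h a‖ ≤ C := by
  let V : Submodule ℝ F :=
    { carrier := {a | ∃ C, ∀ᶠ T' in 𝓝 T₀, ∀ h, IsIntertwiner D h T T' → ‖h a‖ ≤ C}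
      add_mem' := fun {a b} ⟨C, hC⟩ ⟨C', hC'⟩ => ⟨C + C', by
        filter_upwards [hC, hC'] with T' ha hb h hh
        rw [map_add]
        exact norm_add_le_of_le (ha h hh) (hb h hh)⟩
      zero_mem' := ⟨0, by simp⟩
      smul_mem' := fun c a ⟨C, hC⟩ => ⟨‖c‖ * C, by
        filter_upwards [hC] with T' ha h hh
        rw [map_smul, norm_smul]
        exact mul_le_mul_of_nonneg_left (ha h hh) (norm_nonneg c)⟩ }
  have hdeg : degreeOne D ≤ V := fun a ha => by
    obtain ⟨δ, hδ, hle⟩ := hpos.exists_eventually_mul_sq_le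
    refine ⟨√((T a a).2 / δ), hle.mono fun T' hT' h hh => Real.le_sqrt_of_sq_le ?_⟩
    have hform := hT' (h a) (hh.apply_mem_degreeOne ha)
    rw [hh.map] at hform
    rwa [le_div_iff₀' hδ]
  suffices hV : V = ⊤ from (hV ▸ Submodule.mem_top : a ∈ V)
  refine hgen V hdeg fun a ha b ⟨Cb, hCb⟩ => ?_
  obtain ⟨Ca, hCa⟩ := hdeg ha
  refine ⟨(‖T₀‖ + 1) * Ca * Cb, ?_⟩
  have hnear : ∀ᶠ T' in 𝓝 T₀, ‖T'‖ ≤ ‖T₀‖ + 1 :=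
    (continuous_norm (E := SymbolTensor F)).continuousAt.eventually_le_const (lt_add_one ‖T₀‖)
  filter_upwards [hCa, hCb, hnear] with T' ha hb hT' h hh
  have hprod : h (T a b).1 = (T' (h a) (h b)).1 := by rw [hh.map]
  have hCa₀ : 0 ≤ Ca := (norm_nonneg _).trans (ha h hh)
  rw [hprod]
  refine (norm_fst_le _).trans ((T'.le_opNorm₂ _ _).trans ?_)
  gcongr
  exacts [ha h hh, hb h hh]

theorem IsIntertwiner.exists_eventually_norm_le (hpos : IsPositive D T₀)
    (hgen : IsGeneratedInDegreeOne D T) :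
    ∃ C, ∀ᶠ T' in 𝓝 T₀, ∀ h, IsIntertwiner D h T T' → ‖h‖ ≤ C := by
  let b := Module.finBasis ℝ F
  choose C hC using fun i => exists_eventually_norm_apply_le hpos hgen (b i)
  obtain ⟨K, -, hK⟩ := b.exists_opNorm_le (F := F)
  refine ⟨K * ∑ i, |C i|, (eventually_all.2 hC).mono fun T' hT' h hh => ?_⟩
  refine hK (by positivity) fun i => (hT' i h hh).trans ((le_abs_self _).trans ?_)
  exact Finset.single_le_sum (f := fun i => |C i|) (fun i _ => abs_nonneg _) (Finset.mem_univ i)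

end SymbolTensor

section Transport

theorem eqOn_Icc_of_linear_ode {V : Type*} [NormedAddCommGroup V] [NormedSpace ℝ V] {a b : ℝ}
    {A : ℝ → V →L[ℝ] V} (hA : ContinuousOn A (Icc a b)) {f g : ℝ → V}
    (hf : ∀ t ∈ Icc a b, HasDerivWithinAt f (A t (f t)) (Icc a b) t)
    (hg : ∀ t ∈ Icc a b, HasDerivWithinAt g (A t (g t)) (Icc a b) t)
    (hfg : f a = g a) : EqOn f g (Icc a b) := by
  obtain ⟨C, hC⟩ := isCompact_Icc.exists_bound_of_continuousOn hA
  have hIci {f : ℝ → V} (hf : ∀ t ∈ Icc a b, HasDerivWithinAt f (A t (f t)) (Icc a b) t) (t : ℝ)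
      (ht : t ∈ Ico a b) : HasDerivWithinAt f (A t (f t)) (Ici t) t :=
    (hf t (Ico_subset_Icc_self ht)).mono_of_mem_nhdsWithin (Icc_mem_nhdsGE_of_mem ht)
  refine ODE_solution_unique_of_mem_Icc_right (v := fun t y => A t y) (s := fun _ => univ)
    (K := C.toNNReal) (fun t ht => ?_) (fun t ht => (hf t ht).continuousWithinAt) (hIci hf)
    (fun _ _ => mem_univ _) (fun t ht => (hg t ht).continuousWithinAt) (hIci hg)
    (fun _ _ => mem_univ _) hfg
  refine ((A t).lipschitz.weaken ?_).lipschitzOnWith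
  rw [← NNReal.coe_le_coe, coe_nnnorm]
  exact (hC t (Ico_subset_Icc_self ht)).trans (Real.le_coe_toNNReal C)

variable {F : Type*} [NormedAddCommGroup F] [NormedSpace ℝ F] {D : F →L[ℝ] F}
  {A h : ℝ → F →L[ℝ] F} {T : ℝ → SymbolTensor F}

theorem hasDerivWithinAt_transport_apply {s : Set ℝ} {t : ℝ}
    (hh : HasDerivWithinAt h (-(A t * h t)) s t) (a : F) :
    HasDerivWithinAt (fun t => h t a) (-(A t (h t a))) s t := by
  simpa using hh.clm_apply (hasDerivWithinAt_const t s a)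

theorem commute_of_transport (hA : ContinuousOn A (Icc 0 1))
    (hD : ∀ t ∈ Icc (0 : ℝ) 1, Commute (A t) D)
    (hh : ∀ t ∈ Icc (0 : ℝ) 1, HasDerivWithinAt h (-(A t * h t)) (Icc 0 1) t) (h_zero : h 0 = 1)
    {t : ℝ} (ht : t ∈ Icc (0 : ℝ) 1) : Commute (h t) D := by
  rw [commute_iff_eq, ← sub_eq_zero]
  ext a
  refine eqOn_Icc_of_linear_ode (A := fun t => -A t) (f := fun t => (h t * D - D * h t) a)
    (g := fun _ => 0) hA.neg (fun t ht => ?_) (fun t _ => ?_) (by simp [h_zero]) ht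
  · have hcomm : D (A t (h t a)) = A t (D (h t a)) :=
      (DFunLike.congr_fun (hD t ht).eq (h t a)).symm
    refine ((hasDerivWithinAt_transport_apply (hh t ht) (D a)).sub
      (D.hasFDerivAt.comp_hasDerivWithinAt t
        (hasDerivWithinAt_transport_apply (hh t ht) a))).congr_deriv ?_
    simp [hcomm]
    abel
  · simpa using hasDerivWithinAt_const t (Icc (0 : ℝ) 1) (0 : F)

theorem map_of_transport (hA : ContinuousOn A (Icc 0 1))
    (hT : ∀ t ∈ Icc (0 : ℝ) 1, HasDerivWithinAt T (infAct (T t) (A t)) (Icc 0 1) t)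
    (hh : ∀ t ∈ Icc (0 : ℝ) 1, HasDerivWithinAt h (-(A t * h t)) (Icc 0 1) t) (h_zero : h 0 = 1)
    {t : ℝ} (ht : t ∈ Icc (0 : ℝ) 1) (a b : F) :
    T t (h t a) (h t b) = (h t (T 0 a b).1, (T 0 a b).2) := by
  have hprod : ContinuousOn (fun t => (A t).prodMap (0 : ℝ →L[ℝ] ℝ)) (Icc 0 1) :=
    (ContinuousLinearMap.prodMapL ℝ F F ℝ ℝ).continuous.comp_continuousOn
      (hA.prodMk continuousOn_const)
  refine eqOn_Icc_of_linear_ode (A := fun t => -(A t).prodMap 0)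
    (f := fun t => T t (h t a) (h t b)) (g := fun t => (h t (T 0 a b).1, (T 0 a b).2)) hprod.neg
    (fun t ht => ?_) (fun t ht => ?_) (by simp [h_zero]) ht
  · refine (((hT t ht).clm_apply (hasDerivWithinAt_transport_apply (hh t ht) a)).clm_apply
      (hasDerivWithinAt_transport_apply (hh t ht) b)).congr_deriv ?_
    ext
    · simp [Prod.map]
      abel
    · simp [Prod.map]
  · refine ((hasDerivWithinAt_transport_apply (hh t ht) _).prodMk
      (hasDerivWithinAt_const t (Icc 0 1) _)).congr_deriv ?_
    simp [Prod.map]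

theorem isIntertwiner_of_transport (hA : ContinuousOn A (Icc 0 1))
    (hD : ∀ t ∈ Icc (0 : ℝ) 1, Commute (A t) D)
    (hT : ∀ t ∈ Icc (0 : ℝ) 1, HasDerivWithinAt T (infAct (T t) (A t)) (Icc 0 1) t)
    (hh : ∀ t ∈ Icc (0 : ℝ) 1, HasDerivWithinAt h (-(A t * h t)) (Icc 0 1) t) (h_zero : h 0 = 1)
    {t : ℝ} (ht : t ∈ Icc (0 : ℝ) 1) : IsIntertwiner D (h t) (T 0) (T t) :=
  ⟨commute_of_transport hA hD hh h_zero ht, map_of_transport hA hT hh h_zero ht⟩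

theorem exists_transport [CompleteSpace F] (hA : ContinuousOn A (Icc 0 1))
    (hle : ∀ t ∈ Icc (0 : ℝ) 1, ‖A t‖ ≤ 1 / 2) :
    ∃ h : ℝ → F →L[ℝ] F, h 0 = 1 ∧
      ∀ t ∈ Icc (0 : ℝ) 1, HasDerivWithinAt h (-(A t * h t)) (Icc 0 1) t := by
  -- On the ball of radius `1` around `1` the velocity `-A h` has norm at most `1 / 2 * 2`.
  have hpl : IsPicardLindelof (fun t (B : F →L[ℝ] F) => -(A t * B)) (tmin := 0) (tmax := 1)
      ⟨0, left_mem_Icc.2 zero_le_one⟩ (1 : F →L[ℝ] F) 1 0 1 (1 / 2) := by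
    refine ⟨fun t ht => ?_, fun B _ => (hA.mul continuousOn_const).neg, fun t ht B hB => ?_,
      by simp⟩
    · refine LipschitzOnWith.of_dist_le_mul fun B _ B' _ => ?_
      rw [dist_neg_neg, dist_eq_norm, dist_eq_norm, ← mul_sub]
      refine (norm_mul_le _ _).trans ?_
      simpa using mul_le_mul_of_nonneg_right (hle t ht) (norm_nonneg _)
    · have hB_le : ‖B‖ ≤ 1 + 1 :=
        norm_le_norm_add_const_of_dist_le (by simpa using hB) |>.trans
          (by gcongr; exact ContinuousLinearMap.norm_id_le)
      rw [norm_neg]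
      calc ‖A t * B‖ ≤ ‖A t‖ * ‖B‖ := norm_mul_le _ _
        _ ≤ 1 / 2 * (1 + 1) := by gcongr; exact hle t ht
        _ = _ := by norm_num
  exact hpl.exists_eq_forall_mem_Icc_hasDerivWithinAt₀

theorem isIntertwiner_exp [CompleteSpace F] {T : SymbolTensor F} {η : F →L[ℝ] F}
    (hη : Commute η D) (hT : infAct T η = 0) : IsIntertwiner D (NormedSpace.exp η) T T := by
  have hconst := isIntertwiner_of_transport (D := D) (A := fun _ => -η)
    (h := fun t => NormedSpace.exp (t • η)) (T := fun _ => T) continuousOn_const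
    (fun _ _ => hη.neg_left)
    (fun t _ => by
      rw [show infAct T (-η) = 0 from (LinearMap.ker (infAct T)).neg_mem hT]
      exact hasDerivWithinAt_const (F := SymbolTensor F) t _ T)
    (fun t _ => by simpa using! (hasDerivAt_exp_smul_const' (𝕂 := ℝ) η t).hasDerivWithinAt)
    (by simp) (right_mem_Icc.2 zero_le_one)
  simpa using hconst

end Transport

section LinearAlgebra

variable {P W : Type*} [NormedAddCommGroup P] [NormedSpace ℝ P] [FiniteDimensional ℝ P]
  [NormedAddCommGroup W] [NormedSpace ℝ W]

theorem exists_norm_le_of_almost_orthogonal_ker {H : Type*} [NormedAddCommGroup H]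
    [InnerProductSpace ℝ H] (L : P →ₗ[ℝ] W) (S : Submodule ℝ P) {τ : P →L[ℝ] H}
    (hτ : Function.Injective τ) : ∃ K ≥ 0, ∀ p ∈ S, ∀ ε ≥ 0,
      (∀ z ∈ S, L z = 0 → |inner ℝ (τ p) (τ z)| ≤ ε * ‖z‖) → ‖p‖ ≤ K * (‖L p‖ + ε) := by
  let N : Submodule ℝ P := S ⊓ LinearMap.ker L
  let pairing : P →ₗ[ℝ] N →L[ℝ] ℝ :=
    { toFun := fun p => innerSL ℝ (τ p) ∘L τ ∘L N.subtypeL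
      map_add' := fun p q => by ext; simp
      map_smul' := fun c p => by ext; simp }
  have hker : LinearMap.ker ((L.prod pairing).domRestrict S) = ⊥ := by
    refine LinearMap.ker_eq_bot'.2 fun p hp => ?_
    obtain ⟨hL, hpairing⟩ := Prod.ext_iff.1 hp
    have hself : inner ℝ (τ p) (τ p) = (0 : ℝ) := DFunLike.congr_fun hpairing ⟨p, p.2, hL⟩
    exact Subtype.ext (hτ (by simpa using hself))
  obtain ⟨K, -, hK⟩ := LinearMap.exists_antilipschitzWith (𝕜 := ℝ) (E := S)
    (F := W × (N →L[ℝ] ℝ)) _ hker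
  refine ⟨K, K.2, fun p hpS ε hε hp => ?_⟩
  have hpairing : ‖pairing p‖ ≤ ε :=
    ContinuousLinearMap.opNorm_le_bound _ hε fun z => hp z z.2.1 z.2.2
  calc ‖p‖ ≤ K * max ‖L p‖ ‖pairing p‖ := hK.le_mul_norm (map_zero _) ⟨p, hpS⟩
    _ ≤ K * (‖L p‖ + ε) := by
      gcongr
      exact (max_le_add_of_nonneg (norm_nonneg (L p)) (norm_nonneg (pairing p))).trans (by gcongr)

theorem mem_map_of_hasDerivAt (L : P →ₗ[ℝ] W) (S : Submodule ℝ P) {T : ℝ → W} {T' : W}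
    {p : ℝ → P} (hpS : ∀ᶠ t in 𝓝 0, p t ∈ S) (hT : HasDerivAt T T' 0)
    (hp : p =O[𝓝 0] fun t => T t - T 0)
    (hLp : (fun t => L (p t) + (T t - T 0)) =o[𝓝 0] p) : T' ∈ S.map L := by
  have hquot : Tendsto (fun t : ℝ => t⁻¹ • (L (p t) + (T t - T 0)) - t⁻¹ • (T t - T 0)) (𝓝[≠] 0)
      (𝓝 (0 - T')) := by
    have hΔ : (fun t => T t - T 0) =O[𝓝 0] fun t : ℝ => t := by simpa using hT.isBigO_sub
    refine ((hLp.trans_isBigO (hp.trans hΔ)).mono nhdsWithin_le_nhds).tendsto_inv_smul_nhds_zero.sub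
      ?_
    simpa using hT.tendsto_slope_zero
  have hmem : -T' ∈ S.map L := by
    rw [zero_sub] at hquot
    refine (S.map L).closed_of_finiteDimensional.mem_of_tendsto hquot ?_
    filter_upwards [hpS.filter_mono nhdsWithin_le_nhds] with t ht
    refine ⟨t⁻¹ • p t, S.smul_mem _ ht, ?_⟩
    rw [← smul_sub, add_sub_cancel_right, map_smul]
  simpa using (S.map L).neg_mem hmem

end LinearAlgebra

section Tangency

variable {F : Type*} [NormedAddCommGroup F] [NormedSpace ℝ F]

/-- The endomorphisms that commute with `D`. -/
def commutant (D : F →L[ℝ] F) : Submodule ℝ (F →L[ℝ] F) where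
  carrier := {A | Commute A D}
  add_mem' hA hB := hA.add_left hB
  zero_mem' := Commute.zero_left D
  smul_mem' c _ hA := hA.smul_left c

/-- `h` is the intertwiner of `T` and `T'` for which `h - 1` is shortest in the Hilbert norm
defined by `τ`. -/
structure IsNearestIntertwiner {H : Type*} [NormedAddCommGroup H] [InnerProductSpace ℝ H]
    (τ : (F →L[ℝ] F) ≃L[ℝ] H) (D h : F →L[ℝ] F) (T T' : SymbolTensor F) : Prop extends
    IsIntertwiner D h T T' where
  norm_le : ∀ k, IsIntertwiner D k T T' → ‖τ (h - 1)‖ ≤ ‖τ (k - 1)‖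

variable {D h : F →L[ℝ] F} {T T' T₀ : SymbolTensor F}

theorem IsIntertwiner.sub_one_mem_commutant (hh : IsIntertwiner D h T T') :
    h - 1 ∈ commutant D :=
  hh.commute.sub_left (Commute.one_left D)

theorem IsIntertwiner.norm_infAct_sub_one_add_le (hh : IsIntertwiner D h T T') :
    ‖infAct T (h - 1) + (T' - T)‖ ≤ (2 * ‖T' - T‖ + ‖T'‖ * ‖h - 1‖) * ‖h - 1‖ := by
  refine ContinuousLinearMap.opNorm_le_bound₂ _ (by positivity) fun a b => ?_
  have hexpand : (infAct T (h - 1) + (T' - T)) a b =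
      -((T' - T) ((h - 1) a) b + (T' - T) a ((h - 1) b) + T' ((h - 1) a) ((h - 1) b)) := by
    have hmap := hh.map a b
    ext <;> simp [hmap] <;> abel
  rw [hexpand, norm_neg]
  calc _ ≤ ‖T' - T‖ * (‖h - 1‖ * ‖a‖) * ‖b‖ + ‖T' - T‖ * ‖a‖ * (‖h - 1‖ * ‖b‖) +
        ‖T'‖ * (‖h - 1‖ * ‖a‖) * (‖h - 1‖ * ‖b‖) := by
        have ha := (h - 1).le_opNorm a
        have hb := (h - 1).le_opNorm b
        exact norm_add₃_le.trans (add_le_add_three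
          ((T' - T).le_of_opNorm₂_le_of_le le_rfl ha le_rfl)
          ((T' - T).le_of_opNorm₂_le_of_le le_rfl le_rfl hb)
          (T'.le_of_opNorm₂_le_of_le le_rfl ha hb))
    _ = _ := by ring

theorem isLittleO_infAct_sub_one_add {ι : Type*} {l : Filter ι} {T : ι → SymbolTensor F}
    {h : ι → F →L[ℝ] F} (hT : Tendsto T l (𝓝 T₀)) (hh : ∀ᶠ t in l, IsIntertwiner D (h t) T₀ (T t))
    (h_one : Tendsto h l (𝓝 1)) :
    (fun t => infAct T₀ (h t - 1) + (T t - T₀)) =o[l] fun t => h t - 1 := by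
  have hcoeff : Tendsto (fun t => 2 * ‖T t - T₀‖ + ‖T t‖ * ‖h t - 1‖) l (𝓝 0) := by
    have hΔ := (tendsto_iff_norm_sub_tendsto_zero (E := SymbolTensor F)).1 hT
    have hδ := tendsto_iff_norm_sub_tendsto_zero.1 h_one
    simpa using (hΔ.const_mul 2).add ((Tendsto.norm (E := SymbolTensor F) hT).mul hδ)
  refine isLittleO_iff.2 fun c hc => ?_
  filter_upwards [hh, hcoeff.eventually_le_const hc] with t ht htc
  exact ht.norm_infAct_sub_one_add_le.trans (by gcongr)

variable [FiniteDimensional ℝ F] {H : Type*} [NormedAddCommGroup H] [InnerProductSpace ℝ H]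
  {τ : (F →L[ℝ] F) ≃L[ℝ] H}

theorem IsIntertwiner.exists_isNearestIntertwiner (τ : (F →L[ℝ] F) ≃L[ℝ] H)
    (hh : IsIntertwiner D h T T') : ∃ k, IsNearestIntertwiner τ D k T T' := by
  have : FiniteDimensional ℝ H := τ.toLinearEquiv.finiteDimensional
  have : ProperSpace H := FiniteDimensional.proper_real H
  obtain ⟨-, ⟨k, hk, rfl⟩, hdist⟩ := (τ.toHomeomorph.isClosedMap _
    (IsIntertwiner.isClosed_setOf D T T')).exists_infDist_eq_dist ⟨_, mem_image_of_mem _ hh⟩ (τ 1)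
  refine ⟨k, hk, fun k' hk' => ?_⟩
  have hle := infDist_le_dist_of_mem (x := τ 1) (mem_image_of_mem τ
    (show k' ∈ {h | IsIntertwiner D h T T'} from hk'))
  have hdist_le : dist (τ 1) (τ k) ≤ dist (τ 1) (τ k') := hdist.symm.trans_le hle
  rwa [dist_comm, dist_comm _ (τ k'), dist_eq_norm, dist_eq_norm, ← map_sub, ← map_sub] at hdist_le

/-- Along the curve `h * exp (s • η)` of intertwiners the distance to `1` is minimal at `s = 0`. -/
theorem IsNearestIntertwiner.inner_eq_zero (hh : IsNearestIntertwiner τ D h T T') {η : F →L[ℝ] F}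
    (hη : Commute η D) (hT : infAct T η = 0) : inner ℝ (τ (h - 1)) (τ (h * η)) = 0 := by
  have hderiv : HasDerivAt (fun s : ℝ => τ (h * NormedSpace.exp (s • η) - 1)) (τ (h * η)) 0 := by
    have hexp := hasDerivAt_exp_smul_const' (𝕂 := ℝ) η (0 : ℝ)
    simp only [zero_smul, NormedSpace.exp_zero, mul_one] at hexp
    exact (τ : (F →L[ℝ] F) →L[ℝ] H).hasFDerivAt.comp_hasDerivAt _
      ((hexp.const_mul h).sub_const 1)
  have hmin : IsLocalMin (fun s : ℝ => ‖τ (h * NormedSpace.exp (s • η) - 1)‖ ^ 2) 0 := by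
    refine Eventually.of_forall fun s => ?_
    have hsT : infAct T (s • η) = 0 := (LinearMap.ker (infAct T)).smul_mem s hT
    have hle := hh.norm_le _ (hh.mul (isIntertwiner_exp (hη.smul_left s) hsT))
    simp only [zero_smul, NormedSpace.exp_zero, mul_one]
    gcongr
  simpa using hmin.hasDerivAt_eq_zero hderiv.norm_sq

theorem IsNearestIntertwiner.abs_inner_le (hh : IsNearestIntertwiner τ D h T T') {η : F →L[ℝ] F}
    (hη : Commute η D) (hT : infAct T η = 0) :
    |inner ℝ (τ (h - 1)) (τ η)| ≤ ‖(τ : (F →L[ℝ] F) →L[ℝ] H)‖ ^ 2 * ‖h - 1‖ ^ 2 * ‖η‖ := by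
  have hτ (A : F →L[ℝ] F) : ‖τ A‖ ≤ ‖(τ : (F →L[ℝ] F) →L[ℝ] H)‖ * ‖A‖ :=
    (τ : (F →L[ℝ] F) →L[ℝ] H).le_opNorm A
  have hinner : inner ℝ (τ (h - 1)) (τ η) = -inner ℝ (τ (h - 1)) (τ ((h - 1) * η)) := by
    rw [sub_mul, one_mul, map_sub τ (h * _), inner_sub_right, hh.inner_eq_zero hη hT, zero_sub,
      neg_neg]
  calc |inner ℝ (τ (h - 1)) (τ η)| ≤ ‖τ (h - 1)‖ * ‖τ ((h - 1) * η)‖ := by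
        rw [hinner, abs_neg]
        exact abs_real_inner_le_norm _ _
    _ ≤ ‖(τ : (F →L[ℝ] F) →L[ℝ] H)‖ * ‖h - 1‖ *
        (‖(τ : (F →L[ℝ] F) →L[ℝ] H)‖ * (‖h - 1‖ * ‖η‖)) := by
      gcongr
      exacts [hτ _, (hτ _).trans (by gcongr; exact norm_mul_le _ _)]
    _ = _ := by ring

/-- Every ultrafilter limit `h₀` of `h` is an invertible intertwiner of `T₀` with itself, and the
intertwiners `h t * h₀⁻¹`, which are not nearer to `1` than `h t`, tend to `1`. -/
theorem tendsto_one_of_isNearestIntertwiner {ι : Type*} {l : Filter ι} {T : ι → SymbolTensor F}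
    {h : ι → F →L[ℝ] F} (hpos : IsPositive D T₀) (hgen : IsGeneratedInDegreeOne D T₀)
    (hT : Tendsto T l (𝓝 T₀)) (hh : ∀ᶠ t in l, IsNearestIntertwiner τ D (h t) T₀ (T t)) :
    Tendsto h l (𝓝 1) := by
  rw [tendsto_iff_ultrafilter]
  intro u hu
  obtain ⟨C, hC⟩ := IsIntertwiner.exists_eventually_norm_le hpos hgen
  obtain ⟨h₀, -, hh₀⟩ := (isCompact_closedBall (0 : F →L[ℝ] F) C).ultrafilter_le_nhds (u.map h) (by
    rw [Ultrafilter.coe_map, le_principal_iff, mem_map]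
    filter_upwards [hu (hT hC), hu hh] with t hCt ht
    simpa using hCt _ ht.toIsIntertwiner)
  replace hh₀ : Tendsto h u (𝓝 h₀) := hh₀
  obtain ⟨k, -, hhk, hk⟩ := (IsIntertwiner.of_tendsto (hT.mono_left hu) hh₀
    ((hh.filter_mono hu).mono fun _ ht => ht.toIsIntertwiner)).exists_inverse hpos hgen
  have hmul : Tendsto (fun t => τ (h t * k - 1)) u (𝓝 0) := by
    simpa [Function.comp_def, hhk] using
      (τ.continuous.tendsto _).comp ((hh₀.mul_const k).sub_const 1)
  have hnear : Tendsto (fun t => τ (h t - 1)) u (𝓝 0) :=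
    squeeze_zero_norm' ((hh.filter_mono hu).mono fun t ht => ht.norm_le _ (ht.mul hk))
      (tendsto_zero_iff_norm_tendsto_zero.1 hmul)
  simpa [Function.comp_def] using ((τ.symm.continuous.tendsto 0).comp hnear).add_const 1

/-- Up to second order, the displacement `h t - 1` is orthogonal to the stabilizer algebra. -/
theorem isBigO_sub_one_of_isNearestIntertwiner {ι : Type*} {l : Filter ι} {T : ι → SymbolTensor F}
    {h : ι → F →L[ℝ] F} (hT : Tendsto T l (𝓝 T₀))
    (hh : ∀ᶠ t in l, IsNearestIntertwiner τ D (h t) T₀ (T t)) (h_one : Tendsto h l (𝓝 1)) :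
    (fun t => h t - 1) =O[l] fun t => ‖T t - T₀‖ := by
  obtain ⟨K, hK_nonneg, hK⟩ := exists_norm_le_of_almost_orthogonal_ker (W := SymbolTensor F)
    (infAct T₀) (commutant D) (τ := (τ : (F →L[ℝ] F) →L[ℝ] H)) τ.injective
  let c := ‖(τ : (F →L[ℝ] F) →L[ℝ] H)‖
  let r t := ‖infAct T₀ (h t - 1) + (T t - T₀)‖ + c ^ 2 * ‖h t - 1‖ ^ 2
  have hr : r =o[l] fun t => h t - 1 := by
    have hrem := isLittleO_infAct_sub_one_add hT (hh.mono fun _ ht => ht.toIsIntertwiner) h_one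
    have hsq : (fun t => ‖h t - 1‖ ^ 2) =o[l] fun t => ‖h t - 1‖ :=
      (isLittleO_pow_id one_lt_two).comp_tendsto (tendsto_iff_norm_sub_tendsto_zero.1 h_one)
    exact ((isLittleO_norm_left (E' := SymbolTensor F)).2 hrem).add
      (isLittleO_norm_right.1 (hsq.const_mul_left _))
  have hle : (fun t => h t - 1) =O[l] fun t => r t + ‖T t - T₀‖ := by
    refine IsBigO.of_bound K (hh.mono fun t ht => (hK _ ht.sub_one_mem_commutant
      (c ^ 2 * ‖h t - 1‖ ^ 2) (by positivity) fun _ hzD hz => ht.abs_inner_le hzD hz).trans ?_)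
    refine mul_le_mul_of_nonneg_left ?_ hK_nonneg
    have htri : ‖infAct T₀ (h t - 1)‖ ≤ ‖infAct T₀ (h t - 1) + (T t - T₀)‖ + ‖T t - T₀‖ :=
      norm_le_add_norm_add (E := SymbolTensor F) _ _
    refine (add_le_add_left htri _).trans ((le_of_eq ?_).trans (le_abs_self _))
    ring
  have hsub := (hr.trans_isBigO hle).right_isBigO_sub
  exact hle.trans (by simpa using hsub)

theorem exists_infAct_eq_of_hasDerivAt {T : ℝ → SymbolTensor F} {T' : SymbolTensor F}
    (hT : HasDerivAt T T' 0) (hpos : IsPositive D (T 0)) (hgen : IsGeneratedInDegreeOne D (T 0))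
    (horbit : ∀ᶠ t in 𝓝 0, ∃ h, IsIntertwiner D h (T 0) (T t)) :
    ∃ A, Commute A D ∧ infAct (T 0) A = T' := by
  let τ : (F →L[ℝ] F) ≃L[ℝ] EuclideanSpace ℝ (Fin (Module.finrank ℝ (F →L[ℝ] F))) := toEuclidean
  obtain ⟨h, hh⟩ := (horbit.mono fun t ⟨h, hh⟩ => hh.exists_isNearestIntertwiner τ).choice
  have hcont : Tendsto T (𝓝 0) (𝓝 (T 0)) :=
    (HasDerivAt.continuousAt (F := SymbolTensor F) hT).tendsto
  have h_one := tendsto_one_of_isNearestIntertwiner hpos hgen hcont hh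
  have hbig : (fun t => h t - 1) =O[𝓝 0] fun t => T t - T 0 :=
    (isBigO_norm_right (F' := SymbolTensor F)).1
      (isBigO_sub_one_of_isNearestIntertwiner hcont hh h_one)
  have hrem := isLittleO_infAct_sub_one_add hcont (hh.mono fun _ ht => ht.toIsIntertwiner) h_one
  have hS := hh.mono fun _ ht => ht.sub_one_mem_commutant
  obtain ⟨A, hA, hAT⟩ := mem_map_of_hasDerivAt (W := SymbolTensor F) (infAct (T 0)) (commutant D) hS
    hT hbig hrem
  exact ⟨A, hA, hAT⟩

end Tangency

section ConstantRank

variable {P Q : Type*} [NormedAddCommGroup P] [NormedSpace ℝ P] [FiniteDimensional ℝ P]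
  [NormedAddCommGroup Q] [NormedSpace ℝ Q]

/-- The factor `1 + (L - L₀) * G₀` carries `L₀ p` to `L (G₀ (L₀ p))`, so it maps the image of `L₀`
into the image of `L`, and onto it if the dimensions agree. -/
theorem apply_perturbed_generalized_inverse {V : Submodule ℝ P} {L₀ L : P →L[ℝ] Q} {G₀ : Q →L[ℝ] P}
    (hG₀V : ∀ q, G₀ q ∈ V) (hG₀ : ∀ p ∈ V, L₀ (G₀ (L₀ p)) = L₀ p)
    (hN : IsUnit (1 + (L - L₀) ∘L G₀))
    (hrank : Module.finrank ℝ (V.map (L : P →ₗ[ℝ] Q)) =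
      Module.finrank ℝ (V.map (L₀ : P →ₗ[ℝ] Q))) {p : P} (hp : p ∈ V) :
    L (G₀ (Ring.inverse (1 + (L - L₀) ∘L G₀) (L p))) = L p := by
  set N : Q →L[ℝ] Q := 1 + (L - L₀) ∘L G₀ with hNdef
  have hcancel (q : Q) : Ring.inverse N (N q) = q :=
    DFunLike.congr_fun (Ring.inverse_mul_cancel N hN) q
  have hNL₀ {q : P} (hq : q ∈ V) : N (L₀ q) = L (G₀ (L₀ q)) := by simp [hNdef, hG₀ q hq]
  have hrange : (V.map (L₀ : P →ₗ[ℝ] Q)).map (N : Q →ₗ[ℝ] Q) = V.map (L : P →ₗ[ℝ] Q) := by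
    refine Submodule.eq_of_le_of_finrank_eq ?_ ?_
    · rintro _ ⟨_, ⟨q, hq, rfl⟩, rfl⟩
      exact ⟨_, hG₀V _, (hNL₀ hq).symm⟩
    · have hinj : Function.Injective N := Function.LeftInverse.injective hcancel
      exact (Submodule.equivMapOfInjective (N : Q →ₗ[ℝ] Q) hinj _).finrank_eq.symm.trans hrank.symm
  obtain ⟨_, ⟨q, hq, rfl⟩, hqp⟩ := hrange.ge (Submodule.mem_map_of_mem hp)
  have hqp' : N (L₀ q) = L p := hqp
  rw [← hqp', hcancel, hNL₀ hq]

variable [FiniteDimensional ℝ Q]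

theorem exists_generalized_inverse (V : Submodule ℝ P) (L : P →L[ℝ] Q) :
    ∃ G : Q →L[ℝ] P, (∀ q, G q ∈ V) ∧ ∀ p ∈ V, L (G (L p)) = L p := by
  let L_V := (L : P →ₗ[ℝ] Q).domRestrict V
  obtain ⟨π, hπ⟩ := LinearMap.exists_leftInverse_of_injective _ (LinearMap.range L_V).ker_subtype
  obtain ⟨σ, hσ⟩ := LinearMap.exists_rightInverse_of_surjective _ L_V.range_rangeRestrict
  refine ⟨LinearMap.toContinuousLinearMap (V.subtype ∘ₗ σ ∘ₗ π), fun q => (σ (π q)).2,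
    fun p hp => ?_⟩
  have hproj : π (L p) = L_V.rangeRestrict ⟨p, hp⟩ :=
    DFunLike.congr_fun hπ (L_V.rangeRestrict ⟨p, hp⟩)
  have hsection : L_V (σ (π (L p))) = π (L p) :=
    congrArg Subtype.val (DFunLike.congr_fun hσ (π (L p)))
  exact hsection.trans (congrArg Subtype.val hproj)

variable {E : Type*} [NormedAddCommGroup E] [NormedSpace ℝ E] {H : Type*} [TopologicalSpace H]
  {I : ModelWithCorners ℝ E H} {M : Type*} [TopologicalSpace M] [ChartedSpace H M]
  {m : WithTop ℕ∞} {x₀ : M}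

theorem exists_contMDiffAt_generalized_inverse (V : Submodule ℝ P) {L : M → P →L[ℝ] Q}
    (hL : ∀ᶠ x in 𝓝 x₀, ContMDiffAt I 𝓘(ℝ, P →L[ℝ] Q) m L x)
    (hrank : ∀ᶠ x in 𝓝 x₀, Module.finrank ℝ (V.map (L x : P →ₗ[ℝ] Q)) =
      Module.finrank ℝ (V.map (L x₀ : P →ₗ[ℝ] Q))) :
    ∃ G : M → Q →L[ℝ] P, ∀ᶠ x in 𝓝 x₀, ContMDiffAt I 𝓘(ℝ, Q →L[ℝ] P) m G x ∧
      (∀ q, G x q ∈ V) ∧ ∀ p ∈ V, L x (G x (L x p)) = L x p := by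
  obtain ⟨G₀, hG₀V, hG₀⟩ := exists_generalized_inverse V (L x₀)
  let N : M → Q →L[ℝ] Q := fun x => 1 + (L x - L x₀) ∘L G₀
  have hN : ∀ᶠ x in 𝓝 x₀, ContMDiffAt I 𝓘(ℝ, Q →L[ℝ] Q) m N x := hL.mono fun x hx =>
    contMDiffAt_const.add ((hx.sub contMDiffAt_const).clm_comp contMDiffAt_const)
  have hunit : ∀ᶠ x in 𝓝 x₀, IsUnit (N x) :=
    hN.self_of_nhds.continuousAt.eventually_mem (Units.isOpen.mem_nhds (by simp [N]))
  refine ⟨fun x => G₀ ∘L Ring.inverse (N x), ?_⟩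
  filter_upwards [hN, hunit, hrank] with x hNx hx hrankx
  refine ⟨contMDiffAt_const.clm_comp ?_, fun q => hG₀V _, fun p hp =>
    apply_perturbed_generalized_inverse hG₀V hG₀ hx hrankx hp⟩
  obtain ⟨u, hu⟩ := hx
  exact (hu ▸ contDiffAt_ringInverse ℝ u :
    ContDiffAt ℝ m Ring.inverse (N x)).contMDiffAt.comp x hNx

theorem exists_contMDiffAt_generalized_inverse_of_linear {R : Type*} [NormedAddCommGroup R]
    [NormedSpace ℝ R] [FiniteDimensional ℝ R] (L : R →ₗ[ℝ] P →ₗ[ℝ] Q) (V : Submodule ℝ P)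
    {K : R → Submodule ℝ P} (hK : ∀ r p, p ∈ K r ↔ p ∈ V ∧ L r p = 0)
    {f : M → R} (hf : ∀ᶠ x in 𝓝 x₀, ContMDiffAt I 𝓘(ℝ, R) m f x)
    (hker : ∀ᶠ x in 𝓝 x₀, Module.finrank ℝ (K (f x)) = Module.finrank ℝ (K (f x₀))) :
    ∃ G : M → Q →ₗ[ℝ] P, ∀ᶠ x in 𝓝 x₀,
      (∀ B : M → Q, ContMDiffAt I 𝓘(ℝ, Q) m B x →
        ContMDiffAt I 𝓘(ℝ, P) m (fun x => G x (B x)) x) ∧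
      (∀ q, G x q ∈ V) ∧ ∀ p ∈ V, L (f x) (G x (L (f x) p)) = L (f x) p := by
  let L' : R →L[ℝ] P →L[ℝ] Q :=
    LinearMap.toContinuousLinearMap (LinearMap.toContinuousLinearMap.toLinearMap ∘ₗ L)
  have hrank (r : R) : Module.finrank ℝ (V.map (L r)) +
      Module.finrank ℝ (K r) = Module.finrank ℝ V := by
    have hrestrict := LinearMap.finrank_range_add_finrank_ker ((L r).domRestrict V)
    rwa [LinearMap.range_domRestrict, LinearMap.ker_domRestrict, ← Submodule.finrank_map_subtype_eq,
      Submodule.map_comap_subtype,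
      ← (Submodule.ext (hK r) : K r = V ⊓ LinearMap.ker (L r))] at hrestrict
  obtain ⟨G, hG⟩ := exists_contMDiffAt_generalized_inverse V (L := fun x => L' (f x))
    (hf.mono fun x hx => L'.contDiff.contMDiff.contMDiffAt.comp x hx) (hker.mono fun x hx => by
      change Module.finrank ℝ (V.map (L (f x))) = Module.finrank ℝ (V.map (L (f x₀)))
      have hsum := (hrank (f x)).trans (hrank (f x₀)).symm
      lia)
  exact ⟨fun x => G x, hG.mono fun x hx => ⟨fun B hB => hx.1.clm_apply hB, hx.2⟩⟩

end ConstantRank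

section Stabilizer

variable {F : Type*} [NormedAddCommGroup F] [NormedSpace ℝ F]

/-- The Lie algebra of the group of intertwiners of `T` with itself. -/
def infStabilizer (D : F →L[ℝ] F) (T : SymbolTensor F) : Submodule ℝ (F →L[ℝ] F) :=
  commutant D ⊓ LinearMap.ker (infAct T)

variable {D h k : F →L[ℝ] F} {T T' : SymbolTensor F}

theorem IsIntertwiner.conj_mem_infStabilizer (hh : IsIntertwiner D h T T') (hkh : k * h = 1)
    (hhk : h * k = 1) {A : F →L[ℝ] F} (hA : A ∈ infStabilizer D T) :
    h * A * k ∈ infStabilizer D T' := by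
  refine ⟨(hh.commute.mul_left hA.1).mul_left (hh.of_inverse hkh hhk).commute, ?_⟩
  have hk_right (x : F) : h (k x) = x := DFunLike.congr_fun hhk x
  have hA_ker : infAct T A = 0 := hA.2
  change infAct T' (h * A * k) = 0
  ext a b <;> rw [← hk_right a, ← hk_right b, hh.infAct_conj hkh, hA_ker] <;> simp

variable [FiniteDimensional ℝ F]

theorem IsIntertwiner.finrank_infStabilizer_le (hh : IsIntertwiner D h T T') (hkh : k * h = 1)
    (hhk : h * k = 1) :
    Module.finrank ℝ (infStabilizer D T) ≤ Module.finrank ℝ (infStabilizer D T') := by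
  have hconj (A : F →L[ℝ] F) : k * (h * A * k) * h = A := by
    rw [mul_assoc h, ← mul_assoc, ← mul_assoc, hkh, one_mul, mul_assoc, hkh, mul_one]
  refine LinearMap.finrank_le_finrank_of_injective (f := (LinearMap.mulLeftRight ℝ (h, k)).restrict
    fun A hA => hh.conj_mem_infStabilizer hkh hhk hA) fun A B hAB => Subtype.ext ?_
  have hAB' : h * A * k = h * B * k := congrArg Subtype.val hAB
  rw [← hconj A, hAB', hconj]

theorem IsIntertwiner.finrank_infStabilizer_eq (hh : IsIntertwiner D h T T')
    (hpos : IsPositive D T) (hgen : IsGeneratedInDegreeOne D T') :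
    Module.finrank ℝ (infStabilizer D T') = Module.finrank ℝ (infStabilizer D T) := by
  obtain ⟨k, hkh, hhk, hk⟩ := hh.exists_inverse hpos hgen
  exact (hk.finrank_infStabilizer_le hhk hkh).antisymm (hh.finrank_infStabilizer_le hkh hhk)

theorem exists_contMDiffAt_infAct_inverse {E : Type*} [NormedAddCommGroup E] [NormedSpace ℝ E]
    {H : Type*} [TopologicalSpace H] {I : ModelWithCorners ℝ E H} {M : Type*} [TopologicalSpace M]
    [ChartedSpace H M] {m : WithTop ℕ∞} {T : M → SymbolTensor F} {x₀ : M}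
    (hT : ∀ᶠ x in 𝓝 x₀, ContMDiffAt I 𝓘(ℝ, SymbolTensor F) m T x)
    (hrank : ∀ᶠ x in 𝓝 x₀, Module.finrank ℝ (infStabilizer D (T x)) =
      Module.finrank ℝ (infStabilizer D (T x₀))) :
    ∃ G : M → SymbolTensor F →ₗ[ℝ] F →L[ℝ] F, ∀ᶠ x in 𝓝 x₀,
      (∀ B : M → SymbolTensor F, ContMDiffAt I 𝓘(ℝ, SymbolTensor F) m B x →
        ContMDiffAt I 𝓘(ℝ, F →L[ℝ] F) m (fun x => G x (B x)) x) ∧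
      (∀ B, G x B ∈ commutant D) ∧
      ∀ A ∈ commutant D, infAct (T x) (G x (infAct (T x) A)) = infAct (T x) A := by
  obtain ⟨G, hG⟩ := exists_contMDiffAt_generalized_inverse_of_linear (I := I) (m := m)
    (P := F →L[ℝ] F) (Q := SymbolTensor F) (R := SymbolTensor F) (L := infAct) (f := T) (x₀ := x₀)
    (K := infStabilizer D) (commutant D) (fun _ _ => Iff.rfl) hT hrank
  exact ⟨G, hG⟩

end Stabilizer

section SmoothFamilies

variable {E : Type*} [NormedAddCommGroup E] [NormedSpace ℝ E] {H : Type*} [TopologicalSpace H]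
  {I : ModelWithCorners ℝ E H} {M : Type*} [TopologicalSpace M] [ChartedSpace H M]
  {m : WithTop ℕ∞} {ι F : Type*} [Fintype ι] [NormedAddCommGroup F] [NormedSpace ℝ F] {x₀ : M}

/-- The continuous linear map with prescribed values on the standard basis. -/
def linearCombinationCLM (v : ι → F) : (ι → ℝ) →L[ℝ] F :=
  LinearMap.toContinuousLinearMap (Fintype.linearCombination ℝ v)

theorem linearCombinationCLM_apply (v : ι → F) (c : ι → ℝ) :
    linearCombinationCLM v c = ∑ i, c i • v i :=
  rfl

theorem contMDiffAt_linearCombinationCLM {v : M → ι → F}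
    (hv : ∀ i, ContMDiffAt I 𝓘(ℝ, F) m (fun x => v x i) x₀) :
    ContMDiffAt I 𝓘(ℝ, (ι → ℝ) →L[ℝ] F) m (fun x => linearCombinationCLM (v x)) x₀ := by
  have heq (x : M) : linearCombinationCLM (v x) = ∑ i,
      ContinuousLinearMap.smulRightL ℝ (ι → ℝ) F (ContinuousLinearMap.proj i) (v x i) := by
    ext c
    simp [linearCombinationCLM_apply]
  simp only [heq]
  exact ContMDiffAt.sum fun i _ => (ContinuousLinearMap.smulRightL ℝ (ι → ℝ) F
    (ContinuousLinearMap.proj i)).contDiff.contMDiff.contMDiffAt.comp x₀ (hv i)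

theorem exists_contMDiffAt_leftInverse_linearCombinationCLM [FiniteDimensional ℝ F]
    {v : M → ι → F} (hv : ∀ᶠ x in 𝓝 x₀, ContMDiffAt I 𝓘(ℝ, ι → F) m v x)
    (hli : LinearIndependent ℝ (v x₀)) :
    ∃ G : M → F →L[ℝ] ι → ℝ, ∀ᶠ x in 𝓝 x₀, ContMDiffAt I 𝓘(ℝ, F →L[ℝ] ι → ℝ) m G x ∧
      ∀ c, G x (linearCombinationCLM (v x) c) = c := by
  have hinj : ∀ᶠ x in 𝓝 x₀, Function.Injective (linearCombinationCLM (v x)) := by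
    filter_upwards [hv.self_of_nhds.continuousAt.eventually hli.eventually] with x hx
    exact LinearIndependent.fintypeLinearCombination_injective hx
  have hfinrank {x : M} (hx : Function.Injective (linearCombinationCLM (v x))) :
      Module.finrank ℝ ((⊤ : Submodule ℝ (ι → ℝ)).map
        (linearCombinationCLM (v x) : (ι → ℝ) →ₗ[ℝ] F)) = Module.finrank ℝ (ι → ℝ) := by
    rw [Submodule.map_top]
    exact LinearMap.finrank_range_of_inj hx
  obtain ⟨G, hG⟩ := exists_contMDiffAt_generalized_inverse ⊤
    (hv.mono fun x hx => contMDiffAt_linearCombinationCLM (contMDiffAt_pi_space.1 hx))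
    (hinj.mono fun x hx => (hfinrank hx).trans (hfinrank hinj.self_of_nhds).symm)
  refine ⟨G, ?_⟩
  filter_upwards [hG, hinj] with x hGx hx
  exact ⟨hGx.1, fun c => hx (hGx.2.2 c trivial)⟩

theorem exists_contMDiff_eventuallyEq [T2Space M] [FiniteDimensional ℝ E] [IsManifold I ∞ M]
    {f : M → F} (hf : ∀ᶠ x in 𝓝 x₀, ContMDiffAt I 𝓘(ℝ, F) ∞ f x) :
    ∃ g : M → F, ContMDiff I 𝓘(ℝ, F) ∞ g ∧ g =ᶠ[𝓝 x₀] f := by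
  obtain ⟨ρ, -, hρ⟩ := (SmoothBumpFunction.nhds_basis_tsupport (I := I) x₀).mem_iff.1 hf
  refine ⟨fun x => ρ x • f x, contMDiff_of_tsupport fun x hx => ?_, ?_⟩
  · exact (ρ.contMDiff x).smul (hρ (closure_mono (Function.support_smul_subset_left _ _) hx))
  · filter_upwards [ρ.eventuallyEq_one] with x hx
    simp [hx]

end SmoothFamilies

section SmoothFields

variable {n : ℕ} {M : Type*} [TopologicalSpace M] [ChartedSpace (EuclideanSpace ℝ (Fin n)) M]
  [IsManifold (𝓡 n) ∞ M]

instance (x : M) : FiniteDimensional ℝ (TangentSpace (𝓡 n) x) :=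
  inferInstanceAs (FiniteDimensional ℝ (EuclideanSpace ℝ (Fin n)))

theorem IsSmooth.mdifferentiableAt {X : VField n M} (hX : IsSmooth X) (x : M) :
    MDifferentiableAt (𝓡 n) (𝓡 n).tangent (fun x => (⟨x, X x⟩ : TangentBundle (𝓡 n) M)) x :=
  (hX x).mdifferentiableAt (by simp)

theorem IsSmooth.zero : IsSmooth (fun _ => 0 : VField n M) :=
  Bundle.contMDiff_zeroSection ℝ (TangentSpace (𝓡 n) : M → Type _)

theorem IsSmooth.add {X Y : VField n M} (hX : IsSmooth X) (hY : IsSmooth Y) :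
    IsSmooth (fun x => X x + Y x) :=
  ContMDiff.add_section (V := (TangentSpace (𝓡 n) : M → Type _)) hX hY

theorem IsSmooth.smul {f : M → ℝ} {X : VField n M} (hf : ContMDiff (𝓡 n) 𝓘(ℝ, ℝ) ∞ f)
    (hX : IsSmooth X) : IsSmooth (fun x => f x • X x) :=
  ContMDiff.smul_section (V := (TangentSpace (𝓡 n) : M → Type _)) hf hX

theorem IsSmooth.sum {ι : Type*} (s : Finset ι) {X : ι → VField n M}
    (hX : ∀ i ∈ s, IsSmooth (X i)) : IsSmooth (fun x => ∑ i ∈ s, X i x) :=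
  ContMDiff.sum_section (V := (TangentSpace (𝓡 n) : M → Type _)) hX

theorem IsSmooth.mlieBracket {X Y : VField n M} (hX : IsSmooth X) (hY : IsSmooth Y) :
    IsSmooth (VectorField.mlieBracket (𝓡 n) X Y) := by
  have : IsManifold (𝓡 n) (minSmoothness ℝ 2) M := by
    simpa only [minSmoothness_of_isRCLikeNormedField] using .of_le (n := ∞) ENat.LEInfty.out
  have : IsManifold (𝓡 n) ((⊤ : ℕ∞) + 1) M := by
    simpa using! (inferInstance : IsManifold (𝓡 n) ∞ M)
  exact ContDiff.mlieBracket_vectorField (m := ⊤) (n := ⊤) hX hY (by simp)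

theorem mlieBracket_sum_smul_left {ι : Type*} (s : Finset ι) {f : ι → M → ℝ} {W : ι → VField n M}
    {Y : VField n M} (hf : ∀ i, ContMDiff (𝓡 n) 𝓘(ℝ, ℝ) ∞ (f i)) (hW : ∀ i, IsSmooth (W i))
    (x : M) :
    VectorField.mlieBracket (𝓡 n) (fun x => ∑ i ∈ s, f i x • W i x) Y x =
      ∑ i ∈ s, (-(mvfderiv (𝓡 n) (f i) x (Y x)) • W i x +
        f i x • VectorField.mlieBracket (𝓡 n) (W i) Y x) := by
  classical
  induction s using Finset.induction_on with
  | empty => exact congrFun VectorField.mlieBracket_zero_left x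
  | insert a s ha ih =>
    have hinsert : (fun x => ∑ i ∈ insert a s, f i x • W i x : VField n M) =
        (f a • W a) + fun x => ∑ i ∈ s, f i x • W i x :=
      funext fun x => Finset.sum_insert ha
    rw [hinsert, VectorField.mlieBracket_add_left (V := f a • W a)
      (((hW a).smul (hf a)).mdifferentiableAt x)
      ((IsSmooth.sum s fun i _ => (hW i).smul (hf i)).mdifferentiableAt x), ih,
      VectorField.mlieBracket_smul_left ((hf a x).mdifferentiableAt (by simp))
        ((hW a).mdifferentiableAt x), Finset.sum_insert ha]

theorem mlieBracket_jacobi {X Y Z : VField n M} (hX : IsSmooth X) (hY : IsSmooth Y)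
    (hZ : IsSmooth Z) : VectorField.mlieBracket (𝓡 n) X (VectorField.mlieBracket (𝓡 n) Y Z) =
      VectorField.mlieBracket (𝓡 n) (VectorField.mlieBracket (𝓡 n) X Y) Z +
        VectorField.mlieBracket (𝓡 n) Y (VectorField.mlieBracket (𝓡 n) X Z) := by
  have : IsManifold (𝓡 n) (minSmoothness ℝ 3) M := by
    simpa only [minSmoothness_of_isRCLikeNormedField] using .of_le (n := ∞) ENat.LEInfty.out
  have hle : minSmoothness ℝ 2 ≤ ∞ := by
    simpa only [minSmoothness_of_isRCLikeNormedField] using ENat.LEInfty.out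
  exact VectorField.leibniz_identity_mlieBracket (hX.of_le hle) (hY.of_le hle) (hZ.of_le hle)

/-- The preferred trivialization of the tangent bundle near `x₀`. -/
abbrev tangentTriv (n : ℕ) {M : Type*} [TopologicalSpace M]
    [ChartedSpace (EuclideanSpace ℝ (Fin n)) M] [IsManifold (𝓡 n) ∞ M] (x₀ : M) :
    Bundle.Trivialization (EuclideanSpace ℝ (Fin n))
      (Bundle.TotalSpace.proj : TangentBundle (𝓡 n) M → M) :=
  trivializationAt (EuclideanSpace ℝ (Fin n)) (TangentSpace (𝓡 n) : M → Type _) x₀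

/-- The representation of a vector field in the trivialization at `x₀`. -/
def localRep (x₀ : M) (X : VField n M) (x : M) : EuclideanSpace ℝ (Fin n) :=
  (tangentTriv n x₀ ⟨x, X x⟩).2

variable {x₀ x : M}

theorem linearEquivAt_tangentTriv_apply (hx : x ∈ (tangentTriv n x₀).baseSet) (X : VField n M) :
    (tangentTriv n x₀).linearEquivAt ℝ x hx (X x) = localRep x₀ X x :=
  rfl

theorem eventually_mem_baseSet_tangentTriv (n : ℕ) {M : Type*} [TopologicalSpace M]
    [ChartedSpace (EuclideanSpace ℝ (Fin n)) M] [IsManifold (𝓡 n) ∞ M] (x₀ : M) :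
    ∀ᶠ x in 𝓝 x₀, x ∈ (tangentTriv n x₀).baseSet :=
  (tangentTriv n x₀).open_baseSet.mem_nhds (FiberBundle.mem_baseSet_trivializationAt' x₀)

theorem contMDiffAt_localRep_iff (hx : x ∈ (tangentTriv n x₀).baseSet) (X : VField n M) :
    ContMDiffAt (𝓡 n) 𝓘(ℝ, EuclideanSpace ℝ (Fin n)) ∞ (localRep x₀ X) x ↔
    ContMDiffAt (𝓡 n) (𝓡 n).tangent ∞ (fun x => (⟨x, X x⟩ : TangentBundle (𝓡 n) M)) x :=
  (Bundle.Trivialization.contMDiffAt_section_iff (IB := 𝓡 n) (n := ∞) _ hx).symm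

variable {ι : Type*} {Z : ι → VField n M}

theorem linearIndependent_localRep_iff (hx : x ∈ (tangentTriv n x₀).baseSet) :
    LinearIndependent ℝ (fun i => localRep x₀ (Z i) x) ↔ LinearIndependent ℝ fun i => Z i x :=
  LinearMap.linearIndependent_iff ((tangentTriv n x₀).linearEquivAt ℝ x hx).toLinearMap
    (LinearEquiv.ker _)

theorem eventually_linearIndependent [Finite ι] (hZ : ∀ i, IsSmooth (Z i))
    (hli : LinearIndependent ℝ fun i => Z i x₀) :
    ∀ᶠ x in 𝓝 x₀, LinearIndependent ℝ fun i => Z i x := by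
  have hbase := eventually_mem_baseSet_tangentTriv n x₀
  have hli' := (linearIndependent_localRep_iff hbase.self_of_nhds).2 hli
  have hcont : ContinuousAt (fun x i => localRep x₀ (Z i) x) x₀ := continuousAt_pi.2 fun i =>
    ((contMDiffAt_localRep_iff hbase.self_of_nhds (Z i)).2 (hZ i x₀)).continuousAt
  filter_upwards [hbase, hcont.eventually hli'.eventually] with x hx hlix
  exact (linearIndependent_localRep_iff hx).1 hlix

theorem IsSubbundle.eventually_finrank_eq {D : Distribution n M} (hD : IsSubbundle D) (x₀ : M) :
    ∀ᶠ x in 𝓝 x₀, Module.finrank ℝ (D x) = Module.finrank ℝ (D x₀) := by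
  obtain ⟨U, hU, hx₀, r, X, -, hframe⟩ := hD x₀
  have hfinrank (x : M) (hx : x ∈ U) : Module.finrank ℝ (D x) = r := by
    rw [← (hframe x hx).2, finrank_span_eq_card (hframe x hx).1, Fintype.card_fin]
  filter_upwards [hU.mem_nhds hx₀] with x hx
  rw [hfinrank x hx, hfinrank x₀ hx₀]

theorem IsSubbundle.eventually_span_eq [Finite ι] {D : Distribution n M}
    (hD : IsSubbundle D) (hZ : ∀ i, IsSection D (Z i))
    (hli : LinearIndependent ℝ fun i => Z i x₀)
    (hspan : Submodule.span ℝ (range fun i => Z i x₀) = D x₀) :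
    ∀ᶠ x in 𝓝 x₀, Submodule.span ℝ (range fun i => Z i x) = D x := by
  have := Fintype.ofFinite ι
  filter_upwards [hD.eventually_finrank_eq x₀,
    eventually_linearIndependent (fun i => (hZ i).smooth) hli] with x hx hlix
  refine Submodule.eq_of_le_of_finrank_eq
    (Submodule.span_le.2 (range_subset_iff.2 fun i => (hZ i).mem x)) ?_
  rw [hx, ← hspan, finrank_span_eq_card hli, finrank_span_eq_card hlix]

variable [Fintype ι]

theorem contMDiffAt_localRep_family (hZ : ∀ i, IsSmooth (Z i))
    (hx : x ∈ (tangentTriv n x₀).baseSet) :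
    ContMDiffAt (𝓡 n) 𝓘(ℝ, ι → EuclideanSpace ℝ (Fin n)) ∞ (fun x i => localRep x₀ (Z i) x) x :=
  contMDiffAt_pi_space.2 fun i => (contMDiffAt_localRep_iff hx (Z i)).2 (hZ i x)

theorem exists_contMDiff_coeff [T2Space M] (hZ : ∀ i, IsSmooth (Z i))
    (hli : LinearIndependent ℝ fun i => Z i x₀) {X : VField n M} (hX : IsSmooth X)
    (hspan : ∀ᶠ x in 𝓝 x₀, X x ∈ Submodule.span ℝ (range fun i => Z i x)) :
    ∃ f : ι → M → ℝ, (∀ i, ContMDiff (𝓡 n) 𝓘(ℝ, ℝ) ∞ (f i)) ∧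
      ∀ᶠ x in 𝓝 x₀, X x = ∑ i, f i x • Z i x := by
  have hbase := eventually_mem_baseSet_tangentTriv n x₀
  obtain ⟨G, hG⟩ := exists_contMDiffAt_leftInverse_linearCombinationCLM
    (hbase.mono fun x hx => contMDiffAt_localRep_family hZ hx)
    ((linearIndependent_localRep_iff hbase.self_of_nhds).2 hli)
  have hcoeff : ∀ᶠ x in 𝓝 x₀, ContMDiffAt (𝓡 n) 𝓘(ℝ, ι → ℝ) ∞
      (fun x => G x (localRep x₀ X x)) x := by
    filter_upwards [hbase, hG] with x hx hGx
    exact hGx.1.clm_apply ((contMDiffAt_localRep_iff hx X).2 (hX x))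
  obtain ⟨f, hf, hfG⟩ := exists_contMDiff_eventuallyEq hcoeff
  refine ⟨fun i x => f x i, contMDiff_pi_space.1 hf, ?_⟩
  filter_upwards [hbase, hG, hfG, hspan] with x hx hGx hfx hXx
  obtain ⟨c, hc⟩ := (Submodule.mem_span_range_iff_exists_fun ℝ).1 hXx
  have hrep : localRep x₀ X x = linearCombinationCLM (fun i => localRep x₀ (Z i) x) c := by
    simp only [← linearEquivAt_tangentTriv_apply hx, ← hc, map_sum, map_smul,
      linearCombinationCLM_apply]
  rw [hfx, hrep, hGx.2, hc]

end SmoothFields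

section Flag

variable {n : ℕ} {M : Type*} [TopologicalSpace M] [ChartedSpace (EuclideanSpace ℝ (Fin n)) M]
  [IsManifold (𝓡 n) ∞ M] {D : Distribution n M}

theorem IsIteratedBracket.isSmooth {j : ℕ} {Z : VField n M} (h : IsIteratedBracket D j Z) :
    IsSmooth Z := by
  induction h with
  | one hX => exact hX.smooth
  | succ hX _ ih => exact hX.smooth.mlieBracket ih

theorem flag_mono (D : Distribution n M) {i j : ℕ} (h : i ≤ j) (x : M) : flag D i x ≤ flag D j x :=
  Submodule.span_mono fun _ ⟨k, hk, Z, hZ, e⟩ => ⟨k, hk.trans h, Z, hZ, e⟩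

theorem IsIteratedBracket.isSection_flag {j k : ℕ} {Z : VField n M} (h : IsIteratedBracket D j Z)
    (hjk : j ≤ k) : IsSection (flag D k) Z :=
  ⟨h.isSmooth, fun _ => Submodule.subset_span ⟨j, hjk, Z, h, rfl⟩⟩

theorem IsSection.mono {i j : ℕ} {X : VField n M} (hX : IsSection (flag D i) X) (h : i ≤ j) :
    IsSection (flag D j) X :=
  ⟨hX.smooth, fun x => flag_mono D h x (hX.mem x)⟩

theorem IsSection.add {X Y : VField n M} (hX : IsSection D X) (hY : IsSection D Y) :
    IsSection D (fun x => X x + Y x) :=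
  ⟨hX.smooth.add hY.smooth, fun x => Submodule.add_mem _ (hX.mem x) (hY.mem x)⟩

theorem IsSection.smul {f : M → ℝ} {X : VField n M} (hX : IsSection D X)
    (hf : ContMDiff (𝓡 n) 𝓘(ℝ, ℝ) ∞ f) : IsSection D (fun x => f x • X x) :=
  ⟨hX.smooth.smul hf, fun x => Submodule.smul_mem _ _ (hX.mem x)⟩

theorem IsSection.sum {ι : Type*} (s : Finset ι) {X : ι → VField n M}
    (hX : ∀ i ∈ s, IsSection D (X i)) : IsSection D (fun x => ∑ i ∈ s, X i x) :=
  ⟨IsSmooth.sum s fun i hi => (hX i hi).smooth, fun x => Submodule.sum_mem _ fun i hi =>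
    (hX i hi).mem x⟩

theorem IsSection.add_smul {X Y : VField n M} (hX : IsSection D X) (hY : IsSection D Y) (c : ℝ) :
    IsSection D (fun x => X x + c • Y x) :=
  hX.add (hY.smul contMDiff_const)

theorem mlieBracket_add_smul_left {X X' Y : VField n M} (hX : IsSmooth X) (hX' : IsSmooth X')
    (c : ℝ) (x : M) : VectorField.mlieBracket (𝓡 n) (fun x => X x + c • X' x) Y x =
      VectorField.mlieBracket (𝓡 n) X Y x + c • VectorField.mlieBracket (𝓡 n) X' Y x := by
  have hsmul := VectorField.mlieBracket_const_smul_left (W := Y) (c := c) (hX'.mdifferentiableAt x)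
  exact (VectorField.mlieBracket_add_left (V := X) (V₁ := c • X') (hX.mdifferentiableAt x)
    ((hX'.smul contMDiff_const).mdifferentiableAt x)).trans (congrArg _ hsmul)

theorem mlieBracket_add_smul_right {X X' Y : VField n M} (hX : IsSmooth X) (hX' : IsSmooth X')
    (c : ℝ) (x : M) : VectorField.mlieBracket (𝓡 n) Y (fun x => X x + c • X' x) x =
      VectorField.mlieBracket (𝓡 n) Y X x + c • VectorField.mlieBracket (𝓡 n) Y X' x := by
  rw [VectorField.mlieBracket_swap_apply, mlieBracket_add_smul_left hX hX',
    VectorField.mlieBracket_swap_apply (V := Y), VectorField.mlieBracket_swap_apply (V := Y)]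
  module

variable [T2Space M]

theorem IsSection.exists_eq_sum (hreg : IsEquiregular D) {k : ℕ} {X : VField n M}
    (hX : IsSection (flag D k) X) (x₀ : M) :
    ∃ (r : ℕ) (W : Fin r → VField n M) (f : Fin r → M → ℝ),
      (∀ i, ∃ j ≤ k, IsIteratedBracket D j (W i)) ∧
      (∀ i, ContMDiff (𝓡 n) 𝓘(ℝ, ℝ) ∞ (f i)) ∧ LinearIndependent ℝ (fun i => W i x₀) ∧
      ∀ᶠ x in 𝓝 x₀, X x = ∑ i, f i x • W i x := by
  obtain ⟨b, hb, hspan, hli⟩ := exists_linearIndependent ℝ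
    {v | ∃ j ≤ k, ∃ Z : VField n M, IsIteratedBracket D j Z ∧ Z x₀ = v}
  have hfinite : Finite b := hli.finite
  obtain ⟨r, ⟨e⟩⟩ := Finite.exists_equiv_fin b
  choose j hj W hW hWx using fun i : Fin r => hb (e.symm i).2
  replace hWx : (fun i => W i x₀) = Subtype.val ∘ e.symm := funext hWx
  have hliW : LinearIndependent ℝ (fun i => W i x₀) := hWx ▸ hli.comp _ e.symm.injective
  have hspanW : Submodule.span ℝ (range fun i => W i x₀) = flag D k x₀ := by
    rw [hWx, e.symm.surjective.range_comp, Subtype.range_coe, hspan, flag]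
  have hspan_near := (hreg k).eventually_span_eq (fun i => (hW i).isSection_flag (hj i)) hliW hspanW
  obtain ⟨f, hf, hXf⟩ := exists_contMDiff_coeff (fun i => (hW i).isSmooth) hliW hX.smooth
    (hspan_near.mono fun x hx => hx ▸ hX.mem x)
  exact ⟨r, W, f, fun i => ⟨j i, hj i, hW i⟩, hf, hliW, hXf⟩

theorem mlieBracket_mem_of_bracket_mem (hreg : IsEquiregular D) {i m : ℕ} {X Y : VField n M}
    (hX : IsSection (flag D i) X) (x : M) (him : i ≤ m)
    (hW : ∀ j ≤ i, ∀ W, IsIteratedBracket D j W →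
      VectorField.mlieBracket (𝓡 n) W Y x ∈ flag D m x) :
    VectorField.mlieBracket (𝓡 n) X Y x ∈ flag D m x := by
  obtain ⟨r, W, f, hW_iter, hf, -, heq⟩ := hX.exists_eq_sum hreg x
  choose j hj hW_iter using hW_iter
  rw [Filter.EventuallyEq.mlieBracket_vectorField_eq (W₁ := Y) (W := Y) heq EventuallyEq.rfl,
    mlieBracket_sum_smul_left _ hf fun a => (hW_iter a).isSmooth]
  refine Submodule.sum_mem _ fun a _ => Submodule.add_mem _ (Submodule.smul_mem _ _ ?_)
    (Submodule.smul_mem _ _ (hW _ (hj a) _ (hW_iter a)))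
  exact ((hW_iter a).isSection_flag ((hj a).trans him)).mem x

theorem IsSection.mlieBracket_mem_flag_succ (hreg : IsEquiregular D) {X Y : VField n M} {j : ℕ}
    (hX : IsSection D X) (hY : IsSection (flag D j) Y) (x : M) :
    VectorField.mlieBracket (𝓡 n) X Y x ∈ flag D (j + 1) x := by
  rw [VectorField.mlieBracket_swap_apply]
  refine Submodule.neg_mem _ (mlieBracket_mem_of_bracket_mem hreg hY x (by lia) ?_)
  intro k hk W hW
  rw [VectorField.mlieBracket_swap_apply]
  exact Submodule.neg_mem _ (((IsIteratedBracket.succ hX hW).isSection_flag (by lia)).mem x)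

theorem IsIteratedBracket.mlieBracket_mem_flag_add (hreg : IsEquiregular D) {i : ℕ}
    {W : VField n M} (hW : IsIteratedBracket D i W) {j : ℕ} {Y : VField n M}
    (hY : IsSection (flag D j) Y) (x : M) :
    VectorField.mlieBracket (𝓡 n) W Y x ∈ flag D (i + j) x := by
  induction hW generalizing j Y x with
  | one hX => exact add_comm j 1 ▸ hX.mlieBracket_mem_flag_succ hreg hY x
  | @succ i X Z hX hZ ih =>
    have hZY : IsSection (flag D (i + j)) (VectorField.mlieBracket (𝓡 n) Z Y) :=
      ⟨hZ.isSmooth.mlieBracket hY.smooth, ih hY⟩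
    have hXY : IsSection (flag D (j + 1)) (VectorField.mlieBracket (𝓡 n) X Y) :=
      ⟨hX.smooth.mlieBracket hY.smooth, hX.mlieBracket_mem_flag_succ hreg hY⟩
    have hjacobi := congrFun (mlieBracket_jacobi hX.smooth hZ.isSmooth hY.smooth) x
    rw [Pi.add_apply, ← sub_eq_iff_eq_add] at hjacobi
    rw [← hjacobi, show i + 1 + j = i + j + 1 by lia]
    exact Submodule.sub_mem _ (hX.mlieBracket_mem_flag_succ hreg hZY x) (ih hXY x)

theorem IsSection.mlieBracket (hreg : IsEquiregular D) {i j : ℕ} {X Y : VField n M}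
    (hX : IsSection (flag D i) X) (hY : IsSection (flag D j) Y) :
    IsSection (flag D (i + j)) (VectorField.mlieBracket (𝓡 n) X Y) :=
  ⟨hX.smooth.mlieBracket hY.smooth, fun x => mlieBracket_mem_of_bracket_mem hreg hX x (by lia)
    fun _ hk _ hW => flag_mono D (by lia) x (hW.mlieBracket_mem_flag_add hreg hY x)⟩

theorem mlieBracket_mem_of_eq_zero (hreg : IsEquiregular D) {i : ℕ} {X Y : VField n M}
    (hX : IsSection (flag D i) X) {x : M} (hXx : X x = 0) :
    VectorField.mlieBracket (𝓡 n) X Y x ∈ flag D i x := by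
  obtain ⟨r, W, f, hW_iter, hf, hli, heq⟩ := hX.exists_eq_sum hreg x
  choose j hj hW_iter using hW_iter
  have hfx : ∀ a, f a x = 0 := Fintype.linearIndependent_iff.1 hli _ (heq.self_of_nhds ▸ hXx)
  rw [Filter.EventuallyEq.mlieBracket_vectorField_eq (W₁ := Y) (W := Y) heq EventuallyEq.rfl,
    mlieBracket_sum_smul_left _ hf fun a => (hW_iter a).isSmooth]
  refine Submodule.sum_mem _ fun a _ => ?_
  rw [hfx, zero_smul, add_zero]
  exact Submodule.smul_mem _ _ (((hW_iter a).isSection_flag (hj a)).mem x)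

end Flag

namespace Structure

variable {n : ℕ} {M : Type*} [TopologicalSpace M] [ChartedSpace (EuclideanSpace ℝ (Fin n)) M]
  [IsManifold (𝓡 n) ∞ M] (S : Structure n M)

theorem grMk_eq_iff {x : M} {k : ℕ} {v w : TangentSpace (𝓡 n) x} (hv : v ∈ flag S.E k x)
    (hw : w ∈ flag S.E k x) : S.grMk x k v hv = S.grMk x k w hw ↔ v - w ∈ flag S.E (k - 1) x := by
  rw [grMk, grMk, Submodule.Quotient.eq]
  rfl

theorem grMk_eq_zero_iff {x : M} {k : ℕ} {v : TangentSpace (𝓡 n) x} (hv : v ∈ flag S.E k x) :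
    S.grMk x k v hv = 0 ↔ v ∈ flag S.E (k - 1) x := by
  rw [grMk, Submodule.Quotient.mk_eq_zero]
  rfl

theorem grMk_add_smul {x : M} {k : ℕ} {v w : TangentSpace (𝓡 n) x} (hv : v ∈ flag S.E k x)
    (hw : w ∈ flag S.E k x) (c : ℝ) : S.grMk x k (v + c • w)
      (Submodule.add_mem _ hv (Submodule.smul_mem _ _ hw)) =
        S.grMk x k v hv + c • S.grMk x k w hw := rfl

theorem of_grMk_congr {x : M} {i j : ℕ} (h : i = j) {v w : TangentSpace (𝓡 n) x} (hvw : v = w)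
    (hv : v ∈ flag S.E i x) (hw : w ∈ flag S.E j x) :
    DirectSum.of (S.GrPiece x) i (S.grMk x i v hv) =
      DirectSum.of (S.GrPiece x) j (S.grMk x j w hw) := by
  subst h hvw
  rfl

variable [T2Space M] {S} (hreg : IsEquiregular S.E)

include hreg

theorem exists_isSection_grMk_eq {x : M} {k : ℕ} (a : S.GrPiece x k) :
    ∃ (X : VField n M) (hX : IsSection (flag S.E k) X), S.grMk x k (X x) (hX.mem x) = a := by
  obtain ⟨⟨v, hv⟩, rfl⟩ := Submodule.Quotient.mk_surjective _ a
  obtain ⟨X, hX, rfl⟩ := (hreg k).exists_isSection hv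
  exact ⟨X, hX, rfl⟩

theorem mlieBracket_mem_pred {i j : ℕ} {X Y : VField n M} (hX : IsSection (flag S.E i) X)
    (hY : IsSection (flag S.E j) Y) {x : M} (hx : X x ∈ flag S.E (i - 1) x) :
    VectorField.mlieBracket (𝓡 n) X Y x ∈ flag S.E (i + j - 1) x := by
  rcases Nat.eq_zero_or_pos i with rfl | hi
  · have hX_zero : X = 0 := funext fun y => by simpa [flag_zero] using hX.mem y
    simp [hX_zero]
  rcases Nat.eq_zero_or_pos j with rfl | hj
  · have hY_zero : Y = 0 := funext fun y => by simpa [flag_zero] using hY.mem y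
    simp [hY_zero]
  obtain ⟨X', hX', hX'x⟩ := (hreg (i - 1)).exists_isSection hx
  have hdiff : VectorField.mlieBracket (𝓡 n) (fun y => X y + (-1 : ℝ) • X' y) Y x ∈
      flag S.E i x :=
    mlieBracket_mem_of_eq_zero hreg (hX.add_smul (hX'.mono (by lia)) (-1)) (by simp [hX'x])
  rw [mlieBracket_add_smul_left hX.smooth hX'.smooth, neg_one_smul, ← sub_eq_add_neg] at hdiff
  have hX'Y := flag_mono S.E (by lia : i - 1 + j ≤ i + j - 1) x ((hX'.mlieBracket hreg hY).mem x)
  exact (Submodule.sub_mem_iff_left _ hX'Y).1 (flag_mono S.E (by lia : i ≤ i + j - 1) x hdiff)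

theorem mlieBracket_sub_mem_pred {i j : ℕ} {X X' Y Y' : VField n M}
    (hX : IsSection (flag S.E i) X) (hX' : IsSection (flag S.E i) X')
    (hY : IsSection (flag S.E j) Y) (hY' : IsSection (flag S.E j) Y') {x : M}
    (hx : X x - X' x ∈ flag S.E (i - 1) x) (hy : Y x - Y' x ∈ flag S.E (j - 1) x) :
    VectorField.mlieBracket (𝓡 n) X Y x - VectorField.mlieBracket (𝓡 n) X' Y' x ∈
      flag S.E (i + j - 1) x := by
  have hleft := mlieBracket_mem_pred hreg (hX.add_smul hX' (-1)) hY (x := x)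
    (by simpa [sub_eq_add_neg] using hx)
  have hright := mlieBracket_mem_pred hreg (hY.add_smul hY' (-1)) hX' (x := x)
    (by simpa [sub_eq_add_neg] using hy)
  rw [mlieBracket_add_smul_left hX.smooth hX'.smooth] at hleft
  rw [VectorField.mlieBracket_swap_apply,
    mlieBracket_add_smul_right hY.smooth hY'.smooth, add_comm j i] at hright
  convert Submodule.sub_mem _ hleft hright using 1
  module

theorem leviBracket_mk {i j : ℕ} {X Y : VField n M} (hX : IsSection (flag S.E i) X)
    (hY : IsSection (flag S.E j) Y) (x : M) :
    S.leviBracket x (S.grMk x i (X x) (hX.mem x)) (S.grMk x j (Y x) (hY.mem x)) =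
      S.grMk x (i + j) (VectorField.mlieBracket (𝓡 n) X Y x) ((hX.mlieBracket hreg hY).mem x) := by
  have hex : ∃ c, S.IsLeviBracket x (S.grMk x i (X x) (hX.mem x))
      (S.grMk x j (Y x) (hY.mem x)) c :=
    ⟨_, X, Y, hX, hY, (hX.mlieBracket hreg hY).mem x, rfl, rfl, rfl⟩
  rw [leviBracket, dif_pos hex]
  obtain ⟨X', Y', hX', hY', _, hXX', hYY', hbracket⟩ := hex.choose_spec
  rw [← hbracket, grMk_eq_iff]
  exact mlieBracket_sub_mem_pred hreg hX' hX hY' hY ((S.grMk_eq_iff _ _).1 hXX')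
    ((S.grMk_eq_iff _ _).1 hYY')

theorem leviBracket_add_smul_left {x : M} {i j : ℕ} (a a' : S.GrPiece x i) (b : S.GrPiece x j)
    (c : ℝ) : S.leviBracket x (a + c • a') b = S.leviBracket x a b + c • S.leviBracket x a' b := by
  obtain ⟨X, hX, rfl⟩ := exists_isSection_grMk_eq hreg a
  obtain ⟨X', hX', rfl⟩ := exists_isSection_grMk_eq hreg a'
  obtain ⟨Y, hY, rfl⟩ := exists_isSection_grMk_eq hreg b
  rw [← grMk_add_smul, leviBracket_mk hreg hX hY, leviBracket_mk hreg hX' hY, ← grMk_add_smul,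
    leviBracket_mk hreg (hX.add_smul hX' c) hY]
  congr 1
  exact mlieBracket_add_smul_left hX.smooth hX'.smooth c x

theorem leviBracket_add_smul_right {x : M} {i j : ℕ} (a : S.GrPiece x i) (b b' : S.GrPiece x j)
    (c : ℝ) : S.leviBracket x a (b + c • b') = S.leviBracket x a b + c • S.leviBracket x a b' := by
  obtain ⟨X, hX, rfl⟩ := exists_isSection_grMk_eq hreg a
  obtain ⟨Y, hY, rfl⟩ := exists_isSection_grMk_eq hreg b
  obtain ⟨Y', hY', rfl⟩ := exists_isSection_grMk_eq hreg b'
  rw [← grMk_add_smul, leviBracket_mk hreg hX hY, leviBracket_mk hreg hX hY', ← grMk_add_smul,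
    leviBracket_mk hreg hX (hY.add_smul hY' c)]
  congr 1
  exact mlieBracket_add_smul_right hY.smooth hY'.smooth c x

theorem leviBracket_zero_left {x : M} {i j : ℕ} (b : S.GrPiece x j) :
    S.leviBracket x (0 : S.GrPiece x i) b = 0 := by
  simpa using leviBracket_add_smul_left hreg (0 : S.GrPiece x i) 0 b (1 : ℝ)

theorem leviBracket_zero_right {x : M} {i j : ℕ} (a : S.GrPiece x i) :
    S.leviBracket x a (0 : S.GrPiece x j) = 0 := by
  simpa using leviBracket_add_smul_right hreg a (0 : S.GrPiece x j) 0 (1 : ℝ)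

/-- The Levi bracket as a bilinear map. -/
def leviBracketₗ (x : M) (i j : ℕ) :
    S.GrPiece x i →ₗ[ℝ] S.GrPiece x j →ₗ[ℝ] S.GrPiece x (i + j) :=
  LinearMap.mk₂ ℝ (S.leviBracket x)
    (fun a a' b => by simpa using leviBracket_add_smul_left hreg a a' b 1)
    (fun c a b => by
      simpa [leviBracket_zero_left hreg] using leviBracket_add_smul_left hreg 0 a b c)
    (fun a b b' => by simpa using leviBracket_add_smul_right hreg a b b' 1)
    (fun c a b => by
      simpa [leviBracket_zero_right hreg] using leviBracket_add_smul_right hreg a 0 b c)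

/-- The bracket of `gr_x` as a bilinear map. -/
def grBracketₗ (x : M) :
    S.Gr x →ₗ[ℝ] S.Gr x →ₗ[ℝ] S.Gr x :=
  DirectSum.toModule ℝ ℕ _ fun i => LinearMap.flip <| DirectSum.toModule ℝ ℕ _ fun j =>
    ((leviBracketₗ hreg x i j).compr₂ (DirectSum.lof ℝ ℕ (S.GrPiece x) (i + j))).flip

theorem grBracketₗ_of_of (x : M) {i j : ℕ} (a : S.GrPiece x i) (b : S.GrPiece x j) :
    grBracketₗ hreg x (DirectSum.of _ i a) (DirectSum.of _ j b) =
      DirectSum.of (S.GrPiece x) (i + j) (S.leviBracket x a b) := by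
  rw [← DirectSum.lof_eq_of ℝ, ← DirectSum.lof_eq_of ℝ, grBracketₗ, DirectSum.toModule_lof,
    LinearMap.flip_apply, DirectSum.toModule_lof]
  rfl

theorem grBracket_eq (x : M) (a b : S.Gr x) : S.grBracket x a b = grBracketₗ hreg x a b := by
  classical
  rw [grBracket]
  conv_rhs => rw [← DirectSum.sum_support_of a, ← DirectSum.sum_support_of b]
  simp only [map_sum, LinearMap.sum_apply, grBracketₗ_of_of]
  rw [Finset.sum_comm]

theorem grBracket_mk_mk {i j : ℕ} {X Y : VField n M} (hX : IsSection (flag S.E i) X)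
    (hY : IsSection (flag S.E j) Y) (x : M) :
    S.grBracket x (DirectSum.of _ i (S.grMk x i (X x) (hX.mem x)))
      (DirectSum.of _ j (S.grMk x j (Y x) (hY.mem x))) =
      DirectSum.of (S.GrPiece x) (i + j) (S.grMk x (i + j) (VectorField.mlieBracket (𝓡 n) X Y x)
        ((hX.mlieBracket hreg hY).mem x)) := by
  rw [grBracket_eq hreg, grBracketₗ_of_of, leviBracket_mk hreg hX hY]

theorem grBracket_add_left (x : M) (a a' b : S.Gr x) :
    S.grBracket x (a + a') b = S.grBracket x a b + S.grBracket x a' b := by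
  simp only [grBracket_eq hreg, map_add]
  rfl

theorem grBracket_add_right (x : M) (a b b' : S.Gr x) :
    S.grBracket x a (b + b') = S.grBracket x a b + S.grBracket x a b' := by
  simp only [grBracket_eq hreg, map_add]

theorem grBracket_smul_right (x : M) (c : ℝ) (a b : S.Gr x) :
    S.grBracket x a (c • b) = c • S.grBracket x a b := by
  simp only [grBracket_eq hreg, map_smul]

theorem grBracket_zero_left (x : M) (b : S.Gr x) : S.grBracket x 0 b = 0 := by
  simp only [grBracket_eq hreg, map_zero]
  rfl

theorem grBracket_zero_right (x : M) (a : S.Gr x) : S.grBracket x a 0 = 0 := by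
  simp only [grBracket_eq hreg, map_zero]

theorem gr_induction {x : M} {p : S.Gr x → Prop} (a : S.Gr x)
    (mk : ∀ (i : ℕ) (X : VField n M) (hX : IsSection (flag S.E i) X),
      p (DirectSum.of _ i (S.grMk x i (X x) (hX.mem x))))
    (zero : p 0) (add : ∀ a b, p a → p b → p (a + b)) : p a := by
  induction a using DirectSum.induction_on with
  | zero => exact zero
  | of i a =>
    obtain ⟨X, hX, rfl⟩ := exists_isSection_grMk_eq hreg a
    exact mk i X hX
  | add a b ha hb => exact add a b ha hb

theorem grBracket_swap (x : M) (a b : S.Gr x) : S.grBracket x a b = -S.grBracket x b a := by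
  induction a using gr_induction hreg with
  | zero => rw [grBracket_zero_left hreg, grBracket_zero_right hreg, neg_zero]
  | add a a' ha ha' =>
    rw [grBracket_add_left hreg, grBracket_add_right hreg, ha, ha']
    exact (neg_add _ _).symm
  | mk i X hX =>
    induction b using gr_induction hreg with
    | zero => rw [grBracket_zero_left hreg, grBracket_zero_right hreg, neg_zero]
    | add b b' hb hb' =>
      rw [grBracket_add_left hreg, grBracket_add_right hreg, hb, hb']
      exact (neg_add _ _).symm
    | mk j Y hY =>
      rw [grBracket_mk_mk hreg hX hY, grBracket_mk_mk hreg hY hX, ← map_neg]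
      exact S.of_grMk_congr (add_comm i j) VectorField.mlieBracket_swap_apply _
        (Submodule.neg_mem _ ((hY.mlieBracket hreg hX).mem x))

theorem grBracket_jacobi_mk {i j k : ℕ} {X Y Z : VField n M} (hX : IsSection (flag S.E i) X)
    (hY : IsSection (flag S.E j) Y) (hZ : IsSection (flag S.E k) Z) (x : M) :
    let a := DirectSum.of _ i (S.grMk x i (X x) (hX.mem x))
    let b := DirectSum.of _ j (S.grMk x j (Y x) (hY.mem x))
    let c := DirectSum.of _ k (S.grMk x k (Z x) (hZ.mem x))
    S.grBracket x a (S.grBracket x b c) =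
      S.grBracket x (S.grBracket x a b) c + S.grBracket x b (S.grBracket x a c) := by
  have hXY := hX.mlieBracket hreg hY
  have hYZ := hY.mlieBracket hreg hZ
  have hXZ := hX.mlieBracket hreg hZ
  have hXY_Z : VectorField.mlieBracket (𝓡 n) (VectorField.mlieBracket (𝓡 n) X Y) Z x ∈
      flag S.E (i + (j + k)) x := add_assoc i j k ▸ (hXY.mlieBracket hreg hZ).mem x
  have hY_XZ : VectorField.mlieBracket (𝓡 n) Y (VectorField.mlieBracket (𝓡 n) X Z) x ∈
      flag S.E (i + (j + k)) x := add_left_comm j i k ▸ (hY.mlieBracket hreg hXZ).mem x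
  dsimp only
  rw [grBracket_mk_mk hreg hX hY, grBracket_mk_mk hreg hY hZ, grBracket_mk_mk hreg hX hZ,
    grBracket_mk_mk hreg hX hYZ, grBracket_mk_mk hreg hXY hZ, grBracket_mk_mk hreg hY hXZ,
    S.of_grMk_congr (add_assoc i j k) rfl _ hXY_Z,
    S.of_grMk_congr (add_left_comm j i k) rfl _ hY_XZ, ← map_add]
  exact S.of_grMk_congr rfl (congrFun (mlieBracket_jacobi hX.smooth hY.smooth hZ.smooth) x) _
    (Submodule.add_mem _ hXY_Z hY_XZ)

theorem grBracket_jacobi (x : M) (a b c : S.Gr x) :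
    S.grBracket x a (S.grBracket x b c) =
      S.grBracket x (S.grBracket x a b) c + S.grBracket x b (S.grBracket x a c) := by
  induction a using gr_induction hreg with
  | zero => simp only [grBracket_zero_left hreg, grBracket_zero_right hreg, add_zero]
  | add a a' ha ha' =>
    simp only [grBracket_add_left hreg, grBracket_add_right hreg, ha, ha']
    exact add_add_add_comm _ _ _ _
  | mk i X hX =>
    induction b using gr_induction hreg with
    | zero => simp only [grBracket_zero_left hreg, grBracket_zero_right hreg, add_zero]
    | add b b' hb hb' =>
      simp only [grBracket_add_left hreg, grBracket_add_right hreg, hb, hb']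
      exact add_add_add_comm _ _ _ _
    | mk j Y hY =>
      induction c using gr_induction hreg with
      | zero => simp only [grBracket_zero_right hreg, add_zero]
      | add c c' hc hc' =>
        simp only [grBracket_add_right hreg, hc, hc']
        exact add_add_add_comm _ _ _ _
      | mk k Z hZ => exact grBracket_jacobi_mk hreg hX hY hZ x

theorem of_grMk_mem_span (x : M) {k j : ℕ} (hk : 1 ≤ k) {Z : VField n M}
    (hZ : IsIteratedBracket S.E j Z) (hj : j ≤ k + 1) (hZx : Z x ∈ flag S.E (k + 1) x) :
    DirectSum.of (S.GrPiece x) (k + 1) (S.grMk x (k + 1) (Z x) hZx) ∈ Submodule.span ℝ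
      {c | ∃ (u : S.GrPiece x 1) (v : S.GrPiece x k),
        S.grBracket x (DirectSum.of _ 1 u) (DirectSum.of _ k v) = c} := by
  obtain hjk | rfl := Nat.le_or_eq_of_le_succ hj
  · have hzero : S.grMk x (k + 1) (Z x) hZx = 0 :=
      (S.grMk_eq_zero_iff hZx).2 ((hZ.isSection_flag hjk).mem x)
    rw [hzero, map_zero]
    exact Submodule.zero_mem _
  · cases hZ with
    | one hX => exact absurd hk (by lia)
    | succ hX hZ =>
      have hX_flag : IsSection (flag S.E 1) _ :=
        ⟨hX.smooth, fun y => (S.isSubbundle.flag_one y).symm ▸ hX.mem y⟩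
      have hbracket := grBracket_mk_mk hreg hX_flag (hZ.isSection_flag le_rfl) x
      exact Submodule.subset_span
        ⟨_, _, hbracket.trans (S.of_grMk_congr (add_comm 1 k) rfl _ hZx)⟩

theorem of_succ_mem_span (x : M) {k : ℕ} (hk : 1 ≤ k) (a : S.GrPiece x (k + 1)) :
    DirectSum.of (S.GrPiece x) (k + 1) a ∈ Submodule.span ℝ
      {c | ∃ (u : S.GrPiece x 1) (v : S.GrPiece x k),
        S.grBracket x (DirectSum.of _ 1 u) (DirectSum.of _ k v) = c} := by
  obtain ⟨⟨v, hv⟩, rfl⟩ := Submodule.Quotient.mk_surjective _ a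
  let class_of : flag S.E (k + 1) x →ₗ[ℝ] S.Gr x :=
    DirectSum.lof ℝ ℕ (S.GrPiece x) (k + 1) ∘ₗ Submodule.mkQ _
  change class_of ⟨v, hv⟩ ∈ _
  have hv' := hv
  rw [flag] at hv'
  induction hv' using Submodule.span_induction with
  | zero => exact (map_zero class_of).symm ▸ Submodule.zero_mem _
  | add u w hu hw ihu ihw =>
    exact (map_add class_of ⟨u, hu⟩ ⟨w, hw⟩).symm ▸ Submodule.add_mem _ (ihu hu) (ihw hw)
  | smul c u hu ih =>
    exact (map_smul class_of c ⟨u, hu⟩).symm ▸ Submodule.smul_mem _ _ (ih hu)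
  | mem u hu =>
    obtain ⟨j, hj, Z, hZ, rfl⟩ := hu
    exact of_grMk_mem_span hreg x hk hZ hj hv

end Structure

section AdaptedBasis

variable {K V : Type*} [DivisionRing K] [AddCommGroup V] [Module K V] {f : ℕ → Submodule K V}

theorem exists_monotone_linearIndepOn_span_eq (hf : Monotone f) (hbot : f 0 = ⊥) :
    ∃ B : ℕ → Set V, Monotone B ∧
      ∀ k, LinearIndepOn K id (B k) ∧ Submodule.span K (B k) = f k := by
  have hextend (k : ℕ) (B : {B : Set V // LinearIndepOn K id B ∧ Submodule.span K B = f k}) :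
      ∃ B' : {B : Set V // LinearIndepOn K id B ∧ Submodule.span K B = f (k + 1)},
        B.1 ⊆ B'.1 := by
    obtain ⟨B, hli, hspan⟩ := B
    have hsub : B ⊆ f (k + 1) := fun v hv =>
      hf (Nat.le_succ k) (hspan ▸ Submodule.subset_span hv)
    exact ⟨⟨hli.extend hsub, hli.linearIndepOn_extend hsub,
      le_antisymm (Submodule.span_le.2 (hli.extend_subset hsub)) (hli.subset_span_extend hsub)⟩,
      hli.subset_extend hsub⟩
  choose next hnext using hextend
  let B (k : ℕ) : {B : Set V // LinearIndepOn K id B ∧ Submodule.span K B = f k} :=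
    Nat.rec ⟨∅, linearIndepOn_empty K id, by simp [hbot]⟩ next k
  exact ⟨fun k => (B k).1, monotone_nat_of_le_succ fun k => hnext k (B k), fun k => (B k).2⟩

theorem exists_adapted_basis [FiniteDimensional K V] (hf : Monotone f) (hbot : f 0 = ⊥) {s : ℕ}
    (htop : f s = ⊤) {n : ℕ} (hn : Module.finrank K V = n) :
    ∃ (deg : Fin n → ℕ) (b : Fin n → V), LinearIndependent K b ∧ (∀ a, deg a ≤ s) ∧
      ∀ k, Submodule.span K (b '' {a | deg a ≤ k}) = f k := by
  classical
  obtain ⟨B, hB, hspan⟩ := exists_monotone_linearIndepOn_span_eq hf hbot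
  let basis : Module.Basis (B s) K V := Module.Basis.mk (v := ((↑) : B s → V)) (hspan s).1
    (by rw [Subtype.range_coe, (hspan s).2, htop])
  have : Finite (B s) := Module.Finite.finite_basis basis
  have : Fintype (B s) := Fintype.ofFinite _
  have hcard : Fintype.card (B s) = n := by rw [← hn, Module.finrank_eq_card_basis basis]
  let enum : Fin n ≃ B s := (Fintype.equivFinOfCardEq hcard).symm
  have hex (a : Fin n) : ∃ k, (enum a : V) ∈ B k := ⟨s, (enum a).2⟩
  have hdeg (a : Fin n) (k : ℕ) : Nat.find (hex a) ≤ k ↔ (enum a : V) ∈ B k :=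
    ⟨fun h => hB h (Nat.find_spec (hex a)), fun h => Nat.find_le h⟩
  refine ⟨fun a => Nat.find (hex a), fun a => enum a,
    LinearIndependent.comp (v := ((↑) : B s → V)) (hspan s).1 enum enum.injective,
    fun a => (hdeg a s).2 (enum a).2, fun k => ?_⟩
  have himage : (fun a => (enum a : V)) '' {a | Nat.find (hex a) ≤ k} = B s ∩ B k := by
    simp only [hdeg]
    ext v
    refine ⟨?_, fun hv => ⟨enum.symm ⟨v, hv.1⟩, by simpa using hv.2, by simp⟩⟩
    rintro ⟨a, ha, rfl⟩
    exact ⟨(enum a).2, ha⟩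
  rw [himage]
  rcases le_total s k with h | h
  · rw [inter_eq_left.2 (hB h), (hspan s).2]
    exact le_antisymm (hf h) (htop ▸ le_top)
  · rw [inter_eq_right.2 (hB h), (hspan k).2]

end AdaptedBasis

section Frame

variable {n : ℕ} {M : Type*} [TopologicalSpace M] [ChartedSpace (EuclideanSpace ℝ (Fin n)) M]

theorem finrank_tangentSpace (x : M) : Module.finrank ℝ (TangentSpace (𝓡 n) x) = n :=
  finrank_euclideanSpace_fin (𝕜 := ℝ) (n := n)

theorem span_range_eq_top_of_linearIndependent {x : M} {v : Fin n → TangentSpace (𝓡 n) x}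
    (hv : LinearIndependent ℝ v) : Submodule.span ℝ (range v) = ⊤ :=
  hv.span_eq_top_of_card_eq_finrank' (by rw [Fintype.card_fin, finrank_tangentSpace])

variable [IsManifold (𝓡 n) ∞ M]

/-- `Z` is a frame of `TM` on the open set `U` adapted to the filtration by the `E^{-k}`: the
fields of degree at most `k` span `E^{-k}`. -/
structure IsAdaptedFrame (S : Structure n M) (deg : Fin n → ℕ) (Z : Fin n → VField n M)
    (U : Set M) : Prop where
  isOpen : IsOpen U
  isSection : ∀ a, IsSection (flag S.E (deg a)) (Z a)
  linearIndependent : ∀ x ∈ U, LinearIndependent ℝ fun a => Z a x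
  span_eq : ∀ x ∈ U, ∀ k,
    Submodule.span ℝ ((fun a => Z a x) '' {a | deg a ≤ k}) = flag S.E k x

theorem exists_flag_eq_top {D : Distribution n M} (hgen : IsBracketGenerating D) (x : M) :
    ∃ s, flag D s x = ⊤ := by
  let f : ℕ →o Submodule ℝ (TangentSpace (𝓡 n) x) :=
    ⟨fun k => flag D k x, fun _ _ h => flag_mono D h x⟩
  refine ⟨monotonicSequenceLimitIndex f, ?_⟩
  rw [← hgen x]
  exact (WellFoundedGT.iSup_eq_monotonicSequenceLimit f).symm

theorem span_image_eq_flag_of_le {D : Distribution n M} {x : M} {Z : Fin n → VField n M}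
    (hli : LinearIndependent ℝ fun a => Z a x) {deg : Fin n → ℕ} {s : ℕ} (hdeg : ∀ a, deg a ≤ s)
    (hspan : ∀ k ≤ s, Submodule.span ℝ ((fun a => Z a x) '' {a | deg a ≤ k}) = flag D k x)
    (k : ℕ) : Submodule.span ℝ ((fun a => Z a x) '' {a | deg a ≤ k}) = flag D k x := by
  rcases le_total k s with h | h
  · exact hspan k h
  · have hspan_top (m : ℕ) (hm : s ≤ m) :
        Submodule.span ℝ ((fun a => Z a x) '' {a | deg a ≤ m}) = ⊤ := by
      rw [eq_univ_of_forall (s := {a | deg a ≤ m}) fun a => (hdeg a).trans hm, image_univ,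
        span_range_eq_top_of_linearIndependent hli]
    rw [hspan_top k h, eq_comm, eq_top_iff, ← hspan_top s le_rfl, hspan s le_rfl]
    exact flag_mono D h x

theorem exists_isAdaptedFrame [T2Space M] (S : Structure n M) (hgen : IsBracketGenerating S.E)
    (hreg : IsEquiregular S.E) (x₀ : M) :
    ∃ (deg : Fin n → ℕ) (Z : Fin n → VField n M) (U : Set M),
      x₀ ∈ U ∧ IsAdaptedFrame S deg Z U := by
  obtain ⟨s, hs⟩ := exists_flag_eq_top hgen x₀
  obtain ⟨deg, b, hb, hdeg, hspan⟩ := exists_adapted_basis (f := fun k => flag S.E k x₀)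
    (fun _ _ h => flag_mono S.E h x₀) (flag_zero S.E x₀) hs (finrank_tangentSpace x₀)
  have hmem (a : Fin n) : b a ∈ flag S.E (deg a) x₀ :=
    hspan (deg a) ▸ Submodule.subset_span ⟨a, le_refl (deg a), rfl⟩
  choose Z hZ hZx using fun a => (hreg (deg a)).exists_isSection (hmem a)
  have hli : LinearIndependent ℝ fun a => Z a x₀ := by simpa only [hZx] using hb
  have hspan_nhds (k : ℕ) : ∀ᶠ x in 𝓝 x₀,
      Submodule.span ℝ ((fun a => Z a x) '' {a | deg a ≤ k}) = flag S.E k x := by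
    simp only [image_eq_range]
    refine (hreg k).eventually_span_eq (Z := fun a : {a | deg a ≤ k} => Z a)
      (fun a => (hZ a).mono a.2) (hli.comp _ Subtype.val_injective) ?_
    rw [← hspan k, image_eq_range]
    simp only [hZx]
  have hframe : ∀ᶠ x in 𝓝 x₀, LinearIndependent ℝ (fun a => Z a x) ∧
      ∀ k ≤ s, Submodule.span ℝ ((fun a => Z a x) '' {a | deg a ≤ k}) = flag S.E k x :=
    (eventually_linearIndependent (fun a => (hZ a).smooth) hli).and
      ((finite_Iic s).eventually_all.2 fun k _ => hspan_nhds k)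
  obtain ⟨U, hU, hU_open, hxU⟩ := eventually_nhds_iff.1 hframe
  exact ⟨deg, Z, U, hxU, hU_open, hZ, fun x hx => (hU x hx).1,
    fun x hx => span_image_eq_flag_of_le (hU x hx).1 hdeg (hU x hx).2⟩

end Frame

namespace Structure

variable {n : ℕ} {M : Type*} [TopologicalSpace M] [ChartedSpace (EuclideanSpace ℝ (Fin n)) M]
  [IsManifold (𝓡 n) ∞ M] {S : Structure n M}

theorem of_smul {x : M} (k : ℕ) (c : ℝ) (a : S.GrPiece x k) :
    DirectSum.of (S.GrPiece x) k (c • a) = c • DirectSum.of (S.GrPiece x) k a :=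
  (DirectSum.lof ℝ ℕ (S.GrPiece x) k).map_smul c a

/-- The section `A` of `gr` is smooth near `x₀`, in the sense of `IsSmoothGr`. -/
def SmoothGrAt (A : ∀ x, S.Gr x) (x₀ : M) : Prop :=
  ∀ k : ℕ, ∃ (X : VField n M) (hX : IsSection (flag S.E k) X),
    ∀ᶠ x in 𝓝 x₀, A x k = S.grMk x k (X x) (hX.mem x)

theorem isSmoothGr_iff {A : ∀ x, S.Gr x} : S.IsSmoothGr A ↔ ∀ x₀, SmoothGrAt A x₀ :=
  forall_comm

theorem SmoothGrAt.congr {A B : ∀ x, S.Gr x} {x₀ : M} (hA : SmoothGrAt A x₀)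
    (hBA : ∀ᶠ x in 𝓝 x₀, B x = A x) : SmoothGrAt B x₀ := fun k => by
  obtain ⟨X, hX, hAX⟩ := hA k
  refine ⟨X, hX, ?_⟩
  filter_upwards [hAX, hBA] with x hAXx hBAx
  rw [hBAx, hAXx]

end Structure

namespace IsAdaptedFrame

variable {n : ℕ} {M : Type*} [TopologicalSpace M] [ChartedSpace (EuclideanSpace ℝ (Fin n)) M]
  [IsManifold (𝓡 n) ∞ M] {S : Structure n M} {deg : Fin n → ℕ} {Z : Fin n → VField n M}
  {U : Set M} (hF : IsAdaptedFrame S deg Z U)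

include hF

/-- The basis of the tangent space given by an adapted frame. -/
def basisAt {x : M} (hx : x ∈ U) : Module.Basis (Fin n) ℝ (TangentSpace (𝓡 n) x) :=
  Module.Basis.mk (hF.linearIndependent x hx)
    (span_range_eq_top_of_linearIndependent (hF.linearIndependent x hx)).ge

theorem basisAt_apply {x : M} (hx : x ∈ U) (a : Fin n) : hF.basisAt hx a = Z a x := by
  simp [basisAt]

open Classical in
/-- The coefficients of a tangent vector in an adapted frame; zero outside of `U`. -/
def coeff (x : M) (a : Fin n) : TangentSpace (𝓡 n) x →ₗ[ℝ] ℝ :=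
  if hx : x ∈ U then (hF.basisAt hx).coord a else 0

theorem coeff_frame {x : M} (hx : x ∈ U) (a b : Fin n) :
    hF.coeff x a (Z b x) = if a = b then 1 else 0 := by
  rw [coeff, dif_pos hx, ← hF.basisAt_apply hx, Module.Basis.coord_apply,
    Module.Basis.repr_self, Finsupp.single_apply]
  simp only [eq_comm]

theorem coeff_eq_zero (x : M) {a : Fin n} {k : ℕ} (hk : k < deg a)
    {v : TangentSpace (𝓡 n) x} (hv : v ∈ flag S.E k x) : hF.coeff x a v = 0 := by
  by_cases hx : x ∈ U
  · suffices Submodule.span ℝ ((fun b => Z b x) '' {b | deg b ≤ k}) ≤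
        LinearMap.ker (hF.coeff x a) from this (hF.span_eq x hx k ▸ hv)
    rw [Submodule.span_le, image_subset_iff]
    intro b hb
    have hab : a ≠ b := by
      rintro rfl
      exact hk.not_ge hb
    simp [hF.coeff_frame hx, hab]
  · simp [coeff, hx]

theorem deg_pos {x : M} (hx : x ∈ U) (a : Fin n) : 0 < deg a := by
  rw [Nat.pos_iff_ne_zero]
  intro hdeg
  have hmem := (hF.isSection a).mem x
  rw [hdeg, flag_zero, Submodule.mem_bot] at hmem
  exact (hF.linearIndependent x hx).ne_zero a hmem

/-- The section of `gr` given by the class of a frame field. -/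
def grFrame (a : Fin n) (x : M) : S.Gr x :=
  DirectSum.of (S.GrPiece x) (deg a) (S.grMk x (deg a) (Z a x) ((hF.isSection a).mem x))

/-- The element of `gr_x` with given coefficients in the frame of `gr`. -/
def toGr (x : M) : (Fin n → ℝ) →ₗ[ℝ] S.Gr x :=
  Fintype.linearCombination ℝ fun a => hF.grFrame a x

theorem toGr_apply (x : M) (v : Fin n → ℝ) : hF.toGr x v = ∑ a, v a • hF.grFrame a x := rfl

theorem toGr_single (x : M) (a : Fin n) : hF.toGr x (Pi.single a 1) = hF.grFrame a x := by
  simp [toGr]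

/-- The coefficient of a homogeneous element in the frame of `gr`. -/
def coeffPiece (x : M) (a : Fin n) : S.GrPiece x (deg a) →ₗ[ℝ] ℝ :=
  Submodule.liftQ _ ((hF.coeff x a).domRestrict (flag S.E (deg a) x)) (by
    rintro ⟨v, hv⟩ (hv' : v ∈ flag S.E (deg a - 1) x)
    rw [LinearMap.mem_ker, LinearMap.domRestrict_apply]
    by_cases hx : x ∈ U
    · exact hF.coeff_eq_zero x (Nat.sub_lt (hF.deg_pos hx a) one_pos) hv'
    · simp [coeff, hx])

theorem coeffPiece_mk (x : M) (a : Fin n) {v : TangentSpace (𝓡 n) x}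
    (hv : v ∈ flag S.E (deg a) x) :
    hF.coeffPiece x a (S.grMk x (deg a) v hv) = hF.coeff x a v := rfl

/-- The coefficients of an element of `gr_x` in the frame of `gr`. -/
def ofGr (x : M) : S.Gr x →ₗ[ℝ] (Fin n → ℝ) :=
  LinearMap.pi fun a => hF.coeffPiece x a ∘ₗ DirectSum.component ℝ ℕ (S.GrPiece x) (deg a)

theorem ofGr_apply (x : M) (A : S.Gr x) (a : Fin n) :
    hF.ofGr x A a = hF.coeffPiece x a (A (deg a)) := rfl

theorem ofGr_of (x : M) {k : ℕ} {v : TangentSpace (𝓡 n) x} (hv : v ∈ flag S.E k x) (a : Fin n) :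
    hF.ofGr x (DirectSum.of _ k (S.grMk x k v hv)) a =
      if deg a = k then hF.coeff x a v else 0 := by
  rw [ofGr_apply]
  split_ifs with h
  · subst h
    rw [DirectSum.of_eq_same, coeffPiece_mk]
  · rw [DirectSum.of_eq_of_ne _ _ _ h, map_zero]

theorem ofGr_toGr {x : M} (hx : x ∈ U) (v : Fin n → ℝ) : hF.ofGr x (hF.toGr x v) = v := by
  suffices hF.ofGr x ∘ₗ hF.toGr x = LinearMap.id from LinearMap.congr_fun this v
  refine LinearMap.pi_ext' fun a => LinearMap.ext_ring (funext fun b => ?_)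
  simp only [LinearMap.comp_apply, LinearMap.single_apply, toGr_single, LinearMap.id_apply]
  rw [grFrame, hF.ofGr_of, hF.coeff_frame hx, Pi.single_apply]
  grind

theorem mem_range_toGr {x : M} (hx : x ∈ U) {k : ℕ} {v : TangentSpace (𝓡 n) x}
    (hv : v ∈ flag S.E k x) :
    DirectSum.of (S.GrPiece x) k (S.grMk x k v hv) ∈ LinearMap.range (hF.toGr x) := by
  have hmem := hv
  rw [← hF.span_eq x hx k] at hmem
  induction hmem using Submodule.span_induction with
  | zero =>
    rw [show S.grMk x k 0 hv = 0 from rfl, map_zero]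
    exact Submodule.zero_mem _
  | add u w hu hw ihu ihw =>
    rw [hF.span_eq x hx k] at hu hw
    rw [show S.grMk x k (u + w) hv = S.grMk x k u hu + S.grMk x k w hw from rfl, map_add]
    exact Submodule.add_mem _ (ihu hu) (ihw hw)
  | smul c u hu ih =>
    rw [hF.span_eq x hx k] at hu
    rw [show S.grMk x k (c • u) hv = c • S.grMk x k u hu from rfl, Structure.of_smul]
    exact Submodule.smul_mem _ _ (ih hu)
  | mem u hu =>
    obtain ⟨a, ha, rfl⟩ := hu
    rcases (show deg a ≤ k from ha).lt_or_eq with h | h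
    · rw [(S.grMk_eq_zero_iff hv).2 (((hF.isSection a).mono (by lia : deg a ≤ k - 1)).mem x),
        map_zero]
      exact Submodule.zero_mem _
    · exact ⟨Pi.single a 1, (hF.toGr_single x a).trans (S.of_grMk_congr h rfl _ _)⟩

theorem toGr_ofGr {x : M} (hx : x ∈ U) (A : S.Gr x) :
    hF.toGr x (hF.ofGr x A) = A := by
  have hrange : A ∈ LinearMap.range (hF.toGr x) := by
    induction A using DirectSum.induction_on with
    | zero => exact Submodule.zero_mem _
    | add A B hA hB => exact Submodule.add_mem _ hA hB
    | of k a =>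
      obtain ⟨⟨v, hv⟩, rfl⟩ := Submodule.Quotient.mk_surjective _ a
      exact hF.mem_range_toGr hx hv
  obtain ⟨v, rfl⟩ := hrange
  rw [hF.ofGr_toGr hx]

/-- The linear equivalence with `gr_x` given by the frame of `gr`. -/
def equivGr {x : M} (hx : x ∈ U) : (Fin n → ℝ) ≃ₗ[ℝ] S.Gr x :=
  LinearEquiv.ofLinearMap (hF.toGr x) (hF.ofGr x) (LinearMap.ext (hF.toGr_ofGr hx))
    (LinearMap.ext (hF.ofGr_toGr hx))

theorem toGr_apply_degree (x : M) (v : Fin n → ℝ) (k : ℕ) :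
    hF.toGr x v k = ∑ a, if h : deg a = k then
      v a • S.grMk x k (Z a x) (h ▸ (hF.isSection a).mem x) else 0 := by
  rw [toGr_apply, DFinsupp.finsetSum_apply]
  refine Finset.sum_congr rfl fun a _ => ?_
  change v a • (hF.grFrame a x k) = _
  split_ifs with h
  · subst h
    rw [grFrame, DirectSum.of_eq_same]
  · rw [grFrame, DirectSum.of_eq_of_ne _ _ _ (Ne.symm h), smul_zero]

theorem toGr_apply_eq_grMk_sum {x : M} {k : ℕ} (v : Fin n → ℝ)
    (hv : ∑ a with deg a = k, v a • Z a x ∈ flag S.E k x) :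
    hF.toGr x v k = S.grMk x k (∑ a with deg a = k, v a • Z a x) hv := by
  have hsum : (⟨∑ a with deg a = k, v a • Z a x, hv⟩ : flag S.E k x) =
      ∑ a, if h : deg a = k then
        v a • (⟨Z a x, h ▸ (hF.isSection a).mem x⟩ : flag S.E k x) else 0 := by
    ext1
    rw [Submodule.coe_sum]
    change ∑ a with deg a = k, v a • Z a x = _
    rw [Finset.sum_filter]
    refine Finset.sum_congr rfl fun a _ => ?_
    split_ifs <;> rfl
  rw [toGr_apply_degree, Structure.grMk, hsum, ← Submodule.mkQ_apply, map_sum]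
  refine Finset.sum_congr rfl fun a _ => ?_
  split_ifs
  · rw [map_smul]; rfl
  · rw [map_zero]

variable [T2Space M]

theorem contMDiffAt_coeff {X : VField n M} (hX : IsSmooth X) {x₀ : M} (hx₀ : x₀ ∈ U)
    (a : Fin n) : ContMDiffAt (𝓡 n) 𝓘(ℝ, ℝ) ∞ (fun x => hF.coeff x a (X x)) x₀ := by
  have hspan : ∀ᶠ x in 𝓝 x₀, X x ∈ Submodule.span ℝ (range fun b => Z b x) := by
    filter_upwards [hF.isOpen.mem_nhds hx₀] with x hx
    rw [span_range_eq_top_of_linearIndependent (hF.linearIndependent x hx)]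
    exact Submodule.mem_top
  obtain ⟨f, hf, heq⟩ := exists_contMDiff_coeff (fun b => (hF.isSection b).smooth)
    (hF.linearIndependent x₀ hx₀) hX hspan
  refine (hf a x₀).congr_of_eventuallyEq ?_
  filter_upwards [heq, hF.isOpen.mem_nhds hx₀] with x hXx hx
  rw [hXx, map_sum]
  simp [hF.coeff_frame hx]

theorem contMDiffAt_ofGr {A : ∀ x, S.Gr x} {x₀ : M} (hx₀ : x₀ ∈ U)
    (hA : Structure.SmoothGrAt A x₀) :
    ContMDiffAt (𝓡 n) 𝓘(ℝ, Fin n → ℝ) ∞ (fun x => hF.ofGr x (A x)) x₀ := by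
  refine contMDiffAt_pi_space.2 fun a => ?_
  obtain ⟨X, hX, hAX⟩ := hA (deg a)
  refine (hF.contMDiffAt_coeff hX.smooth hx₀ a).congr_of_eventuallyEq ?_
  filter_upwards [hAX] with x hx
  rw [ofGr_apply, hx, coeffPiece_mk]

theorem smoothGrAt_toGr {v : M → Fin n → ℝ} {x₀ : M}
    (hv : ∀ᶠ x in 𝓝 x₀, ContMDiffAt (𝓡 n) 𝓘(ℝ, Fin n → ℝ) ∞ v x) :
    Structure.SmoothGrAt (fun x => hF.toGr x (v x)) x₀ := by
  obtain ⟨g, hg, hgv⟩ := exists_contMDiff_eventuallyEq hv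
  intro k
  have hsec : IsSection (flag S.E k) (fun x => ∑ a with deg a = k, g x a • Z a x) :=
    IsSection.sum _ fun a ha => by
      obtain rfl := (Finset.mem_filter.1 ha).2
      exact (hF.isSection a).smul (contMDiff_pi_space.1 hg a)
  refine ⟨_, hsec, ?_⟩
  filter_upwards [hgv] with x hx
  rw [← hx, hF.toGr_apply_eq_grMk_sum _ (hsec.mem x)]

end IsAdaptedFrame

namespace Structure

variable {n : ℕ} {M : Type*} [TopologicalSpace M] [ChartedSpace (EuclideanSpace ℝ (Fin n)) M]
  [IsManifold (𝓡 n) ∞ M] {S : Structure n M}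

theorem smoothGrAt_of_isSection {k : ℕ} {X : VField n M} (hX : IsSection (flag S.E k) X) (x₀ : M) :
    SmoothGrAt (fun x => DirectSum.of (S.GrPiece x) k (S.grMk x k (X x) (hX.mem x))) x₀ := by
  intro m
  by_cases h : m = k
  · subst h
    exact ⟨X, hX, Eventually.of_forall fun x => DirectSum.of_eq_same _ _⟩
  · refine ⟨fun _ => 0, ⟨IsSmooth.zero, fun x => Submodule.zero_mem _⟩,
      Eventually.of_forall fun x => ?_⟩
    rw [DirectSum.of_eq_of_ne _ _ _ h]
    rfl

theorem eq_of_of_forall_ne {x : M} {A : S.Gr x} {k : ℕ} (hA : ∀ m, m ≠ k → A m = 0) :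
    A = DirectSum.of (S.GrPiece x) k (A k) := by
  refine DFinsupp.ext fun m => ?_
  by_cases hm : m = k
  · subst hm
    exact (DirectSum.of_eq_same _ _).symm
  · rw [hA m hm]
    exact (DirectSum.of_eq_of_ne _ _ _ hm).symm

variable [T2Space M]

/-- The inner product of `gr_{x,-1}` as a bilinear map. -/
def grInnerₗ (S : Structure n M) (x : M) : S.GrPiece x 1 →ₗ[ℝ] S.GrPiece x 1 →ₗ[ℝ] ℝ :=
  (S.g x).compl₁₂ (S.horizontalEquiv x).symm.toLinearMap (S.horizontalEquiv x).symm.toLinearMap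

theorem grInnerₗ_apply (x : M) (a b : S.GrPiece x 1) :
    grInnerₗ S x a b = S.grInner x a b := rfl

theorem grInner_pos (x : M) {a : S.GrPiece x 1} (ha : a ≠ 0) : 0 < S.grInner x a a :=
  S.g_pos x _ (by simpa using ha)

theorem grInner_symm (x : M) (a b : S.GrPiece x 1) : S.grInner x a b = S.grInner x b a :=
  S.g_symm x _ _

theorem isSection_of_flag_one {X : VField n M} (hX : IsSection (flag S.E 1) X) :
    IsSection S.E X :=
  ⟨hX.smooth, fun x => S.isSubbundle.flag_one x ▸ hX.mem x⟩

theorem horizontalEquiv_symm_mk {x : M} {v : TangentSpace (𝓡 n) x} (hv : v ∈ flag S.E 1 x) :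
    (S.horizontalEquiv x).symm (S.grMk x 1 v hv) = ⟨v, S.isSubbundle.flag_one x ▸ hv⟩ := by
  rw [LinearEquiv.symm_apply_eq]
  rfl

theorem contMDiffAt_grInner {A B : ∀ x, S.Gr x} {x₀ : M} (hA : SmoothGrAt A x₀)
    (hB : SmoothGrAt B x₀) :
    ContMDiffAt (𝓡 n) 𝓘(ℝ, ℝ) ∞ (fun x => S.grInner x (A x 1) (B x 1)) x₀ := by
  obtain ⟨X, hX, hAX⟩ := hA 1
  obtain ⟨Y, hY, hBY⟩ := hB 1
  refine (S.g_smooth X Y (isSection_of_flag_one hX)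
    (isSection_of_flag_one hY) x₀).congr_of_eventuallyEq ?_
  filter_upwards [hAX, hBY] with x hAXx hBYx
  rw [hAXx, hBYx, grInner, horizontalEquiv_symm_mk, horizontalEquiv_symm_mk]

/-- A graded isometry between the fibers of `gr` at two points. -/
structure GrIso (S : Structure n M) (x y : M) where
  toEquiv : S.Gr x ≃ₗ[ℝ] S.Gr y
  map_bracket : ∀ a b, toEquiv (S.grBracket x a b) = S.grBracket y (toEquiv a) (toEquiv b)
  map_of : ∀ k a, ∃ b, toEquiv (DirectSum.of _ k a) = DirectSum.of (S.GrPiece y) k b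
  map_inner : ∀ a b, S.grInner y (toEquiv a 1) (toEquiv b 1) = S.grInner x (a 1) (b 1)

/-- The composition of graded isometries. -/
def GrIso.trans {x y z : M} (φ : GrIso S x y) (ψ : GrIso S y z) : GrIso S x z where
  toEquiv := φ.toEquiv.trans ψ.toEquiv
  map_bracket a b := by simp [φ.map_bracket, ψ.map_bracket]
  map_of k a := by
    obtain ⟨b, hb⟩ := φ.map_of k a
    obtain ⟨c, hc⟩ := ψ.map_of k b
    exact ⟨c, by simp [hb, hc]⟩
  map_inner a b := by simp [φ.map_inner, ψ.map_inner]

end Structure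

/-- The operator multiplying the `a`-th coordinate by `deg a`: in an adapted frame, the operator
acting as multiplication by `k` on `gr_{-k}`. -/
def degreeOp {ι : Type*} [Fintype ι] (deg : ι → ℕ) : (ι → ℝ) →L[ℝ] (ι → ℝ) :=
  ContinuousLinearMap.pi fun a => (deg a : ℝ) • ContinuousLinearMap.proj a

theorem degreeOp_apply {ι : Type*} [Fintype ι] (deg : ι → ℕ) (v : ι → ℝ) (a : ι) :
    degreeOp deg v a = deg a * v a := rfl

namespace IsAdaptedFrame

variable {n : ℕ} {M : Type*} [TopologicalSpace M] [ChartedSpace (EuclideanSpace ℝ (Fin n)) M]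
  [IsManifold (𝓡 n) ∞ M] {S : Structure n M} {deg : Fin n → ℕ}
  {Z : Fin n → VField n M} {U : Set M} (hF : IsAdaptedFrame S deg Z U)

include hF

theorem smoothGrAt_grFrame (a : Fin n) (x₀ : M) : Structure.SmoothGrAt (hF.grFrame a) x₀ :=
  Structure.smoothGrAt_of_isSection (hF.isSection a) x₀

theorem toGr_degreeOp (x : M) (v : Fin n → ℝ) (k : ℕ) :
    hF.toGr x (degreeOp deg v) k = (k : ℝ) • hF.toGr x v k := by
  rw [toGr_apply_degree, toGr_apply_degree, Finset.smul_sum]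
  refine Finset.sum_congr rfl fun a _ => ?_
  split_ifs with h
  · rw [degreeOp_apply, smul_smul, show (deg a : ℝ) = k from congrArg _ h]
  · rw [smul_zero]

theorem degreeOp_ofGr_of (x : M) {k : ℕ} (a : S.GrPiece x k) :
    degreeOp deg (hF.ofGr x (DirectSum.of _ k a)) =
      (k : ℝ) • hF.ofGr x (DirectSum.of _ k a) := by
  ext b
  rw [degreeOp_apply, Pi.smul_apply, smul_eq_mul, ofGr_apply]
  by_cases h : deg b = k
  · rw [show (deg b : ℝ) = k from congrArg _ h]
  · rw [DirectSum.of_eq_of_ne _ _ _ h, map_zero, mul_zero, mul_zero]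

theorem toGr_eq_of (x : M) {v : Fin n → ℝ} {k : ℕ} (hv : degreeOp deg v = (k : ℝ) • v) :
    hF.toGr x v = DirectSum.of (S.GrPiece x) k (hF.toGr x v k) := by
  refine Structure.eq_of_of_forall_ne fun m hm => ?_
  have hsmul : (k : ℝ) • hF.toGr x v m = (m : ℝ) • hF.toGr x v m := by
    rw [← hF.toGr_degreeOp x v m, hv, map_smul]
    rfl
  rw [← sub_eq_zero, ← sub_smul] at hsmul
  exact (smul_eq_zero.1 hsmul).resolve_left (sub_ne_zero.2 (Nat.cast_injective.ne hm.symm))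

theorem ofGr_of_one_mem_degreeOne (x : M) (u : S.GrPiece x 1) :
    hF.ofGr x (DirectSum.of _ 1 u) ∈ degreeOne (degreeOp deg) :=
  mem_degreeOne.2 (by simpa only [Nat.cast_one, one_smul] using hF.degreeOp_ofGr_of x u)

theorem toGr_eq_of_one (x : M) {v : Fin n → ℝ} (hv : v ∈ degreeOne (degreeOp deg)) :
    hF.toGr x v = DirectSum.of (S.GrPiece x) 1 (hF.toGr x v 1) :=
  hF.toGr_eq_of x (by simpa only [Nat.cast_one, one_smul] using mem_degreeOne.1 hv)

variable [T2Space M]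

/-- The symbol `gr_x` in an adapted frame: the coefficients of its bracket and of its inner
product. -/
def tensor (x : M) : SymbolTensor (Fin n → ℝ) :=
  linearCombinationCLM fun a => linearCombinationCLM fun b =>
    (hF.ofGr x (S.grBracket x (hF.grFrame a x) (hF.grFrame b x)),
      S.grInner x (hF.grFrame a x 1) (hF.grFrame b x 1))

theorem grInner_toGr (x : M) (v w : Fin n → ℝ) :
    S.grInner x (hF.toGr x v 1) (hF.toGr x w 1) =
      ∑ a, v a * ∑ b, w b * S.grInner x (hF.grFrame a x 1) (hF.grFrame b x 1) := by
  have htoGr (v : Fin n → ℝ) : hF.toGr x v 1 = ∑ a, v a • (hF.grFrame a x 1) := by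
    rw [toGr_apply, DFinsupp.finsetSum_apply]
    rfl
  simp only [← Structure.grInnerₗ_apply, htoGr, map_sum, map_smul, LinearMap.sum_apply,
    LinearMap.smul_apply, smul_eq_mul, Finset.mul_sum]
  rw [Finset.sum_comm]
  exact Finset.sum_congr rfl fun a _ => Finset.sum_congr rfl fun b _ => mul_left_comm _ _ _

variable (hreg : IsEquiregular S.E)

include hreg

theorem grBracket_toGr (x : M) (v w : Fin n → ℝ) :
    S.grBracket x (hF.toGr x v) (hF.toGr x w) =
      ∑ a, v a • ∑ b, w b • S.grBracket x (hF.grFrame a x) (hF.grFrame b x) := by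
  simp only [Structure.grBracket_eq hreg, toGr_apply, map_sum, map_smul, LinearMap.sum_apply,
    LinearMap.smul_apply, Finset.smul_sum]
  rw [Finset.sum_comm]
  exact Finset.sum_congr rfl fun a _ => Finset.sum_congr rfl fun b _ => smul_comm _ _ _

theorem tensor_apply (x : M) (v w : Fin n → ℝ) :
    hF.tensor x v w = (hF.ofGr x (S.grBracket x (hF.toGr x v) (hF.toGr x w)),
      S.grInner x (hF.toGr x v 1) (hF.toGr x w 1)) := by
  rw [tensor, linearCombinationCLM_apply, hF.grBracket_toGr hreg, hF.grInner_toGr]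
  simp only [sum_apply, smul_apply, linearCombinationCLM_apply, map_sum, map_smul]
  ext
  · simp [Prod.fst_sum]
  · simp [Prod.snd_sum]

theorem tensor_ofGr {x : M} (hx : x ∈ U) (A B : S.Gr x) :
    hF.tensor x (hF.ofGr x A) (hF.ofGr x B) =
      (hF.ofGr x (S.grBracket x A B), S.grInner x (A 1) (B 1)) := by
  rw [hF.tensor_apply hreg, hF.toGr_ofGr hx, hF.toGr_ofGr hx]

theorem smoothGrAt_grBracket_frame (a b : Fin n) (x₀ : M) : Structure.SmoothGrAt
    (fun x => S.grBracket x (hF.grFrame a x) (hF.grFrame b x)) x₀ :=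
  (Structure.smoothGrAt_of_isSection
    ((hF.isSection a).mlieBracket hreg (hF.isSection b)) x₀).congr
    (Eventually.of_forall fun x =>
      Structure.grBracket_mk_mk hreg (hF.isSection a) (hF.isSection b) x)

theorem contMDiffAt_tensor {x : M} (hx : x ∈ U) :
    ContMDiffAt (𝓡 n) 𝓘(ℝ, SymbolTensor (Fin n → ℝ)) ∞ hF.tensor x :=
  contMDiffAt_linearCombinationCLM fun a => contMDiffAt_linearCombinationCLM fun b =>
    (hF.contMDiffAt_ofGr hx (hF.smoothGrAt_grBracket_frame hreg a b x)).prodMk_space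
      (Structure.contMDiffAt_grInner (hF.smoothGrAt_grFrame a x) (hF.smoothGrAt_grFrame b x))

theorem isPositive_tensor {x : M} (hx : x ∈ U) : IsPositive (degreeOp deg) (hF.tensor x) := by
  intro v hv hv_ne
  rw [hF.tensor_apply hreg]
  refine Structure.grInner_pos x fun hzero => hv_ne ?_
  rw [← hF.ofGr_toGr hx v, hF.toGr_eq_of_one x hv, hzero, map_zero, map_zero]

theorem ofGr_of_mem {x : M} (hx : x ∈ U) {V : Submodule ℝ (Fin n → ℝ)}
    (hdeg : degreeOne (degreeOp deg) ≤ V)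
    (hV : ∀ v ∈ degreeOne (degreeOp deg), ∀ w ∈ V, (hF.tensor x v w).1 ∈ V)
    (k : ℕ) (a : S.GrPiece x k) : hF.ofGr x (DirectSum.of _ k a) ∈ V := by
  induction k with
  | zero =>
    obtain ⟨⟨v, hv⟩, rfl⟩ := Submodule.Quotient.mk_surjective _ a
    have hzero : S.grMk x 0 v hv = 0 := (S.grMk_eq_zero_iff hv).2 hv
    change hF.ofGr x (DirectSum.of _ 0 (S.grMk x 0 v hv)) ∈ V
    rw [hzero, map_zero, map_zero]
    exact V.zero_mem
  | succ k ih =>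
    rcases Nat.eq_zero_or_pos k with rfl | hk
    · exact hdeg (hF.ofGr_of_one_mem_degreeOne x a)
    · suffices Submodule.span ℝ {c | ∃ (u : S.GrPiece x 1) (v : S.GrPiece x k),
          S.grBracket x (DirectSum.of _ 1 u) (DirectSum.of _ k v) = c} ≤ V.comap (hF.ofGr x) from
        this (Structure.of_succ_mem_span hreg x hk a)
      rw [Submodule.span_le]
      rintro _ ⟨u, v, rfl⟩
      have hmem := hV _ (hF.ofGr_of_one_mem_degreeOne x u) _ (ih v)
      rw [hF.tensor_ofGr hreg hx] at hmem
      exact hmem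

theorem isGeneratedInDegreeOne_tensor {x : M} (hx : x ∈ U) :
    IsGeneratedInDegreeOne (degreeOp deg) (hF.tensor x) := by
  intro V hdeg hV
  rw [eq_top_iff]
  rintro v -
  rw [← hF.ofGr_toGr hx v]
  induction hF.toGr x v using DirectSum.induction_on with
  | zero => exact (map_zero (hF.ofGr x)).symm ▸ V.zero_mem
  | of k a => exact hF.ofGr_of_mem hreg hx hdeg hV k a
  | add A B hA hB => exact (map_add (hF.ofGr x) A B).symm ▸ V.add_mem hA hB

theorem exists_isIntertwiner_of_grIso {x y : M} (hx : x ∈ U) (hy : y ∈ U)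
    (φ : Structure.GrIso S x y) :
    ∃ h, IsIntertwiner (degreeOp deg) h (hF.tensor x) (hF.tensor y) := by
  let h : (Fin n → ℝ) →L[ℝ] (Fin n → ℝ) :=
    LinearMap.toContinuousLinearMap (hF.ofGr y ∘ₗ φ.toEquiv.toLinearMap ∘ₗ hF.toGr x)
  have h_ofGr (A : S.Gr x) : h (hF.ofGr x A) = hF.ofGr y (φ.toEquiv A) :=
    congrArg (fun B => hF.ofGr y (φ.toEquiv B)) (hF.toGr_ofGr hx A)
  refine ⟨h, ContinuousLinearMap.ext fun v => ?_, fun v w => ?_⟩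
  · change h (degreeOp deg v) = degreeOp deg (h v)
    rw [← hF.ofGr_toGr hx v]
    induction hF.toGr x v using DirectSum.induction_on with
    | zero => simp only [map_zero]
    | add A B hA hB => simp only [map_add, hA, hB]
    | of k a =>
      obtain ⟨b, hb⟩ := φ.map_of k a
      rw [hF.degreeOp_ofGr_of, map_smul, h_ofGr, hb, hF.degreeOp_ofGr_of]
  · rw [← hF.ofGr_toGr hx v, ← hF.ofGr_toGr hx w, h_ofGr, h_ofGr, hF.tensor_ofGr hreg hy,
      hF.tensor_ofGr hreg hx, h_ofGr, φ.map_bracket, φ.map_inner]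

theorem nonempty_grIso_of_isIntertwiner {x y : M} (hx : x ∈ U) (hy : y ∈ U)
    {h k : (Fin n → ℝ) →L[ℝ] (Fin n → ℝ)}
    (hh : IsIntertwiner (degreeOp deg) h (hF.tensor x) (hF.tensor y)) (hkh : k * h = 1)
    (hhk : h * k = 1) : Nonempty (Structure.GrIso S x y) := by
  let hEquiv : (Fin n → ℝ) ≃ₗ[ℝ] (Fin n → ℝ) :=
    LinearEquiv.ofLinearMap (h : _ →ₗ[ℝ] _) (k : _ →ₗ[ℝ] _)
      (LinearMap.ext fun v => DFunLike.congr_fun hhk v)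
      (LinearMap.ext fun v => DFunLike.congr_fun hkh v)
  let ψ : S.Gr x ≃ₗ[ℝ] S.Gr y := (hF.equivGr hx).symm.trans (hEquiv.trans (hF.equivGr hy))
  have hψ (A : S.Gr x) : ψ A = hF.toGr y (h (hF.ofGr x A)) := rfl
  have hmap (A B : S.Gr x) :
      (hF.ofGr y (S.grBracket y (ψ A) (ψ B)), S.grInner y (ψ A 1) (ψ B 1)) =
        (h (hF.ofGr x (S.grBracket x A B)), S.grInner x (A 1) (B 1)) := by
    have hmap := hh.map (hF.ofGr x A) (hF.ofGr x B)
    rw [hF.tensor_ofGr hreg hx, hF.tensor_apply hreg] at hmap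
    exact hmap
  have hbracket (A B : S.Gr x) : hF.ofGr y (S.grBracket y (ψ A) (ψ B)) =
      h (hF.ofGr x (S.grBracket x A B)) := congrArg Prod.fst (hmap A B)
  refine ⟨⟨ψ, fun A B => ?_, fun k a => ?_, fun A B => congrArg Prod.snd (hmap A B)⟩⟩
  · rw [hψ, ← hbracket, hF.toGr_ofGr hy]
  · refine ⟨_, hF.toGr_eq_of (v := h (hF.ofGr x (DirectSum.of _ k a))) y ?_⟩
    have hcomm := DFunLike.congr_fun hh.commute.eq (hF.ofGr x (DirectSum.of _ k a))
    rw [mul_apply_eq_comp, mul_apply_eq_comp, hF.degreeOp_ofGr_of, map_smul] at hcomm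
    exact hcomm.symm

end IsAdaptedFrame

section Calculus

variable {n : ℕ} {M : Type*} [TopologicalSpace M] [ChartedSpace (EuclideanSpace ℝ (Fin n)) M]
  {E F : Type*} [NormedAddCommGroup E] [NormedSpace ℝ E] [NormedAddCommGroup F] [NormedSpace ℝ F]

theorem mvfderiv_congr {f g : M → E} {x : M} (h : f =ᶠ[𝓝 x] g) :
    mvfderiv (𝓡 n) f x = mvfderiv (𝓡 n) g x := by
  ext v
  exact DFunLike.congr_fun h.mfderiv_eq v

theorem mvfderiv_clm_comp (L : E →L[ℝ] F) {f : M → E} {x : M}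
    (hf : MDifferentiableAt (𝓡 n) 𝓘(ℝ, E) f x) (v : TangentSpace (𝓡 n) x) :
    mvfderiv (𝓡 n) (fun z => L (f z)) x v = L (mvfderiv (𝓡 n) f x v) := by
  have hchain := mfderiv_comp_apply x (L.differentiableAt.mdifferentiableAt (x := f x)) hf v
  rw [mfderiv_eq_fderiv, L.fderiv] at hchain
  exact hchain

variable [IsManifold (𝓡 n) ∞ M] {x₀ x : M}

/-- The tangent vector at `x` with given coordinates in the chart at `x₀`. -/
def coordVec (x₀ x : M) : EuclideanSpace ℝ (Fin n) →L[ℝ] TangentSpace (𝓡 n) x :=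
  (tangentTriv n x₀).symmL ℝ x

theorem hasFDerivAt_comp_chart_symm {f : M → E} (hx : x ∈ (tangentTriv n x₀).baseSet)
    (hf : MDifferentiableAt (𝓡 n) 𝓘(ℝ, E) f x) :
    HasFDerivAt (f ∘ (extChartAt (𝓡 n) x₀).symm)
      ((mvfderiv (𝓡 n) f x).comp (coordVec x₀ x)) (extChartAt (𝓡 n) x₀ x) := by
  have : IsManifold (𝓡 n) 1 M := IsManifold.of_le (n := ∞) ENat.LEInfty.out
  have hsource : x ∈ (extChartAt (𝓡 n) x₀).source := by rwa [extChartAt_source]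
  have hwithin := (mdifferentiableWithinAt_extChartAt_symm (I := 𝓡 n)
    ((extChartAt (𝓡 n) x₀).map_source hsource)).hasMFDerivWithinAt
  rw [← TangentBundle.symmL_trivializationAt hx] at hwithin
  have hsymm : HasMFDerivAt 𝓘(ℝ, EuclideanSpace ℝ (Fin n)) (𝓡 n) (extChartAt (𝓡 n) x₀).symm
      (extChartAt (𝓡 n) x₀ x) (coordVec x₀ x) := by
    exact hasMFDerivWithinAt_univ.1 (ModelWithCorners.range_eq_univ (𝓡 n) ▸ hwithin)
  have hf' : HasMFDerivAt (𝓡 n) 𝓘(ℝ, E) f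
      ((extChartAt (𝓡 n) x₀).symm (extChartAt (𝓡 n) x₀ x)) (mvfderiv (𝓡 n) f x) := by
    rw [(extChartAt (𝓡 n) x₀).left_inv hsource]
    exact hf.hasMFDerivAt
  exact hasMFDerivAt_iff_hasFDerivAt.1 (HasMFDerivAt.comp _ hf' hsymm)

theorem coordVec_localRep (hx : x ∈ (tangentTriv n x₀).baseSet) (X : VField n M) :
    coordVec x₀ x (localRep x₀ X x) = X x :=
  (congrArg _ (Bundle.Trivialization.continuousLinearMapAt_apply_of_mem ℝ _ hx (X x)).symm).trans
    (Bundle.Trivialization.symmL_continuousLinearMapAt _ hx (X x))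

theorem localRep_coordVec (hx : x ∈ (tangentTriv n x₀).baseSet)
    (w : EuclideanSpace ℝ (Fin n)) : localRep x₀ (fun x => coordVec x₀ x w) x = w :=
  (Bundle.Trivialization.continuousLinearMapAt_apply_of_mem ℝ _ hx _).symm.trans
    (Bundle.Trivialization.continuousLinearMapAt_symmL _ hx w)

theorem contMDiffOn_coordVec (x₀ : M) (w : EuclideanSpace ℝ (Fin n)) :
    ContMDiffOn (𝓡 n) (𝓡 n).tangent ∞
      (fun x => (⟨x, coordVec x₀ x w⟩ : TangentBundle (𝓡 n) M)) (tangentTriv n x₀).baseSet := by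
  intro x hx
  refine ((contMDiffAt_localRep_iff hx fun x => coordVec x₀ x w).1 ?_).contMDiffWithinAt
  refine (contMDiffAt_const (c := w)).congr_of_eventuallyEq ?_
  filter_upwards [(tangentTriv n x₀).open_baseSet.mem_nhds hx] with y hy
  exact localRep_coordVec hy w

theorem exists_coordinate_fields [T2Space M] (x₀ : M) : ∃ X : Fin n → VField n M,
    (∀ j, IsSmooth (X j)) ∧ ∀ᶠ x in 𝓝 x₀, ∀ w : EuclideanSpace ℝ (Fin n),
      coordVec x₀ x w = ∑ j, w j • X j x := by
  obtain ⟨ρ, -, hρ⟩ := (SmoothBumpFunction.nhds_basis_tsupport (I := 𝓡 n) x₀).mem_iff.1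
    (eventually_mem_baseSet_tangentTriv n x₀)
  refine ⟨fun j x => ρ x • coordVec x₀ x (EuclideanSpace.single j 1), fun j => ?_, ?_⟩
  · exact ContMDiffOn.smul_section_of_tsupport ρ.contMDiff.contMDiffOn
      (tangentTriv n x₀).open_baseSet hρ (contMDiffOn_coordVec x₀ _)
  · filter_upwards [ρ.eventuallyEq_one] with x hx w
    have hw : w = ∑ j, w j • EuclideanSpace.single j (1 : ℝ) := by
      ext i
      simp [Finset.sum_apply, Pi.single_apply]
    conv_lhs => rw [hw]
    simp only [map_sum, map_smul, hx, Pi.one_apply, one_smul]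

theorem contMDiffAt_mvfderiv_apply {f : M → E} {X : VField n M}
    (hf : ContMDiffAt (𝓡 n) 𝓘(ℝ, E) ∞ f x₀) (hX : IsSmooth X) :
    ContMDiffAt (𝓡 n) 𝓘(ℝ, E) ∞ (fun x => mvfderiv (𝓡 n) f x (X x)) x₀ := by
  have hbase := eventually_mem_baseSet_tangentTriv n x₀
  have hlocalRep := (contMDiffAt_localRep_iff hbase.self_of_nhds X).2 (hX x₀)
  have hsymm : ContMDiffAt 𝓘(ℝ, EuclideanSpace ℝ (Fin n)) (𝓡 n) ∞ (extChartAt (𝓡 n) x₀).symm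
      (extChartAt (𝓡 n) x₀ x₀) :=
    (contMDiffOn_extChartAt_symm x₀).contMDiffAt (extChartAt_target_mem_nhds x₀)
  have hf_chart : ContDiffAt ℝ ∞ (f ∘ (extChartAt (𝓡 n) x₀).symm) (extChartAt (𝓡 n) x₀ x₀) := by
    refine (ContMDiffAt.comp _ ?_ hsymm).contDiffAt
    rwa [extChartAt_to_inv]
  have hfderiv : ContMDiffAt (𝓡 n) 𝓘(ℝ, EuclideanSpace ℝ (Fin n) →L[ℝ] E) ∞
      (fun x => fderiv ℝ (f ∘ (extChartAt (𝓡 n) x₀).symm) (extChartAt (𝓡 n) x₀ x)) x₀ :=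
    (hf_chart.fderiv_right (m := ∞) (by simp)).contMDiffAt.comp x₀ contMDiffAt_extChartAt
  have hf_mdiff : ∀ᶠ x in 𝓝 x₀, MDifferentiableAt (𝓡 n) 𝓘(ℝ, E) f x := by
    filter_upwards [(contMDiffAt_iff_contMDiffAt_nhds (by simp)).1
      (hf.of_le (m := 1) ENat.LEInfty.out)] with x hx
    exact ContMDiffAt.mdifferentiableAt hx (by simp)
  refine (hfderiv.clm_apply hlocalRep).congr_of_eventuallyEq ?_
  filter_upwards [hf_mdiff, hbase] with x hfx hx
  rw [(hasFDerivAt_comp_chart_symm hx hfx).fderiv, ContinuousLinearMap.comp_apply,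
    coordVec_localRep hx]

end Calculus

namespace Structure

variable {n : ℕ} {M : Type*} [TopologicalSpace M] [ChartedSpace (EuclideanSpace ℝ (Fin n)) M]
  [IsManifold (𝓡 n) ∞ M] {S : Structure n M} {A B : ∀ x, S.Gr x} {x₀ : M}

theorem SmoothGrAt.zero (x₀ : M) : SmoothGrAt (S := S) (fun _ => 0) x₀ := fun _ =>
  ⟨fun _ => 0, ⟨IsSmooth.zero, fun _ => Submodule.zero_mem _⟩, Eventually.of_forall fun _ => rfl⟩

theorem SmoothGrAt.add (hA : SmoothGrAt A x₀) (hB : SmoothGrAt B x₀) :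
    SmoothGrAt (fun x => A x + B x) x₀ := fun k => by
  obtain ⟨X, hX, hAX⟩ := hA k
  obtain ⟨Y, hY, hBY⟩ := hB k
  refine ⟨_, hX.add hY, ?_⟩
  filter_upwards [hAX, hBY] with x hAx hBx
  rw [DirectSum.add_apply, hAx, hBx]
  rfl

theorem SmoothGrAt.smul {f : M → ℝ} (hA : SmoothGrAt A x₀) (hf : ContMDiff (𝓡 n) 𝓘(ℝ, ℝ) ∞ f) :
    SmoothGrAt (fun x => f x • A x) x₀ := fun k => by
  obtain ⟨X, hX, hAX⟩ := hA k
  refine ⟨_, hX.smul hf, ?_⟩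
  filter_upwards [hAX] with x hAx
  rw [DirectSum.smul_apply, hAx]
  rfl

theorem SmoothGrAt.sum {ι : Type*} (s : Finset ι) {A : ι → ∀ x, S.Gr x}
    (hA : ∀ i ∈ s, SmoothGrAt (A i) x₀) : SmoothGrAt (fun x => ∑ i ∈ s, A i x) x₀ := by
  classical
  induction s using Finset.induction_on with
  | empty => simpa only [Finset.sum_empty] using SmoothGrAt.zero x₀
  | insert i s hi ih =>
    simp only [Finset.sum_insert hi]
    exact (hA i (Finset.mem_insert_self i s)).add
      (ih fun j hj => hA j (Finset.mem_insert_of_mem hj))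

namespace GrConnection

variable (D : S.GrConnection) {Y : VField n M}

theorem nabla_zero (hY : IsSmooth Y) (x : M) : D.nabla Y (fun _ => 0) x = 0 := by
  simpa using D.leibniz (fun _ => 0) Y (fun _ => 0) contMDiff_const hY
    (isSmoothGr_iff.2 fun x₀ => SmoothGrAt.zero x₀) x

theorem nabla_sum_smul {ι : Type*} (s : Finset ι) {f : ι → M → ℝ} {A : ι → ∀ x, S.Gr x}
    (hY : IsSmooth Y) (hf : ∀ i, ContMDiff (𝓡 n) 𝓘(ℝ, ℝ) ∞ (f i)) (hA : ∀ i, S.IsSmoothGr (A i))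
    (x : M) : D.nabla Y (fun z => ∑ i ∈ s, f i z • A i z) x =
      ∑ i ∈ s, (mvfderiv (𝓡 n) (f i) x (Y x) • A i x + f i x • D.nabla Y (A i) x) := by
  classical
  have hfA (i : ι) : S.IsSmoothGr fun z => f i z • A i z :=
    isSmoothGr_iff.2 fun x₀ => (isSmoothGr_iff.1 (hA i) x₀).smul (hf i)
  induction s using Finset.induction_on with
  | empty => simpa only [Finset.sum_empty] using D.nabla_zero hY x
  | insert i s hi ih =>
    simp only [Finset.sum_insert hi]
    rw [D.add_right Y (fun z => f i z • A i z) (fun z => ∑ j ∈ s, f j z • A j z) hY (hfA i)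
      (isSmoothGr_iff.2 fun x₀ => SmoothGrAt.sum s fun j _ => isSmoothGr_iff.1 (hfA j) x₀), ih,
      D.leibniz (f i) Y (A i) (hf i) hY (hA i)]

theorem nabla_congr [T2Space M] (hY : IsSmooth Y) (hA : S.IsSmoothGr A) (hB : S.IsSmoothGr B)
    {x : M} (h : ∀ᶠ z in 𝓝 x, A z = B z) : D.nabla Y A x = D.nabla Y B x := by
  obtain ⟨ρ, -, hρ⟩ := (SmoothBumpFunction.nhds_basis_tsupport (I := 𝓡 n) x).mem_iff.1 h
  have hcutoff : (fun z => ρ z • A z) = fun z => ρ z • B z := by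
    funext z
    by_cases hz : z ∈ tsupport ρ
    · rw [show A z = B z from hρ hz]
    · rw [image_eq_zero_of_notMem_tsupport hz, zero_smul, zero_smul]
  have hleibniz := D.leibniz ρ Y A ρ.contMDiff hY hA x
  rw [hcutoff, D.leibniz ρ Y B ρ.contMDiff hY hB x, ρ.eq_one, one_smul, one_smul,
    h.self_of_nhds] at hleibniz
  exact DFinsupp.ext fun k => (add_left_cancel (DFunLike.congr_fun hleibniz k)).symm

theorem IsCompatible.mvfderiv_grInner [T2Space M] {D : S.GrConnection} (hD : D.IsCompatible)
    (hY : IsSmooth Y) (hA : S.IsSmoothGr A) (hB : S.IsSmoothGr B) {i j : ℕ}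
    (hAi : IsInDegree i A) (hBj : IsInDegree j B) (x : M) :
    mvfderiv (𝓡 n) (fun z => S.grInner z (A z 1) (B z 1)) x (Y x) =
      S.grInner x (D.nabla Y A x 1) (B x 1) + S.grInner x (A x 1) (D.nabla Y B x 1) := by
  by_cases hi : i = 1
  · by_cases hj : j = 1
    · exact hD.metric Y A B hY hA hB (hi ▸ hAi) (hj ▸ hBj) x
    · have hB_one (z : M) : B z 1 = 0 := hBj z 1 (Ne.symm hj)
      have hnabla : D.nabla Y B x 1 = 0 := hD.parallel j Y B hY hB hBj x 1 (Ne.symm hj)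
      simp only [hB_one, hnabla, ← grInnerₗ_apply, map_zero, add_zero, mvfderiv_const]
      rfl
  · have hA_one (z : M) : A z 1 = 0 := hAi z 1 (Ne.symm hi)
    have hnabla : D.nabla Y A x 1 = 0 := hD.parallel i Y A hY hA hAi x 1 (Ne.symm hi)
    simp only [hA_one, hnabla, ← grInnerₗ_apply, map_zero, add_zero, mvfderiv_const,
      LinearMap.zero_apply]
    rfl

end GrConnection

end Structure

theorem continuousLinearMap_pi_ext {ι E : Type*} [Finite ι] [DecidableEq ι] [AddCommMonoid E]
    [Module ℝ E] [TopologicalSpace E] {f g : (ι → ℝ) →L[ℝ] E}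
    (h : ∀ i, f (Pi.single i 1) = g (Pi.single i 1)) : f = g :=
  ContinuousLinearMap.coe_injective
    (LinearMap.pi_ext' fun i => LinearMap.ext_ring (h i))

namespace IsAdaptedFrame

variable {n : ℕ} {M : Type*} [TopologicalSpace M] [ChartedSpace (EuclideanSpace ℝ (Fin n)) M]
  [IsManifold (𝓡 n) ∞ M] {S : Structure n M} {deg : Fin n → ℕ} {Z : Fin n → VField n M}
  {U : Set M}

theorem eventually_mem (hF : IsAdaptedFrame S deg Z U) {x : M} (hx : x ∈ U) :
    ∀ᶠ z in 𝓝 x, z ∈ U := hF.isOpen.mem_nhds hx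

variable (hF : IsAdaptedFrame S deg Z U)

theorem isSmoothGr_grFrame (a : Fin n) : S.IsSmoothGr (hF.grFrame a) :=
  Structure.isSmoothGr_iff.2 fun x₀ => hF.smoothGrAt_grFrame a x₀

theorem isInDegree_grFrame (a : Fin n) : Structure.IsInDegree (deg a) (hF.grFrame a) :=
  fun _ _ hm => DirectSum.of_eq_of_ne _ _ _ hm

variable (D : S.GrConnection) {Y : VField n M}

/-- The matrix of the connection in the frame, acting on coordinate vectors. -/
def connMat (Y : VField n M) (x : M) : (Fin n → ℝ) →L[ℝ] (Fin n → ℝ) :=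
  linearCombinationCLM fun a => hF.ofGr x (D.nabla Y (hF.grFrame a) x)

theorem connMat_single (x : M) (a : Fin n) :
    hF.connMat D Y x (Pi.single a 1) = hF.ofGr x (D.nabla Y (hF.grFrame a) x) := by
  simp [connMat, linearCombinationCLM_apply, Pi.single_apply]

variable [T2Space M] (hY : IsSmooth Y)

include hY

theorem contMDiffAt_connMat {x : M} (hx : x ∈ U) : ContMDiffAt (𝓡 n)
    𝓘(ℝ, (Fin n → ℝ) →L[ℝ] (Fin n → ℝ)) ∞ (hF.connMat D Y) x :=
  contMDiffAt_linearCombinationCLM fun a => hF.contMDiffAt_ofGr hx (Structure.isSmoothGr_iff.1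
    (D.smooth Y _ hY (hF.isSmoothGr_grFrame a)) x)

theorem ofGr_nabla {A : ∀ x, S.Gr x} (hA : S.IsSmoothGr A) {x : M} (hx : x ∈ U) :
    hF.ofGr x (D.nabla Y A x) = mvfderiv (𝓡 n) (fun z => hF.ofGr z (A z)) x (Y x) +
      hF.connMat D Y x (hF.ofGr x (A x)) := by
  obtain ⟨g, hg, hgA⟩ := exists_contMDiff_eventuallyEq (x₀ := x)
    ((hF.eventually_mem hx).mono fun z hz =>
      hF.contMDiffAt_ofGr hz (Structure.isSmoothGr_iff.1 hA z))
  have hg_apply := contMDiff_pi_space.1 hg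
  have hsum : S.IsSmoothGr fun z => ∑ a, g z a • hF.grFrame a z :=
    Structure.isSmoothGr_iff.2 fun x₀ => Structure.SmoothGrAt.sum _ fun a _ =>
      (hF.smoothGrAt_grFrame a x₀).smul (hg_apply a)
  have hA_eq : ∀ᶠ z in 𝓝 x, A z = ∑ a, g z a • hF.grFrame a z := by
    filter_upwards [hgA, hF.eventually_mem hx] with z hgz hz
    rw [← toGr_apply, hgz, hF.toGr_ofGr hz]
  have hderiv (a : Fin n) :
      mvfderiv (𝓡 n) (fun z => g z a) x (Y x) = mvfderiv (𝓡 n) g x (Y x) a :=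
    mvfderiv_clm_comp (ContinuousLinearMap.proj (R := ℝ) (φ := fun _ : Fin n => ℝ) a)
      ((hg x).mdifferentiableAt (by simp)) (Y x)
  rw [D.nabla_congr hY hA hsum hA_eq,
    D.nabla_sum_smul Finset.univ hY hg_apply hF.isSmoothGr_grFrame, ← mvfderiv_congr hgA,
    Finset.sum_add_distrib, map_add]
  congr 1
  · simp only [hderiv]
    rw [← toGr_apply, hF.ofGr_toGr hx]
  · rw [connMat, linearCombinationCLM_apply, map_sum,
      show hF.ofGr x (A x) = g x from hgA.self_of_nhds.symm]
    simp only [map_smul]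

theorem commute_connMat (hD : D.IsCompatible) (x : M) :
    Commute (hF.connMat D Y x) (degreeOp deg) := by
  refine continuousLinearMap_pi_ext fun a => ?_
  have hnabla : D.nabla Y (hF.grFrame a) x =
      DirectSum.of _ (deg a) (D.nabla Y (hF.grFrame a) x (deg a)) :=
    Structure.eq_of_of_forall_ne (hD.parallel (deg a) Y _ hY (hF.isSmoothGr_grFrame a)
      (hF.isInDegree_grFrame a) x)
  have hsingle : degreeOp deg (Pi.single a (1 : ℝ)) = (deg a : ℝ) • Pi.single a (1 : ℝ) := by
    ext b
    rcases eq_or_ne b a with rfl | hba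
    · simp [degreeOp_apply]
    · simp [degreeOp_apply, hba]
  change hF.connMat D Y x (degreeOp deg (Pi.single a 1)) =
    degreeOp deg (hF.connMat D Y x (Pi.single a 1))
  rw [hsingle, map_smul, hF.connMat_single, hnabla, hF.degreeOp_ofGr_of]

theorem mvfderiv_tensor (hreg : IsEquiregular S.E) (hD : D.IsStronglyCompatible) {x : M}
    (hx : x ∈ U) :
    mvfderiv (𝓡 n) hF.tensor x (Y x) = infAct (hF.tensor x) (hF.connMat D Y x) := by
  refine continuousLinearMap_pi_ext fun a => continuousLinearMap_pi_ext fun b => ?_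
  let evalAB : SymbolTensor (Fin n → ℝ) →L[ℝ] (Fin n → ℝ) × ℝ :=
    (ContinuousLinearMap.apply ℝ _ (Pi.single b 1)).comp
      (ContinuousLinearMap.apply ℝ _ (Pi.single a 1))
  have hevalAB (z : M) : evalAB (hF.tensor z) =
      (hF.ofGr z (S.grBracket z (hF.grFrame a z) (hF.grFrame b z)),
        S.grInner z (hF.grFrame a z 1) (hF.grFrame b z 1)) := by
    change hF.tensor z (Pi.single a 1) (Pi.single b 1) = _
    rw [hF.tensor_apply hreg, hF.toGr_single, hF.toGr_single]
  have hT := (hF.contMDiffAt_tensor hreg hx).mdifferentiableAt (by simp)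
  have hfst := mvfderiv_clm_comp ((ContinuousLinearMap.fst ℝ (Fin n → ℝ) ℝ).comp evalAB) hT (Y x)
  have hsnd := mvfderiv_clm_comp ((ContinuousLinearMap.snd ℝ (Fin n → ℝ) ℝ).comp evalAB) hT (Y x)
  simp only [ContinuousLinearMap.comp_apply, hevalAB, ContinuousLinearMap.coe_fst',
    ContinuousLinearMap.coe_snd'] at hfst hsnd
  have hbracket := hF.ofGr_nabla D hY (Structure.isSmoothGr_iff.2 fun x₀ =>
    hF.smoothGrAt_grBracket_frame hreg a b x₀) hx
  rw [hD.bracket Y _ _ hY (hF.isSmoothGr_grFrame a) (hF.isSmoothGr_grFrame b), map_add, hfst]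
    at hbracket
  have hinner := hD.toIsCompatible.mvfderiv_grInner hY (hF.isSmoothGr_grFrame a)
    (hF.isSmoothGr_grFrame b) (hF.isInDegree_grFrame a) (hF.isInDegree_grFrame b) x
  rw [infAct_apply_apply, hF.tensor_apply hreg x (hF.connMat D Y x _),
    hF.tensor_apply hreg x _ (hF.connMat D Y x _), hF.tensor_apply hreg x (Pi.single a 1),
    hF.connMat_single, hF.connMat_single, hF.toGr_single, hF.toGr_single, hF.toGr_ofGr hx,
    hF.toGr_ofGr hx]
  refine Prod.ext (eq_sub_of_add_eq hbracket.symm) ?_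
  rw [hinner] at hsnd
  exact hsnd.symm.trans (sub_zero _).symm

end IsAdaptedFrame

section Segment

variable {V F : Type*} [NormedAddCommGroup V] [NormedSpace ℝ V] [NormedAddCommGroup F]
  [NormedSpace ℝ F] [CompleteSpace F] {D : F →L[ℝ] F} {T : V → SymbolTensor F}
  {T' : V → V →L[ℝ] SymbolTensor F} {Γ : V → V →L[ℝ] F →L[ℝ] F} {z₀ : V}

theorem exists_isIntertwiner_segment {v : V}
    (hΓ : ∀ t ∈ Icc (0 : ℝ) 1, ContinuousAt Γ (z₀ + t • v))
    (hcomm : ∀ t ∈ Icc (0 : ℝ) 1, Commute (Γ (z₀ + t • v) v) D)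
    (hT : ∀ t ∈ Icc (0 : ℝ) 1, HasFDerivAt T (T' (z₀ + t • v)) (z₀ + t • v))
    (hT' : ∀ t ∈ Icc (0 : ℝ) 1,
      T' (z₀ + t • v) v = infAct (T (z₀ + t • v)) (Γ (z₀ + t • v) v))
    (hle : ∀ t ∈ Icc (0 : ℝ) 1, ‖Γ (z₀ + t • v) v‖ ≤ 1 / 2) :
    ∃ h, IsIntertwiner D h (T z₀) (T (z₀ + v)) := by
  have hpath (t : ℝ) : HasDerivAt (fun t => z₀ + t • v) v t := by
    simpa only [one_smul, id] using ((hasDerivAt_id t).smul_const v).const_add z₀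
  have hcont : ContinuousOn (fun t : ℝ => Γ (z₀ + t • v) v) (Icc 0 1) := fun t ht =>
    (((hΓ t ht).comp (f := fun t : ℝ => z₀ + t • v)
      (hpath t).continuousAt).clm_apply continuousAt_const).continuousWithinAt
  have hderiv : ∀ t ∈ Icc (0 : ℝ) 1, HasDerivWithinAt (fun t => T (z₀ + t • v))
      (infAct (T (z₀ + t • v)) (Γ (z₀ + t • v) v)) (Icc 0 1) t := fun t ht => by
    rw [← hT' t ht]
    exact (HasFDerivAt.comp_hasDerivAt (E := SymbolTensor F) (F := V) t (hT t ht)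
      (hpath t)).hasDerivWithinAt
  obtain ⟨h, h_zero, hh⟩ := exists_transport hcont hle
  have htransport := isIntertwiner_of_transport hcont hcomm hderiv hh h_zero
    (right_mem_Icc.2 zero_le_one)
  rw [zero_smul, add_zero, one_smul] at htransport
  exact ⟨h 1, htransport⟩

theorem eventually_exists_isIntertwiner_of_hasFDerivAt
    (hΓ : ∀ᶠ z in 𝓝 z₀, ContinuousAt Γ z) (hcomm : ∀ᶠ z in 𝓝 z₀, ∀ w, Commute (Γ z w) D)
    (hT : ∀ᶠ z in 𝓝 z₀, HasFDerivAt T (T' z) z)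
    (hT' : ∀ᶠ z in 𝓝 z₀, ∀ w, T' z w = infAct (T z) (Γ z w)) :
    ∀ᶠ z in 𝓝 z₀, ∃ h, IsIntertwiner D h (T z₀) (T z) := by
  let C := ‖Γ z₀‖ + 1
  have hC : 0 < C := by positivity
  have hΓ_le : ∀ᶠ z in 𝓝 z₀, ‖Γ z‖ < C :=
    (ContinuousAt.norm (f := Γ) hΓ.self_of_nhds).eventually (gt_mem_nhds (lt_add_one _))
  obtain ⟨r, hr, hball⟩ := Metric.eventually_nhds_iff_ball.1
    (hΓ.and (hcomm.and (hT.and (hT'.and hΓ_le))))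
  have hδ : 0 < min r (1 / (2 * C)) := by positivity
  filter_upwards [Metric.ball_mem_nhds z₀ hδ] with z hz
  have hz_norm : ‖z - z₀‖ < min r (1 / (2 * C)) := mem_ball_iff_norm.1 hz
  have hsegment (t : ℝ) (ht : t ∈ Icc (0 : ℝ) 1) : z₀ + t • (z - z₀) ∈ ball z₀ r := by
    rw [mem_ball_iff_norm, add_sub_cancel_left, norm_smul, Real.norm_of_nonneg ht.1]
    exact (mul_le_of_le_one_left (norm_nonneg _) ht.2).trans_lt (hz_norm.trans_le (min_le_left _ _))
  rw [← add_sub_cancel z₀ z]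
  refine exists_isIntertwiner_segment (fun t ht => (hball _ (hsegment t ht)).1)
    (fun t ht => (hball _ (hsegment t ht)).2.1 _) (fun t ht => (hball _ (hsegment t ht)).2.2.1)
    (fun t ht => (hball _ (hsegment t ht)).2.2.2.1 _) fun t ht => ?_
  calc ‖Γ (z₀ + t • (z - z₀)) (z - z₀)‖
      ≤ ‖Γ (z₀ + t • (z - z₀))‖ * ‖z - z₀‖ := ContinuousLinearMap.le_opNorm _ _
    _ ≤ C * (1 / (2 * C)) := by
      gcongr
      · exact (hball _ (hsegment t ht)).2.2.2.2.le
      · exact hz_norm.le.trans (min_le_right _ _)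
    _ = 1 / 2 := by field_simp

end Segment

namespace IsAdaptedFrame

variable {n : ℕ} {M : Type*} [TopologicalSpace M] [ChartedSpace (EuclideanSpace ℝ (Fin n)) M]
  [IsManifold (𝓡 n) ∞ M] [T2Space M] {S : Structure n M} {deg : Fin n → ℕ}
  {Z : Fin n → VField n M} {U : Set M}

theorem exists_coordinate_connection_form (hF : IsAdaptedFrame S deg Z U)
    (hreg : IsEquiregular S.E) {D : S.GrConnection} (hD : D.IsStronglyCompatible) {x₀ : M}
    (hx₀ : x₀ ∈ U) :
    ∃ Γ : M → EuclideanSpace ℝ (Fin n) →L[ℝ] (Fin n → ℝ) →L[ℝ] (Fin n → ℝ), ∀ᶠ x in 𝓝 x₀,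
      ContinuousAt Γ x ∧ (∀ w, Commute (Γ x w) (degreeOp deg)) ∧
      ∀ w, mvfderiv (𝓡 n) hF.tensor x (coordVec x₀ x w) = infAct (hF.tensor x) (Γ x w) := by
  obtain ⟨X, hX, hcoord⟩ := exists_coordinate_fields (n := n) x₀
  refine ⟨fun x => (linearCombinationCLM fun j => hF.connMat D (X j) x).comp
    (EuclideanSpace.equiv (Fin n) ℝ : EuclideanSpace ℝ (Fin n) →L[ℝ] Fin n → ℝ), ?_⟩
  filter_upwards [hF.eventually_mem hx₀, hcoord] with x hx hcoordx
  refine ⟨(contMDiffAt_linearCombinationCLM fun j =>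
    hF.contMDiffAt_connMat D (hX j) hx).continuousAt.clm_comp continuousAt_const, fun w => ?_,
    fun w => ?_⟩
  · exact Commute.sum_left _ _ _ fun j _ =>
      (hF.commute_connMat D (hX j) hD.toIsCompatible x).smul_left (w j)
  · rw [ContinuousLinearMap.comp_apply, linearCombinationCLM_apply, hcoordx, map_sum, map_sum]
    refine Finset.sum_congr rfl fun j _ => ?_
    rw [map_smul, map_smul, hF.mvfderiv_tensor D (hX j) hreg hD hx]
    rfl

variable (hF : IsAdaptedFrame S deg Z U)

theorem eventually_exists_isIntertwiner (hreg : IsEquiregular S.E) {D : S.GrConnection}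
    (hD : D.IsStronglyCompatible) {x₀ : M} (hx₀ : x₀ ∈ U) :
    ∀ᶠ y in 𝓝 x₀, ∃ h, IsIntertwiner (degreeOp deg) h (hF.tensor x₀) (hF.tensor y) := by
  obtain ⟨Γ, hΓ⟩ := hF.exists_coordinate_connection_form hreg hD hx₀
  let φ := extChartAt (𝓡 n) x₀
  have hφ_symm : Tendsto φ.symm (𝓝 (φ x₀)) (𝓝 x₀) := by
    simpa only [ContinuousAt, φ, extChartAt_to_inv] using continuousAt_extChartAt_symm (I := 𝓡 n) x₀
  have hΓ_chart := hφ_symm.eventually hΓ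
  have htarget := extChartAt_target_mem_nhds (I := 𝓡 n) x₀
  have hchart : ∀ᶠ z in 𝓝 (φ x₀), ∃ h, IsIntertwiner (degreeOp deg) h
      (hF.tensor (φ.symm (φ x₀))) (hF.tensor (φ.symm z)) := by
    refine eventually_exists_isIntertwiner_of_hasFDerivAt (T := hF.tensor ∘ φ.symm)
      (T' := fun z => (mvfderiv (𝓡 n) hF.tensor (φ.symm z)).comp (coordVec x₀ (φ.symm z)))
      (Γ := Γ ∘ φ.symm) ?_ (hΓ_chart.mono fun z hz => hz.2.1) ?_
      (hΓ_chart.mono fun z hz => hz.2.2)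
    · filter_upwards [hΓ_chart, htarget] with z hz hz_target
      exact hz.1.comp (continuousAt_extChartAt_symm'' hz_target)
    · filter_upwards [hφ_symm.eventually (hF.eventually_mem hx₀), htarget,
        hφ_symm.eventually (eventually_mem_baseSet_tangentTriv n x₀)] with z hzU hz_target hz_base
      have hderiv := hasFDerivAt_comp_chart_symm hz_base
        ((hF.contMDiffAt_tensor hreg hzU).mdifferentiableAt (by simp))
      rwa [φ.right_inv hz_target] at hderiv
  filter_upwards [(continuousAt_extChartAt x₀).eventually hchart,
    extChartAt_source_mem_nhds (I := 𝓡 n) x₀] with y hy hy_source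
  rwa [φ.left_inv hy_source, extChartAt_to_inv] at hy

include hF in
theorem eventually_nonempty_grIso (hreg : IsEquiregular S.E) {D : S.GrConnection}
    (hD : D.IsStronglyCompatible) {x₀ : M} (hx₀ : x₀ ∈ U) :
    ∀ᶠ y in 𝓝 x₀, Nonempty (Structure.GrIso S x₀ y) ∧ Nonempty (Structure.GrIso S y x₀) := by
  filter_upwards [hF.eventually_exists_isIntertwiner hreg hD hx₀, hF.eventually_mem hx₀]
    with y ⟨h, hh⟩ hy
  obtain ⟨k, hkh, hhk, hk⟩ := hh.exists_inverse (hF.isPositive_tensor hreg hx₀)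
    (hF.isGeneratedInDegreeOne_tensor hreg hy)
  exact ⟨hF.nonempty_grIso_of_isIntertwiner hreg hx₀ hy hh hkh hhk,
    hF.nonempty_grIso_of_isIntertwiner hreg hy hx₀ hk hhk hkh⟩

end IsAdaptedFrame

theorem Structure.nonempty_grIso_of_isStronglyCompatible {n : ℕ} {M : Type*} [TopologicalSpace M]
    [ChartedSpace (EuclideanSpace ℝ (Fin n)) M] [IsManifold (𝓡 n) ∞ M] [T2Space M]
    [PreconnectedSpace M] {S : Structure n M} (hgen : IsBracketGenerating S.E)
    (hreg : IsEquiregular S.E) {D : S.GrConnection} (hD : D.IsStronglyCompatible) (x y : M) :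
    Nonempty (GrIso S x y) := by
  refine PreconnectedSpace.induction₂' (fun x y => Nonempty (GrIso S x y)) (fun x => ?_)
    ⟨fun _ _ _ ⟨φ⟩ ⟨ψ⟩ => ⟨φ.trans ψ⟩⟩ x y
  obtain ⟨deg, Z, U, hx, hF⟩ := exists_isAdaptedFrame S hgen hreg x
  exact hF.eventually_nonempty_grIso hreg hD hx

theorem isInternal_range_lof (R : Type*) {ι : Type*} [DecidableEq ι] [Ring R] (N : ι → Type*)
    [∀ i, AddCommGroup (N i)] [∀ i, Module R (N i)] :
    DirectSum.IsInternal fun i => LinearMap.range (DirectSum.lof R ι N i) := by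
  refine DirectSum.isInternal_submodule_of_iSupIndep_of_iSup_eq_top (fun i => ?_)
    DFinsupp.iSup_range_lsingle
  have hle : ⨆ (j) (_ : j ≠ i), LinearMap.range (DirectSum.lof R ι N j) ≤
      LinearMap.ker (DirectSum.component R ι N i) := by
    refine iSup₂_le fun j hj => ?_
    rintro _ ⟨a, rfl⟩
    exact DirectSum.of_eq_of_ne j i a hj.symm
  refine Submodule.disjoint_def.2 ?_
  rintro _ ⟨a, rfl⟩ ha
  have hker : a = 0 := (DirectSum.of_eq_same i a).symm.trans (hle ha)
  rw [hker, map_zero]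

namespace Structure

variable {n : ℕ} {M : Type*} [TopologicalSpace M] [ChartedSpace (EuclideanSpace ℝ (Fin n)) M]
  [IsManifold (𝓡 n) ∞ M] {S : Structure n M}

theorem subsingleton_grPiece {x : M} {k : ℕ} (h : flag S.E k x ≤ flag S.E (k - 1) x) :
    Subsingleton (S.GrPiece x k) :=
  Submodule.Quotient.subsingleton_iff.2 (Submodule.submoduleOf_eq_top.2 h)

instance (x : M) : Subsingleton (S.GrPiece x 0) := subsingleton_grPiece le_rfl

/-- The subspace `gr_{x,-k}` of `gr_x`. -/
def grLayer (S : Structure n M) (x : M) (k : ℕ) : Submodule ℝ (S.Gr x) :=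
  LinearMap.range (DirectSum.lof ℝ ℕ (S.GrPiece x) k)

theorem of_mem_grLayer {x : M} {k : ℕ} (u : S.GrPiece x k) :
    DirectSum.of (S.GrPiece x) k u ∈ grLayer S x k :=
  ⟨u, rfl⟩

theorem grLayer_eq_bot {x : M} {k : ℕ} [Subsingleton (S.GrPiece x k)] : grLayer S x k = ⊥ := by
  rw [grLayer, Subsingleton.elim (DirectSum.lof ℝ ℕ (S.GrPiece x) k) 0, LinearMap.range_zero]

theorem apply_eq_apply_of {x y : M} (χ : S.Gr x ≃ₗ[ℝ] S.Gr y)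
    (hχ : ∀ k a, ∃ b, χ (DirectSum.of _ k a) = DirectSum.of (S.GrPiece y) k b) (A : S.Gr x)
    (k : ℕ) : χ A k = χ (DirectSum.of _ k (A k)) k := by
  induction A using DirectSum.induction_on with
  | zero => simp only [map_zero, DirectSum.zero_apply]
  | add A B hA hB => simp only [map_add, DirectSum.add_apply, hA, hB]
  | of m a =>
    obtain rfl | hm := eq_or_ne k m
    · rw [DirectSum.of_eq_same]
    · obtain ⟨b, hb⟩ := hχ m a
      rw [hb, DirectSum.of_eq_of_ne _ _ _ hm, DirectSum.of_eq_of_ne _ _ _ hm, map_zero, map_zero,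
        DirectSum.zero_apply]

variable [T2Space M]

theorem grBracket_mem_grLayer (hreg : IsEquiregular S.E) {x : M} {i j : ℕ} {a b : S.Gr x}
    (ha : a ∈ grLayer S x i) (hb : b ∈ grLayer S x j) :
    S.grBracket x a b ∈ grLayer S x (i + j) := by
  obtain ⟨u, rfl⟩ := ha
  obtain ⟨v, rfl⟩ := hb
  rw [grBracket_eq hreg, DirectSum.lof_eq_of, DirectSum.lof_eq_of, grBracketₗ_of_of]
  exact of_mem_grLayer _

theorem span_grBracket (hreg : IsEquiregular S.E) (x : M) {k : ℕ} (hk : 1 ≤ k) :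
    Submodule.span ℝ {c | ∃ a ∈ grLayer S x 1, ∃ b ∈ grLayer S x k, S.grBracket x a b = c} =
      grLayer S x (k + 1) := by
  refine le_antisymm (Submodule.span_le.2 ?_) ?_
  · rintro _ ⟨a, ha, b, hb, rfl⟩
    exact add_comm 1 k ▸ grBracket_mem_grLayer hreg ha hb
  · rintro _ ⟨a, rfl⟩
    refine Submodule.span_mono ?_ (of_succ_mem_span hreg x hk a)
    rintro _ ⟨u, v, rfl⟩
    exact ⟨_, of_mem_grLayer u, _, of_mem_grLayer v, rfl⟩

theorem map_of_mem_grLayer (hreg : IsEquiregular S.E) {x y : M} {χ : S.Gr x →ₗ[ℝ] S.Gr y}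
    (hbracket : ∀ a b, χ (S.grBracket x a b) = S.grBracket y (χ a) (χ b))
    (hone : ∀ u : S.GrPiece x 1, χ (DirectSum.of _ 1 u) ∈ grLayer S y 1) (k : ℕ)
    (a : S.GrPiece x k) : χ (DirectSum.of _ k a) ∈ grLayer S y k := by
  induction k with
  | zero =>
    rw [Subsingleton.elim a 0, map_zero, map_zero]
    exact Submodule.zero_mem _
  | succ k ih =>
    obtain rfl | hk := Nat.eq_zero_or_pos k
    · exact hone a
    · suffices hle : Submodule.span ℝ {c | ∃ (u : S.GrPiece x 1) (v : S.GrPiece x k),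
          S.grBracket x (DirectSum.of _ 1 u) (DirectSum.of _ k v) = c} ≤
          (grLayer S y (k + 1)).comap χ from hle (of_succ_mem_span hreg x hk a)
      rw [Submodule.span_le]
      rintro _ ⟨u, v, rfl⟩
      rw [SetLike.mem_coe, Submodule.mem_comap, hbracket, add_comm k 1]
      exact grBracket_mem_grLayer hreg (hone u) (ih v)

/-- The inner product of `gr_{x,-1}`, as a subspace of `gr_x`. -/
def grLayerInner (S : Structure n M) (x : M) : grLayer S x 1 →ₗ[ℝ] grLayer S x 1 →ₗ[ℝ] ℝ :=
  (grInnerₗ S x).compl₁₂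
    (DirectSum.component ℝ ℕ (S.GrPiece x) 1 ∘ₗ (grLayer S x 1).subtype)
    (DirectSum.component ℝ ℕ (S.GrPiece x) 1 ∘ₗ (grLayer S x 1).subtype)

theorem grLayerInner_pos (x : M) (a : grLayer S x 1) (ha : a ≠ 0) : 0 < grLayerInner S x a a := by
  obtain ⟨_, u, rfl⟩ := a
  refine grInner_pos x fun hzero => ha ?_
  obtain rfl : u = 0 := (DirectSum.of_eq_same 1 u).symm.trans hzero
  exact Subtype.ext (map_zero _)

theorem grBracket_self (hreg : IsEquiregular S.E) (x : M) (a : S.Gr x) :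
    S.grBracket x a a = 0 := by
  have : IsAddTorsionFree (S.Gr x) := .of_isTorsionFree ℝ _
  exact self_eq_neg.1 (grBracket_swap hreg x a a)

/-- The Lie ring structure of `gr_x`. -/
abbrev grLieRing (hreg : IsEquiregular S.E) (x : M) : LieRing (S.Gr x) where
  bracket := S.grBracket x
  add_lie := grBracket_add_left hreg x
  lie_add := grBracket_add_right hreg x
  lie_self := grBracket_self hreg x
  leibniz_lie := grBracket_jacobi hreg x

/-- The Lie algebra structure of `gr_x`. -/
abbrev grLieAlgebra (hreg : IsEquiregular S.E) (x : M) :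
    letI := grLieRing hreg x
    LieAlgebra ℝ (S.Gr x) :=
  letI := grLieRing hreg x
  { (inferInstance : Module ℝ (S.Gr x)) with lie_smul := grBracket_smul_right hreg x }

/-- The Carnot algebra `gr_x`. -/
def grCarnotAlgebra (hgen : IsBracketGenerating S.E) (hreg : IsEquiregular S.E) (x : M) :
    CarnotAlgebra where
  carrier := S.Gr x
  lieRing := grLieRing hreg x
  lieAlgebra := grLieAlgebra hreg x
  finiteDimensional := by
    obtain ⟨deg, Z, U, hx, hF⟩ := exists_isAdaptedFrame S hgen hreg x
    exact Module.Finite.equiv (hF.equivGr hx)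
  step := (exists_flag_eq_top hgen x).choose
  layer := grLayer S x
  layer_zero := grLayer_eq_bot
  layer_of_step_lt k hk := by
    have : Subsingleton (S.GrPiece x k) := subsingleton_grPiece <|
      (le_top.trans (exists_flag_eq_top hgen x).choose_spec.ge).trans
        (flag_mono S.E (Nat.le_sub_one_of_lt hk) x)
    exact grLayer_eq_bot
  isInternal := isInternal_range_lof ℝ (S.GrPiece x)
  lie_mem _ _ _ ha _ hb := grBracket_mem_grLayer hreg ha hb
  span_lie _ hk := span_grBracket hreg x hk
  inner := grLayerInner S x
  inner_symm _ _ := grInner_symm x _ _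
  inner_pos := grLayerInner_pos x

theorem GrIso.isIsometry (hgen : IsBracketGenerating S.E) (hreg : IsEquiregular S.E) {x y : M}
    (φ : GrIso S x y) : S.IsIsometry (grCarnotAlgebra hgen hreg x) y φ.toEquiv where
  map_lie := φ.map_bracket
  map_layer := by
    refine le_antisymm ?_ ?_
    · rintro _ ⟨_, ⟨u, rfl⟩, rfl⟩
      obtain ⟨b, hb⟩ := φ.map_of 1 u
      exact ⟨b, hb.symm⟩
    · rintro _ ⟨b, rfl⟩
      obtain ⟨A, hA⟩ := φ.toEquiv.surjective (DirectSum.of _ 1 b)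
      refine ⟨DirectSum.of _ 1 (A 1), of_mem_grLayer _, ?_⟩
      obtain ⟨c, hc⟩ := φ.map_of 1 (A 1)
      have hbc := apply_eq_apply_of φ.toEquiv φ.map_of A 1
      rw [hc, hA, DirectSum.of_eq_same, DirectSum.of_eq_same] at hbc
      exact hbc ▸ hc
  map_inner a b := φ.map_inner a.1 b.1

theorem hasConstantSymbol_of_isStronglyCompatible [ConnectedSpace M]
    (hgen : IsBracketGenerating S.E) (hreg : IsEquiregular S.E) {D : S.GrConnection}
    (hD : D.IsStronglyCompatible) : S.HasConstantSymbol := by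
  obtain ⟨x₀⟩ := (inferInstance : Nonempty M)
  refine ⟨grCarnotAlgebra hgen hreg x₀, fun x => ?_⟩
  obtain ⟨φ⟩ := nonempty_grIso_of_isStronglyCompatible hgen hreg hD x₀ x
  exact ⟨φ.toEquiv, φ.isIsometry hgen hreg⟩

namespace IsIsometry

variable {𝔤 : CarnotAlgebra} {x y : M} {φ : 𝔤.carrier ≃ₗ[ℝ] S.Gr x}
  {ψ : 𝔤.carrier ≃ₗ[ℝ] S.Gr y}

theorem apply_mem_grLayer (hφ : S.IsIsometry 𝔤 x φ) (a : 𝔤.layer 1) : φ a ∈ grLayer S x 1 :=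
  hφ.map_layer.le ⟨a, a.2, rfl⟩

theorem exists_apply_eq_of (hφ : S.IsIsometry 𝔤 x φ) (u : S.GrPiece x 1) :
    ∃ a : 𝔤.layer 1, φ a = DirectSum.of _ 1 u := by
  obtain ⟨a, ha, hau⟩ := hφ.map_layer.ge (of_mem_grLayer u)
  exact ⟨⟨a, ha⟩, hau⟩

theorem map_bracket (hφ : S.IsIsometry 𝔤 x φ) (hψ : S.IsIsometry 𝔤 y ψ) (a b : S.Gr x) :
    ψ (φ.symm (S.grBracket x a b)) = S.grBracket y (ψ (φ.symm a)) (ψ (φ.symm b)) := by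
  have hlie : φ ⁅φ.symm a, φ.symm b⁆ = S.grBracket x a b := by
    rw [hφ.map_lie, φ.apply_symm_apply, φ.apply_symm_apply]
  rw [← hlie, φ.symm_apply_apply, hψ.map_lie]

theorem map_of (hφ : S.IsIsometry 𝔤 x φ) (hψ : S.IsIsometry 𝔤 y ψ) (hreg : IsEquiregular S.E)
    (k : ℕ) (u : S.GrPiece x k) :
    ∃ v, ψ (φ.symm (DirectSum.of _ k u)) = DirectSum.of (S.GrPiece y) k v := by
  obtain ⟨v, hv⟩ := map_of_mem_grLayer (χ := (φ.symm.trans ψ).toLinearMap) hreg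
    (hφ.map_bracket hψ) (fun u => by
      obtain ⟨a, ha⟩ := hφ.exists_apply_eq_of u
      rw [← ha, LinearEquiv.coe_coe, LinearEquiv.trans_apply, φ.symm_apply_apply]
      exact hψ.apply_mem_grLayer a) k u
  exact ⟨v, hv.symm⟩

/-- The graded isometry `ψ ∘ φ⁻¹` between two fibers of `gr` isometric to `𝔤`. -/
def grIso (hφ : S.IsIsometry 𝔤 x φ) (hψ : S.IsIsometry 𝔤 y ψ) (hreg : IsEquiregular S.E) :
    GrIso S x y where
  toEquiv := φ.symm.trans ψ
  map_bracket := hφ.map_bracket hψ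
  map_of := hφ.map_of hψ hreg
  map_inner A B := by
    obtain ⟨a, ha⟩ := hφ.exists_apply_eq_of (A 1)
    obtain ⟨b, hb⟩ := hφ.exists_apply_eq_of (B 1)
    have hinner : S.grInner x (φ a 1) (φ b 1) = S.grInner y (ψ a 1) (ψ b 1) :=
      (hφ.map_inner a b).trans (hψ.map_inner a b).symm
    rw [apply_eq_apply_of _ (hφ.map_of hψ hreg) A, apply_eq_apply_of _ (hφ.map_of hψ hreg) B,
      ← ha, ← hb, LinearEquiv.trans_apply, LinearEquiv.trans_apply, φ.symm_apply_apply,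
      φ.symm_apply_apply, ← hinner, ha, hb, DirectSum.of_eq_same, DirectSum.of_eq_same]

end IsIsometry

theorem HasConstantSymbol.nonempty_grIso (hS : S.HasConstantSymbol) (hreg : IsEquiregular S.E)
    (x y : M) : Nonempty (GrIso S x y) := by
  obtain ⟨𝔤, h𝔤⟩ := hS
  obtain ⟨φ, hφ⟩ := h𝔤 x
  obtain ⟨ψ, hψ⟩ := h𝔤 y
  exact ⟨hφ.grIso hψ hreg⟩

end Structure

section Calculus

variable {n : ℕ} {M : Type*} [TopologicalSpace M] [ChartedSpace (EuclideanSpace ℝ (Fin n)) M]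
  [IsManifold (𝓡 n) ∞ M] {x : M}

theorem exists_coordVec_eq (v : TangentSpace (𝓡 n) x) : ∃ w, coordVec x x w = v :=
  ⟨_, Bundle.Trivialization.symmL_continuousLinearMapAt (R := ℝ) _
    (FiberBundle.mem_baseSet_trivializationAt' x) v⟩

theorem mvfderiv_clm_apply_apply {E F G : Type*} [NormedAddCommGroup E] [NormedSpace ℝ E]
    [NormedAddCommGroup F] [NormedSpace ℝ F] [NormedAddCommGroup G] [NormedSpace ℝ G]
    {T : M → E →L[ℝ] F →L[ℝ] G} {a : M → E} {b : M → F}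
    (hT : MDifferentiableAt (𝓡 n) 𝓘(ℝ, E →L[ℝ] F →L[ℝ] G) T x)
    (ha : MDifferentiableAt (𝓡 n) 𝓘(ℝ, E) a x) (hb : MDifferentiableAt (𝓡 n) 𝓘(ℝ, F) b x)
    (v : TangentSpace (𝓡 n) x) :
    mvfderiv (𝓡 n) (fun z => T z (a z) (b z)) x v = mvfderiv (𝓡 n) T x v (a x) (b x) +
      T x (mvfderiv (𝓡 n) a x v) (b x) + T x (a x) (mvfderiv (𝓡 n) b x v) := by
  obtain ⟨w, rfl⟩ := exists_coordVec_eq v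
  have hx := (eventually_mem_baseSet_tangentTriv n x).self_of_nhds
  have hproduct := (((hasFDerivAt_comp_chart_symm hx hT).clm_apply
    (hasFDerivAt_comp_chart_symm hx ha)).clm_apply (hasFDerivAt_comp_chart_symm hx hb))
  have heq := DFunLike.congr_fun ((hasFDerivAt_comp_chart_symm hx
    ((hT.clm_apply ha).clm_apply hb)).unique hproduct) w
  simp only [ContinuousLinearMap.comp_apply, Function.comp_apply, extChartAt_to_inv] at heq
  rw [heq]
  simp only [ContinuousLinearMap.flip_add, add_apply, ContinuousLinearMap.comp_apply,
    ContinuousLinearMap.flip_apply]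
  abel

end Calculus

/-- The operator `N` has the properties of a strongly compatible connection over `W`. -/
structure Structure.IsLocalConnection {n : ℕ} {M : Type*} [TopologicalSpace M]
    [ChartedSpace (EuclideanSpace ℝ (Fin n)) M] [IsManifold (𝓡 n) ∞ M] [T2Space M]
    (S : Structure n M) (W : Set M) (N : VField n M → (∀ x, S.Gr x) → ∀ x, S.Gr x) : Prop where
  smooth : ∀ Y A, IsSmooth Y → S.IsSmoothGr A → ∀ x ∈ W, SmoothGrAt (N Y A) x
  add_left : ∀ Y Y' A x, N (fun z => Y z + Y' z) A x = N Y A x + N Y' A x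
  smul_left : ∀ (f : M → ℝ) Y A x, N (fun z => f z • Y z) A x = f x • N Y A x
  add_right : ∀ Y A B, S.IsSmoothGr A → S.IsSmoothGr B →
    ∀ x ∈ W, N Y (fun z => A z + B z) x = N Y A x + N Y B x
  leibniz : ∀ (f : M → ℝ) Y A, ContMDiff (𝓡 n) 𝓘(ℝ, ℝ) ∞ f → S.IsSmoothGr A →
    ∀ x ∈ W, N Y (fun z => f z • A z) x = mvfderiv (𝓡 n) f x (Y x) • A x + f x • N Y A x
  parallel : ∀ k Y A, S.IsSmoothGr A → IsInDegree k A → ∀ x ∈ W, ∀ m, m ≠ k → N Y A x m = 0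
  metric : ∀ Y A B, S.IsSmoothGr A → S.IsSmoothGr B → ∀ x ∈ W,
    mvfderiv (𝓡 n) (fun z => S.grInner z (A z 1) (B z 1)) x (Y x) =
      S.grInner x (N Y A x 1) (B x 1) + S.grInner x (A x 1) (N Y B x 1)
  bracket : ∀ Y A B, S.IsSmoothGr A → S.IsSmoothGr B → ∀ x ∈ W,
    N Y (fun z => S.grBracket z (A z) (B z)) x =
      S.grBracket x (N Y A x) (B x) + S.grBracket x (A x) (N Y B x)

namespace IsAdaptedFrame

variable {n : ℕ} {M : Type*} [TopologicalSpace M] [ChartedSpace (EuclideanSpace ℝ (Fin n)) M]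
  [IsManifold (𝓡 n) ∞ M] {S : Structure n M} {deg : Fin n → ℕ} {Z : Fin n → VField n M}
  {U : Set M} (hF : IsAdaptedFrame S deg Z U)
  (Γ : ∀ x : M, TangentSpace (𝓡 n) x →ₗ[ℝ] ((Fin n → ℝ) →L[ℝ] (Fin n → ℝ)))
  {A B : ∀ x, S.Gr x} {x : M}

/-- The connection with matrix `Γ` in the frame. -/
def frameNabla (Y : VField n M) (A : ∀ x, S.Gr x) (x : M) : S.Gr x :=
  hF.toGr x (mvfderiv (𝓡 n) (fun z => hF.ofGr z (A z)) x (Y x) + Γ x (Y x) (hF.ofGr x (A x)))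

theorem frameNabla_add_left (Y Y' : VField n M) :
    hF.frameNabla Γ (fun z => Y z + Y' z) A x =
      hF.frameNabla Γ Y A x + hF.frameNabla Γ Y' A x := by
  simp only [frameNabla, map_add, add_apply]
  exact add_add_add_comm _ _ _ _

theorem frameNabla_smul_left (f : M → ℝ) (Y : VField n M) :
    hF.frameNabla Γ (fun z => f z • Y z) A x = f x • hF.frameNabla Γ Y A x := by
  simp only [frameNabla, map_smul, smul_apply, map_add]
  exact (smul_add _ _ _).symm

theorem ofGr_frameNabla (hx : x ∈ U) (Y : VField n M) :
    hF.ofGr x (hF.frameNabla Γ Y A x) =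
      mvfderiv (𝓡 n) (fun z => hF.ofGr z (A z)) x (Y x) + Γ x (Y x) (hF.ofGr x (A x)) :=
  hF.ofGr_toGr hx _

theorem mdifferentiableAt_ofGr [T2Space M] (hx : x ∈ U) (hA : Structure.SmoothGrAt A x) :
    MDifferentiableAt (𝓡 n) 𝓘(ℝ, Fin n → ℝ) (fun z => hF.ofGr z (A z)) x :=
  (hF.contMDiffAt_ofGr hx hA).mdifferentiableAt (by simp)

variable [T2Space M]

theorem frameNabla_add_right (hx : x ∈ U) (hA : Structure.SmoothGrAt A x)
    (hB : Structure.SmoothGrAt B x) (Y : VField n M) :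
    hF.frameNabla Γ Y (fun z => A z + B z) x =
      hF.frameNabla Γ Y A x + hF.frameNabla Γ Y B x := by
  have hderiv : mvfderiv (𝓡 n) (fun z => hF.ofGr z (A z) + hF.ofGr z (B z)) x (Y x) = _ :=
    DFunLike.congr_fun (mvfderiv_add (hF.mdifferentiableAt_ofGr hx hA)
      (hF.mdifferentiableAt_ofGr hx hB)) (Y x)
  simp only [frameNabla, map_add, hderiv, add_apply]
  exact add_add_add_comm _ _ _ _

theorem frameNabla_leibniz (hx : x ∈ U) {f : M → ℝ}
    (hf : MDifferentiableAt (𝓡 n) 𝓘(ℝ, ℝ) f x) (hA : Structure.SmoothGrAt A x)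
    (Y : VField n M) :
    hF.frameNabla Γ Y (fun z => f z • A z) x =
      mvfderiv (𝓡 n) f x (Y x) • A x + f x • hF.frameNabla Γ Y A x := by
  have hderiv : mvfderiv (𝓡 n) (fun z => f z • hF.ofGr z (A z)) x (Y x) =
      f x • mvfderiv (𝓡 n) (fun z => hF.ofGr z (A z)) x (Y x) +
        mvfderiv (𝓡 n) f x (Y x) • hF.ofGr x (A x) :=
    DFunLike.congr_fun (mvfderiv_smul hf (hF.mdifferentiableAt_ofGr hx hA)) (Y x)
  simp only [frameNabla, map_smul, map_add, hderiv, hF.toGr_ofGr hx, smul_add]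
  abel

/-- The form `Γ` is, over the open set `W`, the matrix of a connection that preserves the grading
and for which the structure tensor is parallel. -/
structure IsCompatibleForm (W : Set M) : Prop where
  isOpen : IsOpen W
  subset : W ⊆ U
  contMDiffAt : ∀ Y, IsSmooth Y → ∀ x ∈ W,
    ContMDiffAt (𝓡 n) 𝓘(ℝ, (Fin n → ℝ) →L[ℝ] (Fin n → ℝ)) ∞ (fun z => Γ z (Y z)) x
  commute : ∀ x ∈ W, ∀ v, Commute (Γ x v) (degreeOp deg)
  infAct_eq : ∀ x ∈ W, ∀ v, infAct (hF.tensor x) (Γ x v) = mvfderiv (𝓡 n) hF.tensor x v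

namespace IsCompatibleForm

variable {hF Γ} {W : Set M} (hΓ : hF.IsCompatibleForm Γ W) {Y : VField n M}

include hΓ

theorem smoothGrAt_frameNabla (hY : IsSmooth Y) (hA : S.IsSmoothGr A) (hx : x ∈ W) :
    Structure.SmoothGrAt (hF.frameNabla Γ Y A) x := by
  refine hF.smoothGrAt_toGr ?_
  filter_upwards [hΓ.isOpen.mem_nhds hx] with z hz
  have hAz := hF.contMDiffAt_ofGr (hΓ.subset hz) (Structure.isSmoothGr_iff.1 hA z)
  exact (contMDiffAt_mvfderiv_apply hAz hY).add ((hΓ.contMDiffAt Y hY z hz).clm_apply hAz)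

theorem frameNabla_apply_of_ne {k m : ℕ} (hA : Structure.SmoothGrAt A x)
    (hk : Structure.IsInDegree k A) (hx : x ∈ W) (hm : m ≠ k) :
    hF.frameNabla Γ Y A x m = 0 := by
  have hdegree (z : M) : degreeOp deg (hF.ofGr z (A z)) = (k : ℝ) • hF.ofGr z (A z) := by
    rw [Structure.eq_of_of_forall_ne (hk z), hF.degreeOp_ofGr_of]
  have hderiv : degreeOp deg (mvfderiv (𝓡 n) (fun z => hF.ofGr z (A z)) x (Y x)) =
      (k : ℝ) • mvfderiv (𝓡 n) (fun z => hF.ofGr z (A z)) x (Y x) := by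
    have hdiff := hF.mdifferentiableAt_ofGr (hΓ.subset hx) hA
    rw [← mvfderiv_clm_comp (degreeOp deg) hdiff]
    simp only [hdegree]
    exact mvfderiv_clm_comp ((k : ℝ) • ContinuousLinearMap.id ℝ (Fin n → ℝ)) hdiff (Y x)
  have hform : degreeOp deg (Γ x (Y x) (hF.ofGr x (A x))) =
      (k : ℝ) • Γ x (Y x) (hF.ofGr x (A x)) := by
    rw [← map_smul, ← hdegree]
    exact (DFunLike.congr_fun (hΓ.commute x hx (Y x)) (hF.ofGr x (A x))).symm
  rw [frameNabla, hF.toGr_eq_of x (k := k) (by rw [map_add, hderiv, hform, smul_add])]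
  exact DirectSum.of_eq_of_ne _ _ _ hm

theorem mvfderiv_tensor_ofGr (hreg : IsEquiregular S.E) (hA : Structure.SmoothGrAt A x)
    (hB : Structure.SmoothGrAt B x) (hx : x ∈ W) :
    mvfderiv (𝓡 n) (fun z => hF.tensor z (hF.ofGr z (A z)) (hF.ofGr z (B z))) x (Y x) =
      hF.tensor x (hF.ofGr x (hF.frameNabla Γ Y A x)) (hF.ofGr x (B x)) +
      hF.tensor x (hF.ofGr x (A x)) (hF.ofGr x (hF.frameNabla Γ Y B x)) -
      (Γ x (Y x) (hF.tensor x (hF.ofGr x (A x)) (hF.ofGr x (B x))).1, 0) := by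
  have hxU := hΓ.subset hx
  rw [mvfderiv_clm_apply_apply
    ((hF.contMDiffAt_tensor hreg hxU).mdifferentiableAt (by simp))
    (hF.mdifferentiableAt_ofGr hxU hA) (hF.mdifferentiableAt_ofGr hxU hB), ← hΓ.infAct_eq x hx,
    infAct_apply_apply, hF.ofGr_frameNabla Γ hxU, hF.ofGr_frameNabla Γ hxU, map_add, map_add,
    add_apply]
  abel

theorem mvfderiv_clm_comp_bracket_inner (hreg : IsEquiregular S.E)
    (hA : Structure.SmoothGrAt A x) (hB : Structure.SmoothGrAt B x) (hx : x ∈ W) {E : Type*}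
    [NormedAddCommGroup E] [NormedSpace ℝ E] (L : (Fin n → ℝ) × ℝ →L[ℝ] E) :
    mvfderiv (𝓡 n) (fun z =>
        L (hF.ofGr z (S.grBracket z (A z) (B z)), S.grInner z (A z 1) (B z 1))) x (Y x) =
      L (hF.ofGr x (S.grBracket x (hF.frameNabla Γ Y A x) (B x)) +
          hF.ofGr x (S.grBracket x (A x) (hF.frameNabla Γ Y B x)) -
          Γ x (Y x) (hF.ofGr x (S.grBracket x (A x) (B x))),
        S.grInner x (hF.frameNabla Γ Y A x 1) (B x 1) +
          S.grInner x (A x 1) (hF.frameNabla Γ Y B x 1)) := by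
  have hxU := hΓ.subset hx
  have hdiff := (((hF.contMDiffAt_tensor hreg hxU).mdifferentiableAt (by simp)).clm_apply
    (hF.mdifferentiableAt_ofGr hxU hA)).clm_apply (hF.mdifferentiableAt_ofGr hxU hB)
  rw [mvfderiv_congr (g := fun z => L (hF.tensor z (hF.ofGr z (A z)) (hF.ofGr z (B z)))),
    mvfderiv_clm_comp L hdiff, hΓ.mvfderiv_tensor_ofGr hreg hA hB hx, hF.tensor_ofGr hreg hxU,
    hF.tensor_ofGr hreg hxU, hF.tensor_ofGr hreg hxU]
  · exact congrArg L (Prod.ext rfl (sub_zero _))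
  · filter_upwards [hF.eventually_mem hxU] with z hz
    rw [hF.tensor_ofGr hreg hz]

theorem isLocalConnection_frameNabla (hreg : IsEquiregular S.E) :
    S.IsLocalConnection W (hF.frameNabla Γ) where
  smooth _ _ hY hA _ hx := hΓ.smoothGrAt_frameNabla hY hA hx
  add_left _ _ _ _ := hF.frameNabla_add_left Γ _ _
  smul_left _ _ _ _ := hF.frameNabla_smul_left Γ _ _
  add_right _ _ _ hA hB x hx := hF.frameNabla_add_right Γ (hΓ.subset hx)
    (Structure.isSmoothGr_iff.1 hA x) (Structure.isSmoothGr_iff.1 hB x) _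
  leibniz _ _ _ hf hA x hx := hF.frameNabla_leibniz Γ (hΓ.subset hx)
    ((hf x).mdifferentiableAt (by simp)) (Structure.isSmoothGr_iff.1 hA x) _
  parallel _ _ _ hA hk x hx _ hm :=
    hΓ.frameNabla_apply_of_ne (Structure.isSmoothGr_iff.1 hA x) hk hx hm
  metric _ _ _ hA hB x hx := hΓ.mvfderiv_clm_comp_bracket_inner hreg
    (Structure.isSmoothGr_iff.1 hA x) (Structure.isSmoothGr_iff.1 hB x) hx
    (ContinuousLinearMap.snd ℝ (Fin n → ℝ) ℝ)
  bracket Y A B hA hB x hx := by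
    have hderiv := hΓ.mvfderiv_clm_comp_bracket_inner (Y := Y) hreg
      (Structure.isSmoothGr_iff.1 hA x) (Structure.isSmoothGr_iff.1 hB x) hx
      (ContinuousLinearMap.fst ℝ (Fin n → ℝ) ℝ)
    simp only [ContinuousLinearMap.coe_fst'] at hderiv
    apply (hF.equivGr (hΓ.subset hx)).symm.injective
    change hF.ofGr x _ = hF.ofGr x _
    rw [hF.ofGr_frameNabla Γ (hΓ.subset hx), hderiv, map_add, sub_add_cancel]

end IsCompatibleForm

end IsAdaptedFrame

namespace IsAdaptedFrame

variable {n : ℕ} {M : Type*} [TopologicalSpace M] [ChartedSpace (EuclideanSpace ℝ (Fin n)) M]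
  [IsManifold (𝓡 n) ∞ M] [T2Space M] {S : Structure n M} {deg : Fin n → ℕ}
  {Z : Fin n → VField n M} {U : Set M} (hF : IsAdaptedFrame S deg Z U)

theorem exists_infAct_eq_mvfderiv (hreg : IsEquiregular S.E)
    (hiso : ∀ x y, Nonempty (Structure.GrIso S x y)) {x : M} (hx : x ∈ U)
    (v : TangentSpace (𝓡 n) x) : ∃ A, Commute A (degreeOp deg) ∧
      infAct (hF.tensor x) A = mvfderiv (𝓡 n) hF.tensor x v := by
  obtain ⟨w, rfl⟩ := exists_coordVec_eq v
  let line : ℝ → EuclideanSpace ℝ (Fin n) := fun t => extChartAt (𝓡 n) x x + t • w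
  have hline_zero : line 0 = extChartAt (𝓡 n) x x := by simp [line]
  have hline : HasDerivAt line w 0 := by
    simpa only [one_smul] using!
      ((hasDerivAt_id (0 : ℝ)).smul_const w).const_add (extChartAt (𝓡 n) x x)
  let curve : ℝ → M := fun t => (extChartAt (𝓡 n) x).symm (line t)
  have hcurve_zero : curve 0 = x := by simp only [curve, hline_zero, extChartAt_to_inv]
  have hcurve : Tendsto curve (𝓝 0) (𝓝 x) := by
    suffices ContinuousAt curve 0 by rwa [ContinuousAt, hcurve_zero] at this
    refine ContinuousAt.comp ?_ hline.continuousAt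
    rw [hline_zero]
    exact continuousAt_extChartAt_symm x
  have htensor := hasFDerivAt_comp_chart_symm
    (eventually_mem_baseSet_tangentTriv n x).self_of_nhds
    ((hF.contMDiffAt_tensor hreg hx).mdifferentiableAt (by simp))
  rw [← hline_zero] at htensor
  have hderiv := HasFDerivAt.comp_hasDerivAt (0 : ℝ) htensor hline
  have horbit : ∀ᶠ t in 𝓝 0,
      ∃ h, IsIntertwiner (degreeOp deg) h (hF.tensor (curve 0)) (hF.tensor (curve t)) := by
    rw [hcurve_zero]
    filter_upwards [hcurve.eventually (hF.eventually_mem hx)] with t ht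
    exact hF.exists_isIntertwiner_of_grIso hreg hx ht (hiso x _).some
  have htangent := exists_infAct_eq_of_hasDerivAt (T := fun t => hF.tensor (curve t)) hderiv
    (hcurve_zero.symm ▸ hF.isPositive_tensor hreg hx)
    (hcurve_zero.symm ▸ hF.isGeneratedInDegreeOne_tensor hreg hx) horbit
  rwa [hcurve_zero] at htangent

theorem exists_isCompatibleForm (hreg : IsEquiregular S.E)
    (hiso : ∀ x y, Nonempty (Structure.GrIso S x y)) {x₀ : M} (hx₀ : x₀ ∈ U) :
    ∃ Γ W, x₀ ∈ W ∧ hF.IsCompatibleForm Γ W := by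
  have hrank : ∀ᶠ x in 𝓝 x₀, Module.finrank ℝ (infStabilizer (degreeOp deg) (hF.tensor x)) =
      Module.finrank ℝ (infStabilizer (degreeOp deg) (hF.tensor x₀)) := by
    filter_upwards [hF.eventually_mem hx₀] with x hx
    obtain ⟨h, hh⟩ := hF.exists_isIntertwiner_of_grIso hreg hx₀ hx (hiso x₀ x).some
    exact hh.finrank_infStabilizer_eq (hF.isPositive_tensor hreg hx₀)
      (hF.isGeneratedInDegreeOne_tensor hreg hx)
  obtain ⟨G, hG⟩ := exists_contMDiffAt_infAct_inverse (D := degreeOp deg)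
    ((hF.eventually_mem hx₀).mono fun x hx => hF.contMDiffAt_tensor hreg hx) hrank
  obtain ⟨W, hW, hWo, hxW⟩ := eventually_nhds_iff.1 (hG.and (hF.eventually_mem hx₀))
  refine ⟨fun x => G x ∘ₗ (mvfderiv (𝓡 n) hF.tensor x : TangentSpace (𝓡 n) x →ₗ[ℝ] _), W, hxW,
    { isOpen := hWo
      subset := fun x hx => (hW x hx).2
      contMDiffAt := fun Y hY x hx => (hW x hx).1.1 _
        (contMDiffAt_mvfderiv_apply (hF.contMDiffAt_tensor hreg (hW x hx).2) hY)
      commute := fun x hx v => (hW x hx).1.2.1 _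
      infAct_eq := fun x hx v => ?_ }⟩
  obtain ⟨A, hA, hAv⟩ := hF.exists_infAct_eq_mvfderiv hreg hiso (hW x hx).2 v
  have hinverse := (hW x hx).1.2.2 A hA
  rwa [hAv] at hinverse

end IsAdaptedFrame

theorem sum_fintsupport_eq_one {n : ℕ} {M ι : Type*} [TopologicalSpace M]
    [ChartedSpace (EuclideanSpace ℝ (Fin n)) M] (ρ : SmoothPartitionOfUnity ι (𝓡 n) M) (x : M) :
    ∑ i ∈ ρ.fintsupport x, ρ i x = 1 :=
  ρ.sum_finsupport' x (mem_univ x) (ρ.finsupport_subset_fintsupport x)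

namespace Structure

variable {n : ℕ} {M : Type*} [TopologicalSpace M] [ChartedSpace (EuclideanSpace ℝ (Fin n)) M]
  [IsManifold (𝓡 n) ∞ M] {S : Structure n M} {ι : Type*}

theorem sum_smul_apply (s : Finset ι) (r : ι → ℝ) {x : M} (a : ι → S.Gr x) (k : ℕ) :
    (∑ i ∈ s, r i • a i) k = ∑ i ∈ s, r i • a i k := by
  rw [DFinsupp.finsetSum_apply]
  rfl

variable [T2Space M]

theorem IsLocalConnection.mono {W W' : Set M} {N : VField n M → (∀ x, S.Gr x) → ∀ x, S.Gr x}
    (hN : S.IsLocalConnection W N) (hW : W' ⊆ W) : S.IsLocalConnection W' N where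
  smooth Y A hY hA x hx := hN.smooth Y A hY hA x (hW hx)
  add_left := hN.add_left
  smul_left := hN.smul_left
  add_right Y A B hA hB x hx := hN.add_right Y A B hA hB x (hW hx)
  leibniz f Y A hf hA x hx := hN.leibniz f Y A hf hA x (hW hx)
  parallel k Y A hA hk x hx := hN.parallel k Y A hA hk x (hW hx)
  metric Y A B hA hB x hx := hN.metric Y A B hA hB x (hW hx)
  bracket Y A B hA hB x hx := hN.bracket Y A B hA hB x (hW hx)

variable {ρ : SmoothPartitionOfUnity ι (𝓡 n) M}
  {N : ι → VField n M → (∀ x, S.Gr x) → ∀ x, S.Gr x}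
  (hN : ∀ i, S.IsLocalConnection (tsupport (ρ i)) (N i))

include hN in
theorem smoothGrAt_sum_fintsupport {Y : VField n M} (hY : IsSmooth Y) {A : ∀ x, S.Gr x}
    (hA : S.IsSmoothGr A) (x₀ : M) :
    SmoothGrAt (fun x => ∑ i ∈ ρ.fintsupport x, ρ i x • N i Y A x) x₀ := by
  refine (SmoothGrAt.sum (ρ.fintsupport x₀) fun i hi =>
    ((hN i).smooth Y A hY hA x₀ ((ρ.mem_fintsupport_iff x₀ i).1 hi)).smul
      (ρ i).contMDiff).congr ?_
  filter_upwards [ρ.eventually_fintsupport_subset x₀] with x hx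
  refine Finset.sum_subset hx fun i _ hi => ?_
  rw [ρ.mem_fintsupport_iff] at hi
  rw [image_eq_zero_of_notMem_tsupport hi, zero_smul]

/-- The connection obtained by gluing local connections along a partition of unity. -/
def glueConnection : S.GrConnection where
  nabla Y A x := ∑ i ∈ ρ.fintsupport x, ρ i x • N i Y A x
  smooth _ _ hY hA := isSmoothGr_iff.2 (smoothGrAt_sum_fintsupport hN hY hA)
  add_left Y Y' A _ _ _ x := by
    simp only [(hN _).add_left, smul_add, Finset.sum_add_distrib]
  smul_left f Y A _ _ _ x := by
    simp only [(hN _).smul_left, Finset.smul_sum, smul_comm (f x)]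
  add_right Y A B _ hA hB x := by
    rw [← Finset.sum_add_distrib]
    refine Finset.sum_congr rfl fun i hi => ?_
    rw [(hN i).add_right Y A B hA hB x ((ρ.mem_fintsupport_iff x i).1 hi), smul_add]
  leibniz f Y A hf _ hA x := by
    calc ∑ i ∈ ρ.fintsupport x, ρ i x • N i Y (fun z => f z • A z) x
      _ = ∑ i ∈ ρ.fintsupport x,
          (ρ i x • mvfderiv (𝓡 n) f x (Y x) • A x + f x • ρ i x • N i Y A x) := by
        refine Finset.sum_congr rfl fun i hi => ?_
        rw [(hN i).leibniz f Y A hf hA x ((ρ.mem_fintsupport_iff x i).1 hi), smul_add,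
          smul_comm (f x)]
      _ = _ := by
        rw [Finset.sum_add_distrib, ← Finset.sum_smul, sum_fintsupport_eq_one,
          one_smul, Finset.smul_sum]

theorem isStronglyCompatible_glueConnection (hreg : IsEquiregular S.E) :
    (glueConnection hN).IsStronglyCompatible where
  parallel k Y A _ hA hk x m hm := by
    simp only [glueConnection, sum_smul_apply]
    refine Finset.sum_eq_zero fun i hi => ?_
    rw [(hN i).parallel k Y A hA hk x ((ρ.mem_fintsupport_iff x i).1 hi) m hm, smul_zero]
  metric Y A B _ hA hB _ _ x := by
    rw [← one_mul (mvfderiv (𝓡 n) _ x (Y x)), ← sum_fintsupport_eq_one ρ x, Finset.sum_mul,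
      Finset.sum_congr rfl fun i hi => congrArg (ρ i x * ·)
        ((hN i).metric Y A B hA hB x ((ρ.mem_fintsupport_iff x i).1 hi))]
    simp only [glueConnection, sum_smul_apply, ← grInnerₗ_apply, map_sum, map_smul,
      LinearMap.sum_apply, LinearMap.smul_apply, mul_add, Finset.sum_add_distrib, smul_eq_mul]
  bracket Y A B _ hA hB x := by
    simp only [glueConnection, grBracket_eq hreg, map_sum, map_smul, LinearMap.sum_apply,
      LinearMap.smul_apply]
    rw [← Finset.sum_add_distrib]
    refine Finset.sum_congr rfl fun i hi => ?_
    have hbracket := (hN i).bracket Y A B hA hB x ((ρ.mem_fintsupport_iff x i).1 hi)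
    simp only [grBracket_eq hreg] at hbracket
    rw [hbracket, smul_add]

theorem exists_isStronglyCompatible_of_local [SecondCountableTopology M]
    (hreg : IsEquiregular S.E)
    (hloc : ∀ x, ∃ W, IsOpen W ∧ x ∈ W ∧ ∃ N, S.IsLocalConnection W N) :
    ∃ D : S.GrConnection, D.IsStronglyCompatible := by
  choose W hWo hxW N hN using hloc
  have : LocallyCompactSpace M := ChartedSpace.locallyCompactSpace (EuclideanSpace ℝ (Fin n)) M
  obtain ⟨ρ, hρ⟩ := SmoothPartitionOfUnity.exists_isSubordinate (𝓡 n) isClosed_univ W hWo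
    (fun x _ => mem_iUnion.2 ⟨x, hxW x⟩)
  exact ⟨_, isStronglyCompatible_glueConnection (fun x => (hN x).mono (hρ x)) hreg⟩

theorem HasConstantSymbol.exists_isStronglyCompatible [SecondCountableTopology M]
    (hgen : IsBracketGenerating S.E) (hreg : IsEquiregular S.E) (hS : S.HasConstantSymbol) :
    ∃ D : S.GrConnection, D.IsStronglyCompatible := by
  refine exists_isStronglyCompatible_of_local hreg fun x => ?_
  obtain ⟨deg, Z, U, hx, hF⟩ := exists_isAdaptedFrame S hgen hreg x
  obtain ⟨Γ, W, hxW, hΓ⟩ := hF.exists_isCompatibleForm hreg (hS.nonempty_grIso hreg) hx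
  exact ⟨W, hΓ.isOpen, hxW, _, hΓ.isLocalConnection_frameNabla hreg⟩

end Structure

end SubRiemannian

end

theorem mainTheorem7 {n : ℕ} {M : Type*} [TopologicalSpace M]
    [ChartedSpace (EuclideanSpace ℝ (Fin n)) M] [IsManifold (𝓡 n) ∞ M]
    [T2Space M] [SecondCountableTopology M] [ConnectedSpace M]
    (S : SubRiemannian.Structure n M)
    (hgen : SubRiemannian.IsBracketGenerating S.E) (hreg : SubRiemannian.IsEquiregular S.E) :
    (∃ D : S.GrConnection, D.IsStronglyCompatible) ↔ S.HasConstantSymbol := by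
  constructor
  · rintro ⟨_, hD⟩
    exact SubRiemannian.Structure.hasConstantSymbol_of_isStronglyCompatible hgen hreg hD
  · intro hS
    exact hS.exists_isStronglyCompatible hgen hreg
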